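/- Setting. Let $H$ be a real inner product space with inner product $\langle\cdot,\cdot\rangle$ (for instance $H=L^2(\mathbb R^N;\mathbb R^K)$), let $V$ be a Banach space continuously embedded in $H$ (the energy space of $M$), and let $M:V\to V^*$ be a topological isomorphism that is Hermitian, $(Mv)(w)=(Mw)(v)$, and positive definite, $(Mv)(v)>0$ for $v\neq0$. An element $v\in V$ is identified with the functional $\langle v,\cdot\rangle\in V^*$. Let $L_{00}:V\to V^*$ be a nonlinear operator. For $\mu\in\mathbb R$ put $L_0u=L_{00}u-\mu u$, let $L_1=DL_{00}(u)-\mu:V\to V^*$ be the linearization of $L_0$ at $u$, let $L_1^\dagger$ be its adjoint, $(L_1^\dagger v)(w)=(L_1w)(v)$, and let $\langle u,u\rangle$ be the power of $u$. The power-conserving squared-operator method (PCSOM) with time step $\Delta t$ and prescribed power $P$ is $$u_{n+1}=\Big[\frac{P}{\langle\hat u_{n+1},\hat u_{n+1}\rangle}\Big]^{1/2}\hat u_{n+1},\qquad \hat u_{n+1}=u_n-M^{-1}\big[L_1^\dagger M^{-1}L_0u-\gamma u\big]_{u=u_n,\ \mu=\mu_n}\,\Delta t,$$ $$\gamma=\frac{\langle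 u,M^{-1}L_1^\dagger M^{-1}L_0u\rangle}{\langle u,M^{-1}u\rangle},\qquad \mu_n=\frac{\langle u,M^{-1}L_{00}u\rangle}{\langle u,M^{-1}u\rangle}\Big|_{u=u_n}.$$ Theorem. Let $u(\mu',c)\in V$, with $c=(c_1,\dots,c_s)$ ($s\ge0$), be a family of solutions of $L_{00}v=\mu'v$ that is defined and continuously differentiable for $(\mu',c)$ near $(\mu,c^0)$, let $u=u(\mu,c^0)$, and let $L_{00}$ be differentiable with Lipschitz continuous derivative near $u$. Assume that 1. the kernel of $L_1$ (at $u$, $\mu$) is spanned by the invariance modes $\partial u/\partial c_j$, $1\le j\le s$, at $(\mu,c^0)$; 2. $u$ is orthogonal to the kernel of $L_1$; 3. $P'(\mu)\ne0$, where $P(\mu')=\langle u(\mu',c^0),u(\mu',c^0)\rangle$. Let $P=\langle u,u\rangle$, let $S=\{\Psi\in V:\langle\Psi,u\rangle=0\}$, and let $\mathcal L_{PC}:S\to S$ be $$\mathcal L_{PC}\Psi=M^{-1}(\hat L\Psi-\hat\gamma u),\qquad \hat L\Psi=-L_1^\dagger M^{-1}(L_1\Psi-\beta u),$$ $$\hat\gamma=\frac{\langle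 u,M^{-1}\hat L\Psi\rangle}{\langle u,M^{-1}u\rangle},\qquad \beta=\frac{\langle u,M^{-1}L_1\Psi\rangle}{\langle u,M^{-1}u\rangle}.$$ Let $\Lambda_{\min}$ be the minimum of the spectrum of $\mathcal L_{PC}$, assume that $\Lambda_{\min}\ne0$, and put $\Delta t_{\max}=-2/\Lambda_{\min}$. (a) Let zero not be in the continuous spectrum of $L_1$, that is, let the range of $L_1$ be closed in $V^*$. If $0<\Delta t<\Delta t_{\max}$, then the PCSOM with power $P$ converges to the solitary wave $u$, up to a small shift of the constants of the family, for all initial conditions close to $u$: for every $\varepsilon>0$ there is a $\delta>0$ such that, whenever $\|u_0-u\|_V<\delta$, all iterates satisfy $\|u_n-u\|_V<\varepsilon$, and there are constants $(\mu',c')$ with $|\mu'-\mu|<\varepsilon$, $\|c'-c^0\|<\varepsilon$ such that $u(\mu',c')$ solves $L_{00}v=\mu'v$ and has power $P$, $u_n\to u(\mu',c')$ in $V$ and $\mu_n\to\mu'$. (b) If $\Delta t>\Delta t_{\max}$, then the PCSOM with power $P$ diverges from $u$: there is an $\varepsilon>0$ such that arbitrarily close to $u$ there are initial conditions of power $P$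 for which $\|u_n-u\|_V\ge\varepsilon$ for some $n$. If moreover the interval $[\Lambda_{\min},-2/\Delta t]$ is not entirely contained in the spectrum of $\mathcal L_{PC}$ (in particular, if $\Lambda_{\min}$ is an isolated eigenvalue), then the divergence is generic: for some $\varepsilon>0$, the initial conditions of power $P$ for which $\|u_n-u\|_V\ge\varepsilon$ for some $n$ are dense among the functions $v$ of power $P$ with $\|v-u\|_V<\varepsilon$. -/

import Mathlib

open Filter Topology

noncomputable section

/-- An acceleration operator: a real, positive-definite, Hermitian operator `M`, acting as an
isomorphism from its energy space `V` onto the dual of `V`. The value `op v w` is the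
pairing of `M v` with `w`. -/
structure AccelerationOperator (V : Type*) [NormedAddCommGroup V] [NormedSpace ℝ V] where
  op : V ≃L[ℝ] StrongDual ℝ V
  hermitian : ∀ v w : V, op v w = op w v
  posDef : ∀ v : V, v ≠ 0 → 0 < op v v

namespace PCSOM

section Definitions

variable {V H : Type*} [NormedAddCommGroup V] [NormedSpace ℝ V]
  [NormedAddCommGroup H] [InnerProductSpace ℝ H]

/-- The inner product `⟨v, w⟩` of `H` (the `L²` inner product when `H` is `L²`), for
elements of `V`; `ι` is the inclusion of `V` in `H`. -/
def ip (ι : V →L[ℝ] H) (v w : V) : ℝ := inner ℝ (ι v) (ι w)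

/-- The power `⟨v, v⟩`. -/
def power (ι : V →L[ℝ] H) (v : V) : ℝ := ip ι v v

/-- The element `v` of `V` regarded as an element `⟨v, ·⟩` of the dual of `V`. -/
def embed (ι : V →L[ℝ] H) : V →L[ℝ] StrongDual ℝ V := (innerSL ℝ).bilinearComp ι ι

theorem embed_apply (ι : V →L[ℝ] H) (v w : V) : embed ι v w = ip ι v w := rfl

/-- `M⁻¹`. -/
def Minv (M : AccelerationOperator V) : StrongDual ℝ V →L[ℝ] V := M.op.symm

/-- `⟨u, M⁻¹ u⟩`. -/
def denom (ι : V →L[ℝ] H) (M : AccelerationOperator V) (u : V) : ℝ :=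
  ip ι u (Minv M (embed ι u))

/-- `L₀ u = L₀₀ u - μ u`. -/
def L0 (ι : V →L[ℝ] H) (L00 : V → StrongDual ℝ V) (μ : ℝ) (u : V) : StrongDual ℝ V :=
  L00 u - μ • embed ι u

/-- `L₁`, the linearization of `L₀` (with `μ` fixed) at `u`. -/
def L1 (ι : V →L[ℝ] H) (L00 : V → StrongDual ℝ V) (μ : ℝ) (u : V) :
    V →L[ℝ] StrongDual ℝ V :=
  fderiv ℝ L00 u - μ • embed ι

/-- The adjoint `L₁†`: the pairing of `L₁† v` with `w` is the pairing of `L₁ w` with `v`. -/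
def L1adj (ι : V →L[ℝ] H) (L00 : V → StrongDual ℝ V) (μ : ℝ) (u : V) :
    V →L[ℝ] StrongDual ℝ V :=
  (L1 ι L00 μ u).flip

/-! ### The iteration -/

/-- The Rayleigh quotient `⟨u, M⁻¹ L₀₀ u⟩ / ⟨u, M⁻¹ u⟩` that gives `μₙ` from `u = uₙ`. -/
def rayleigh (ι : V →L[ℝ] H) (M : AccelerationOperator V) (L00 : V → StrongDual ℝ V)
    (u : V) : ℝ :=
  ip ι u (Minv M (L00 u)) / denom ι M u

/-- `L₁† M⁻¹ L₀ u`, with `L₀` and `L₁` taken at `u` and at the given `μ`. -/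
def squaredTerm (ι : V →L[ℝ] H) (M : AccelerationOperator V) (L00 : V → StrongDual ℝ V)
    (μ : ℝ) (u : V) : StrongDual ℝ V :=
  L1adj ι L00 μ u (Minv M (L0 ι L00 μ u))

/-- `γ = ⟨u, M⁻¹ L₁† M⁻¹ L₀ u⟩ / ⟨u, M⁻¹ u⟩`. -/
def gam (ι : V →L[ℝ] H) (M : AccelerationOperator V) (L00 : V → StrongDual ℝ V)
    (μ : ℝ) (u : V) : ℝ :=
  ip ι u (Minv M (squaredTerm ι M L00 μ u)) / denom ι M u

/-- The predictor `û = u - M⁻¹ [L₁† M⁻¹ L₀ u - γ u] Δt`, evaluated at `μ = μₙ`. -/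
def predictor (ι : V →L[ℝ] H) (M : AccelerationOperator V) (L00 : V → StrongDual ℝ V)
    (Δt : ℝ) (u : V) : V :=
  u - Δt • Minv M (squaredTerm ι M L00 (rayleigh ι M L00 u) u
    - gam ι M L00 (rayleigh ι M L00 u) u • embed ι u)

/-- One step of the method: `[P / ⟨û, û⟩]^(1/2) û`. -/
def step (ι : V →L[ℝ] H) (M : AccelerationOperator V) (L00 : V → StrongDual ℝ V)
    (P Δt : ℝ) (u : V) : V :=
  √(P / power ι (predictor ι M L00 Δt u)) • predictor ι M L00 Δt u

/-- The iterates `uₙ` started at `u₀`. -/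
def iterates (ι : V →L[ℝ] H) (M : AccelerationOperator V) (L00 : V → StrongDual ℝ V)
    (P Δt : ℝ) (u₀ : V) (n : ℕ) : V :=
  (step ι M L00 P Δt)^[n] u₀

/-! ### The linearized iteration operator -/

/-- `β`, as a functional of `Ψ`: `⟨u, M⁻¹ L₁ Ψ⟩ / ⟨u, M⁻¹ u⟩`. -/
def beta (ι : V →L[ℝ] H) (M : AccelerationOperator V) (L00 : V → StrongDual ℝ V)
    (μ : ℝ) (u : V) : StrongDual ℝ V :=
  (denom ι M u)⁻¹ • (embed ι u ∘L Minv M ∘L L1 ι L00 μ u)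

/-- `L̂ Ψ = -L₁† M⁻¹ (L₁ Ψ - β u)`. -/
def Lhat (ι : V →L[ℝ] H) (M : AccelerationOperator V) (L00 : V → StrongDual ℝ V)
    (μ : ℝ) (u : V) : V →L[ℝ] StrongDual ℝ V :=
  -(L1adj ι L00 μ u ∘L Minv M ∘L
    (L1 ι L00 μ u - (beta ι M L00 μ u).smulRight (embed ι u)))

/-- `γ̂`, as a functional of `Ψ`: `⟨u, M⁻¹ L̂ Ψ⟩ / ⟨u, M⁻¹ u⟩`. -/
def gammaHat (ι : V →L[ℝ] H) (M : AccelerationOperator V) (L00 : V → StrongDual ℝ V)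
    (μ : ℝ) (u : V) : StrongDual ℝ V :=
  (denom ι M u)⁻¹ • (embed ι u ∘L Minv M ∘L Lhat ι M L00 μ u)

/-- `𝓛_PC Ψ = M⁻¹ (L̂ Ψ - γ̂ u)`, on all of `V`. -/
def LPCfull (ι : V →L[ℝ] H) (M : AccelerationOperator V) (L00 : V → StrongDual ℝ V)
    (μ : ℝ) (u : V) : V →L[ℝ] V :=
  Minv M ∘L (Lhat ι M L00 μ u - (gammaHat ι M L00 μ u).smulRight (embed ι u))

/-- The space `S = {Ψ : ⟨Ψ, u⟩ = 0}`. -/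
def orthSpace (ι : V →L[ℝ] H) (u : V) : Submodule ℝ V :=
  LinearMap.ker (embed ι u : V →ₗ[ℝ] ℝ)

theorem mem_orthSpace (ι : V →L[ℝ] H) (u Ψ : V) :
    Ψ ∈ orthSpace ι u ↔ ip ι Ψ u = 0 := by
  simp only [orthSpace, LinearMap.mem_ker, ContinuousLinearMap.coe_coe, embed_apply]
  rw [ip, ip, real_inner_comm]

theorem denom_ne_zero (ι : V →L[ℝ] H) (M : AccelerationOperator V) (u : V)
    (hu : embed ι u ≠ 0) : denom ι M u ≠ 0 := by
  have h1 : Minv M (embed ι u) ≠ 0 := by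
    intro h
    exact hu (M.op.symm.map_eq_zero_iff.mp h)
  have h2 := M.posDef _ h1
  have h3 : M.op (Minv M (embed ι u)) = embed ι u := M.op.apply_symm_apply _
  rw [h3] at h2
  exact h2.ne'

theorem LPCfull_mem (ι : V →L[ℝ] H) (M : AccelerationOperator V) (L00 : V → StrongDual ℝ V)
    (μ : ℝ) (u Ψ : V) : LPCfull ι M L00 μ u Ψ ∈ orthSpace ι u := by
  by_cases hu : embed ι u = 0
  · simp [orthSpace, hu]
  · have hd := denom_ne_zero ι M u hu
    have hd' : embed ι u (Minv M (embed ι u)) = denom ι M u := rfl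
    simp only [orthSpace, LinearMap.mem_ker, ContinuousLinearMap.coe_coe, LPCfull, gammaHat,
      ContinuousLinearMap.comp_apply, _root_.sub_apply,
      ContinuousLinearMap.smulRight_apply, _root_.smul_apply, map_sub, map_smul,
      smul_eq_mul, hd']
    field_simp
    ring

/-- The iteration operator `𝓛_PC` on the space `S`. -/
def LPC (ι : V →L[ℝ] H) (M : AccelerationOperator V) (L00 : V → StrongDual ℝ V)
    (μ : ℝ) (u : V) : orthSpace ι u →L[ℝ] orthSpace ι u :=
  ((LPCfull ι M L00 μ u).comp (orthSpace ι u).subtypeL).codRestrict (orthSpace ι u)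
    (fun Ψ => LPCfull_mem ι M L00 μ u Ψ)

/-! ### Solution families and the two asymptotic behaviours -/

/-- `U μ' c` is, for `(μ', c)` near `(μ, c₀)`, a continuously differentiable family of
solutions of `L₀₀ v = μ' v`, with free real parameters `c = (c₁, …, c_s)`. -/
def IsSolutionFamily (ι : V →L[ℝ] H) (L00 : V → StrongDual ℝ V) {s : ℕ}
    (U : ℝ → (Fin s → ℝ) → V) (μ : ℝ) (c₀ : Fin s → ℝ) : Prop :=
  ContDiffAt ℝ 1 (fun p : ℝ × (Fin s → ℝ) => U p.1 p.2) (μ, c₀) ∧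
    ∀ᶠ p : ℝ × (Fin s → ℝ) in 𝓝 (μ, c₀), L0 ι L00 p.1 (U p.1 p.2) = 0

/-- The invariance mode `∂U/∂c_j` at `(μ, c₀)`. -/
def invarianceMode {s : ℕ} (U : ℝ → (Fin s → ℝ) → V) (μ : ℝ) (c₀ : Fin s → ℝ)
    (j : Fin s) : V :=
  lineDeriv ℝ (U μ) c₀ (Pi.single j 1)

/-- The method with time step `Δt` and power `P` converges for initial conditions close to
the solitary wave `U μ c₀`: if `u₀` is close enough to it, then all iterates stay close, and
they converge to a solitary wave of power `P` whose constants `(μ', c')` are as close to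
`(μ, c₀)` as desired; the `μₙ` converge to its propagation constant. -/
def ConvergesNear (ι : V →L[ℝ] H) (M : AccelerationOperator V) (L00 : V → StrongDual ℝ V)
    {s : ℕ} (U : ℝ → (Fin s → ℝ) → V) (μ : ℝ) (c₀ : Fin s → ℝ) (P Δt : ℝ) : Prop :=
  ∀ ε > 0, ∃ δ > 0, ∀ u₀ : V, ‖u₀ - U μ c₀‖ < δ →
    (∀ n, ‖iterates ι M L00 P Δt u₀ n - U μ c₀‖ < ε) ∧
    ∃ (μ' : ℝ) (c' : Fin s → ℝ), |μ' - μ| < ε ∧ ‖c' - c₀‖ < ε ∧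
      L0 ι L00 μ' (U μ' c') = 0 ∧ power ι (U μ' c') = P ∧
      Tendsto (iterates ι M L00 P Δt u₀) atTop (𝓝 (U μ' c')) ∧
      Tendsto (fun n => rayleigh ι M L00 (iterates ι M L00 P Δt u₀ n)) atTop (𝓝 μ')

/-- The method diverges from `u`: arbitrarily close to `u` there are initial conditions of
power `P` whose iterates leave a fixed neighbourhood of `u`. -/
def DivergesFrom (ι : V →L[ℝ] H) (M : AccelerationOperator V) (L00 : V → StrongDual ℝ V)
    (u : V) (P Δt : ℝ) : Prop :=
  ∃ ε > 0, ∀ δ > 0, ∃ u₀ : V, ‖u₀ - u‖ < δ ∧ power ι u₀ = P ∧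
    ∃ n, ε ≤ ‖iterates ι M L00 P Δt u₀ n - u‖

/-- The method diverges from `u` for generic initial conditions: among the initial conditions
of power `P` in a neighbourhood of `u`, those whose iterates leave this neighbourhood are
dense. -/
def DivergesGenerically (ι : V →L[ℝ] H) (M : AccelerationOperator V)
    (L00 : V → StrongDual ℝ V) (u : V) (P Δt : ℝ) : Prop :=
  ∃ ε > 0, ∀ v : V, ‖v - u‖ < ε → power ι v = P → ∀ δ > 0,
    ∃ u₀ : V, ‖u₀ - v‖ < δ ∧ power ι u₀ = P ∧
      ∃ n, ε ≤ ‖iterates ι M L00 P Δt u₀ n - u‖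

end Definitions

end PCSOM

end

/-! With `R v = M⁻¹ L₀ v`, where `μ` is the Rayleigh quotient of `v`, one step moves `v` by a linear
operator applied to `R v` and then rescales to power `P`. Since `R` vanishes at `u`, the derivative
of the step there involves only the derivative `B` of `R`. On `S` it is `1 + Δt 𝓛_PC`, and `𝓛_PC =
-B*B` with respect to the form of `M` (`op_LPCfull`), so `𝓛_PC` is symmetric and nonpositive. The
form of `M` is equivalent to the square of the norm, so the least spectral value controls the
quadratic form, and every spectral value has approximate eigenvectors.

Convergence. On `S` the kernel of `B` is the kernel `K` of `L₁`: `B y = 0` gives `L₁ y = β u = β L₁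
∂u/∂μ`, and pairing `y - β ∂u/∂μ ∈ K` with `u` gives `β P'(μ) = 0`. With closed range, `B` is
bounded below modulo `K`, and `1 + Δt 𝓛_PC` contracts the part of `S` that is `M`-orthogonal to `K`.
The neutral directions in `K` are handled by comparing each iterate with an exact solution of power
`P` having the same `K`-component (`IsSolutionFamily.exists_nearby`). Relative to it, the increment
of the step is nearly `Δt 𝓛_PC y`, which is `M`-orthogonal to `K` and controls `y`. Hence successive
increments contract (`exists_contracting_increments`), the iterates form a Cauchy sequence, and the
limit is a member of the family.

Divergence. Beyond the threshold, `1 + Δt 𝓛_PC` has energy norm at most `r = -(1 + Δt Λmin) > 1` on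
`S`, and this rate is approximately attained. A start along an approximate eigenvector grows like `r
^ n`, while the accumulated nonlinear error is quadratic in the current size, so the orbit reaches a
fixed distance (`Seminorm.half_mul_pow_le_of_quadratic_recursion`).

Generic divergence. For `ν` outside the spectrum with `Λmin < ν < -2/Δt`, the indefinite form of `ν
- 𝓛_PC` is expanded by the step on differences of elements of equal power
(`exists_gapForm_expanding`). Two orbits whose initial difference is positive for this form cannot
both stay near `u`, and any initial condition has such a partner arbitrarily close to it. -/

noncomputable section

/-! ### Calculus of maps whose linearization error at one point is locally quadratic -/

section LipschitzDerivative

set_option linter.unusedSectionVars false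

open Asymptotics

variable {E F G : Type*} [NormedAddCommGroup E] [NormedSpace ℝ E]
  [NormedAddCommGroup F] [NormedSpace ℝ F] [NormedAddCommGroup G] [NormedSpace ℝ G]

/-- `f` is Lipschitz continuous in a neighbourhood of `u`. -/
def LipschitzNear (f : E → F) (u : E) : Prop :=
  (fun p : E × E => f p.1 - f p.2) =O[𝓝 (u, u)] fun p => p.1 - p.2

/-- `f` is differentiable at `u` with derivative `f'`, and the remainder has a Lipschitz constant
that is linear in the distance to `u`. -/
def HasLipFDerivAt (f : E → F) (f' : E →L[ℝ] F) (u : E) : Prop :=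
  (fun p : E × E => f p.1 - f p.2 - f' (p.1 - p.2)) =O[𝓝 (u, u)]
    fun p => (‖p.1 - u‖ + ‖p.2 - u‖) * ‖p.1 - p.2‖

theorem tendsto_norm_sub_add (u : E) :
    Tendsto (fun p : E × E => ‖p.1 - u‖ + ‖p.2 - u‖) (𝓝 (u, u)) (𝓝 0) := by
  have : Continuous fun p : E × E => ‖p.1 - u‖ + ‖p.2 - u‖ := by fun_prop
  simpa using this.tendsto (u, u)

namespace HasLipFDerivAt

variable {f : E → F} {f' : E →L[ℝ] F} {g : F → G} {g' : F →L[ℝ] G} {u : E}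

theorem hasStrictFDerivAt (h : HasLipFDerivAt f f' u) : HasStrictFDerivAt f f' u := by
  refine .of_isLittleO (IsBigO.trans_isLittleO h ?_)
  have h1 : (fun p : E × E => ‖p.1 - u‖ + ‖p.2 - u‖) =o[𝓝 (u, u)] fun _ => (1 : ℝ) :=
    (isLittleO_one_iff ℝ).2 (tendsto_norm_sub_add u)
  have h2 := h1.mul_isBigO (isBigO_refl (fun p : E × E => ‖p.1 - p.2‖) (𝓝 (u, u)))
  simp only [one_mul] at h2
  exact h2.of_norm_right

theorem hasFDerivAt (h : HasLipFDerivAt f f' u) : HasFDerivAt f f' u :=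
  h.hasStrictFDerivAt.hasFDerivAt

theorem continuousAt (h : HasLipFDerivAt f f' u) : ContinuousAt f u :=
  h.hasStrictFDerivAt.continuousAt

theorem lipschitzNear (h : HasLipFDerivAt f f' u) : LipschitzNear f u :=
  h.hasStrictFDerivAt.isBigO_sub

theorem of_eq {f'' : E →L[ℝ] F} (h : HasLipFDerivAt f f' u) (e : f' = f'') :
    HasLipFDerivAt f f'' u := e ▸ h

end HasLipFDerivAt

theorem LipschitzNear.continuousAt {f : E → F} {u : E} (h : LipschitzNear f u) :
    ContinuousAt f u := by
  have h1 : Tendsto (fun v : E => (v, u)) (𝓝 u) (𝓝 (u, u)) :=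
    (Continuous.prodMk_left u).tendsto u
  have h2 := (h.comp_tendsto h1).trans_tendsto (by
    have : Continuous fun v : E => v - u := by fun_prop
    simpa [Function.comp_def] using this.tendsto u)
  exact tendsto_sub_nhds_zero_iff.1 h2

theorem ContinuousAt.tendsto_prodMap {f : E → F} {u : E} (h : ContinuousAt f u) :
    Tendsto (fun p : E × E => (f p.1, f p.2)) (𝓝 (u, u)) (𝓝 (f u, f u)) := by
  rw [nhds_prod_eq, nhds_prod_eq]
  exact Tendsto.prodMap h h

theorem LipschitzNear.comp {f : E → F} {g : F → G} {u : E} (hg : LipschitzNear g (f u))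
    (hf : LipschitzNear f u) : LipschitzNear (fun v => g (f v)) u :=
  (hg.comp_tendsto hf.continuousAt.tendsto_prodMap).trans hf

theorem LipschitzNear.prodMk {f : E → F} {g : E → G} {u : E} (hf : LipschitzNear f u)
    (hg : LipschitzNear g u) : LipschitzNear (fun v => (f v, g v)) u :=
  IsBigO.prod_left hf hg

theorem LipschitzNear.of_lipschitzOnWith {f : E → F} {u : E} {K : NNReal} {W : Set E}
    (hW : W ∈ 𝓝 u) (h : LipschitzOnWith K f W) : LipschitzNear f u := by
  refine IsBigO.of_bound K ?_
  rw [nhds_prod_eq]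
  filter_upwards [prod_mem_prod hW hW] with p hp
  exact h.norm_sub_le hp.1 hp.2

theorem ContDiffAt.lipschitzNear {f : E → F} {u : E} (h : ContDiffAt ℝ 1 f u) :
    LipschitzNear f u :=
  (h.hasStrictFDerivAt one_ne_zero).isBigO_sub

/-- Mean value inequality on the closed ball about `u` reaching the farther of the two points: there
the derivative differs from its value at `u` by at most a constant times the radius. -/
theorem HasLipFDerivAt.of_lipschitzNear_fderiv {f : E → F} {u : E}
    (hd : ∀ᶠ v in 𝓝 u, DifferentiableAt ℝ f v) (hl : LipschitzNear (fderiv ℝ f) u) :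
    HasLipFDerivAt f (fderiv ℝ f u) u := by
  obtain ⟨K, hK0, hK⟩ := hl.exists_pos
  have hK := hK.bound
  have h1 : Tendsto (fun v : E => (v, u)) (𝓝 u) (𝓝 (u, u)) :=
    (Continuous.prodMk_left u).tendsto u
  obtain ⟨r, hr, hball⟩ := Metric.eventually_nhds_iff_ball.1 (hd.and (h1.eventually hK))
  refine IsBigO.of_bound K ?_
  rw [nhds_prod_eq]
  filter_upwards [prod_mem_prod (Metric.ball_mem_nhds u hr) (Metric.ball_mem_nhds u hr)]
    with ⟨v, w⟩ ⟨hv, hw⟩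
  have hs : Metric.closedBall u (max ‖v - u‖ ‖w - u‖) ⊆ Metric.ball u r := by
    refine Metric.closedBall_subset_ball (max_lt ?_ ?_)
    · simpa [dist_eq_norm] using hv
    · simpa [dist_eq_norm] using hw
  have := (convex_closedBall u (max ‖v - u‖ ‖w - u‖)).norm_image_sub_le_of_norm_fderiv_le'
    (f := f) (φ := fderiv ℝ f u) (C := K * max ‖v - u‖ ‖w - u‖) (x := w) (y := v)
    (fun x hx => (hball x (hs hx)).1)
    (fun x hx => ((hball x (hs hx)).2).trans (by
      gcongr
      simpa [dist_eq_norm] using hx))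
    (by simp [dist_eq_norm]) (by simp [dist_eq_norm])
  refine this.trans ?_
  rw [norm_mul, norm_norm, ← mul_assoc]
  gcongr
  rw [Real.norm_of_nonneg (by positivity)]
  exact max_le (by simp) (by simp)

theorem ContDiffAt.hasLipFDerivAt {f : E → F} {u : E} (h : ContDiffAt ℝ 2 f u) :
    HasLipFDerivAt f (fderiv ℝ f u) u := by
  refine .of_lipschitzNear_fderiv ?_ ?_
  · filter_upwards [h.eventually (by simp)] with v hv
    exact hv.differentiableAt (by simp)
  · exact ContDiffAt.lipschitzNear (h.fderiv_right (m := 1) (by norm_num))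

namespace HasLipFDerivAt

variable {f : E → F} {f' : E →L[ℝ] F} {g : F → G} {g' : F →L[ℝ] G} {u : E}

theorem comp (hg : HasLipFDerivAt g g' (f u)) (hf : HasLipFDerivAt f f' u) :
    HasLipFDerivAt (fun v => g (f v)) (g' ∘L f') u := by
  have hl := hf.lipschitzNear
  have h0 : (fun p : E × E => ‖f p.1 - f u‖ + ‖f p.2 - f u‖) =O[𝓝 (u, u)]
      fun p => ‖p.1 - u‖ + ‖p.2 - u‖ := by
    have ht1 : Tendsto (fun p : E × E => (p.1, u)) (𝓝 (u, u)) (𝓝 (u, u)) := by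
      have : Continuous fun p : E × E => (p.1, u) := by fun_prop
      exact this.tendsto (u, u)
    have ht2 : Tendsto (fun p : E × E => (p.2, u)) (𝓝 (u, u)) (𝓝 (u, u)) := by
      have : Continuous fun p : E × E => (p.2, u) := by fun_prop
      exact this.tendsto (u, u)
    refine IsBigO.add ?_ ?_
    · refine ((hl.comp_tendsto ht1).norm_left.trans (IsBigO.of_bound 1 (.of_forall fun p => ?_)))
      simp only [Function.comp_apply, one_mul]
      rw [Real.norm_of_nonneg (by positivity)]
      simp
    · refine ((hl.comp_tendsto ht2).norm_left.trans (IsBigO.of_bound 1 (.of_forall fun p => ?_)))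
      simp only [Function.comp_apply, one_mul]
      rw [Real.norm_of_nonneg (by positivity)]
      simp
  have h1 := (hg.comp_tendsto hf.continuousAt.tendsto_prodMap).trans (h0.mul hl.norm_norm)
  have h2 := (g'.isBigO_comp (fun p : E × E => f p.1 - f p.2 - f' (p.1 - p.2)) (𝓝 (u, u))).trans hf
  refine (h1.add h2).congr_left fun p => ?_
  simp [map_sub]

theorem prodMk {g : E → G} {g' : E →L[ℝ] G} (hf : HasLipFDerivAt f f' u)
    (hg : HasLipFDerivAt g g' u) : HasLipFDerivAt (fun v => (f v, g v)) (f'.prod g') u :=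
  IsBigO.prod_left hf hg

theorem id : HasLipFDerivAt (fun v : E => v) (ContinuousLinearMap.id ℝ E) u := by
  refine (isBigO_zero _ _).congr_left fun p => ?_
  simp

theorem clm_comp (L : F →L[ℝ] G) (hf : HasLipFDerivAt f f' u) :
    HasLipFDerivAt (fun v => L (f v)) (L ∘L f') u := by
  refine ((L.isBigO_comp _ _).trans hf).congr_left fun p => ?_
  simp [map_sub]

theorem sub {g : E → F} {g' : E →L[ℝ] F} (hf : HasLipFDerivAt f f' u)
    (hg : HasLipFDerivAt g g' u) : HasLipFDerivAt (fun v => f v - g v) (f' - g') u := by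
  refine (IsBigO.sub hf hg).congr_left fun p => ?_
  simp [map_sub]
  abel

theorem const_smul (c : ℝ) (hf : HasLipFDerivAt f f' u) :
    HasLipFDerivAt (fun v => c • f v) (c • f') u := by
  refine (IsBigO.const_smul_left hf c).congr_left fun p => ?_
  simp [smul_sub]

/-- A product with a factor that vanishes at `u`; the other factor need only be Lipschitz. -/
theorem lipschitz_clm_apply {a : E → F →L[ℝ] G} (ha : LipschitzNear a u)
    (hf : HasLipFDerivAt f f' u) (h0 : f u = 0) :
    HasLipFDerivAt (fun v => a v (f v)) (a u ∘L f') u := by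
  have hl := hf.lipschitzNear
  have ht1 : Tendsto (fun p : E × E => (p.1, u)) (𝓝 (u, u)) (𝓝 (u, u)) := by
    have : Continuous fun p : E × E => (p.1, u) := by fun_prop
    exact this.tendsto (u, u)
  have ht2 : Tendsto (fun p : E × E => (p.2, u)) (𝓝 (u, u)) (𝓝 (u, u)) := by
    have : Continuous fun p : E × E => (p.2, u) := by fun_prop
    exact this.tendsto (u, u)
  have e1 : (fun p : E × E => ‖p.1 - u‖) =O[𝓝 (u, u)] fun p => ‖p.1 - u‖ + ‖p.2 - u‖ := by
    refine IsBigO.of_bound 1 (.of_forall fun p => ?_)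
    rw [Real.norm_of_nonneg (by positivity), Real.norm_of_nonneg (by positivity)]
    simp
  have e2 : (fun p : E × E => ‖p.2 - u‖) =O[𝓝 (u, u)] fun p => ‖p.1 - u‖ + ‖p.2 - u‖ := by
    refine IsBigO.of_bound 1 (.of_forall fun p => ?_)
    rw [Real.norm_of_nonneg (by positivity), Real.norm_of_nonneg (by positivity)]
    simp
  have hc : (fun p : E × E => ‖a p.1‖) =O[𝓝 (u, u)] fun _ => (1 : ℝ) := by
    have : ContinuousAt (fun p : E × E => a p.1) (u, u) :=
      ContinuousAt.comp (f := Prod.fst) (x := ((u, u) : E × E)) ha.continuousAt continuousAt_fst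
    exact this.norm.isBigO_one ℝ
  have t1 : (fun p : E × E => a p.1 (f p.1 - f p.2 - f' (p.1 - p.2))) =O[𝓝 (u, u)]
      fun p => (‖p.1 - u‖ + ‖p.2 - u‖) * ‖p.1 - p.2‖ := by
    refine (IsBigO.of_bound 1 (.of_forall fun p => ?_)).trans
      ((hc.mul hf.norm_left).congr_right fun p => one_mul _)
    rw [one_mul, norm_mul, norm_norm, norm_norm]
    exact (a p.1).le_opNorm _
  have t2 : (fun p : E × E => (a p.1 - a u) (f' (p.1 - p.2))) =O[𝓝 (u, u)]
      fun p => (‖p.1 - u‖ + ‖p.2 - u‖) * ‖p.1 - p.2‖ := by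
    have h1 : (fun p : E × E => ‖a p.1 - a u‖) =O[𝓝 (u, u)]
        fun p => ‖p.1 - u‖ + ‖p.2 - u‖ := (ha.comp_tendsto ht1).norm_norm.trans e1
    refine (IsBigO.of_bound 1 (.of_forall fun p => ?_)).trans
      (h1.mul ((f'.isBigO_comp (fun p : E × E => p.1 - p.2) (𝓝 (u, u))).norm_norm))
    rw [one_mul, norm_mul, norm_norm, norm_norm]
    exact (a p.1 - a u).le_opNorm _
  -- Only here is `f u = 0` needed: the increment of `a` is merely Lipschitz, and `f p.2`, being of
  -- order `‖p.2 - u‖`, supplies the missing small factor.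
  have t3 : (fun p : E × E => (a p.1 - a p.2) (f p.2)) =O[𝓝 (u, u)]
      fun p => (‖p.1 - u‖ + ‖p.2 - u‖) * ‖p.1 - p.2‖ := by
    have h1 : (fun p : E × E => ‖f p.2‖) =O[𝓝 (u, u)]
        fun p => ‖p.1 - u‖ + ‖p.2 - u‖ := by
      refine IsBigO.trans ?_ e2
      simpa [Function.comp_def, h0] using (hl.comp_tendsto ht2).norm_norm
    refine (IsBigO.of_bound 1 (.of_forall fun p => ?_)).trans (h1.mul ha.norm_norm)
    rw [one_mul, norm_mul, norm_norm, norm_norm, mul_comm]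
    exact (a p.1 - a p.2).le_opNorm _
  refine ((t1.add t2).add t3).congr_left fun p => ?_
  simp [map_sub]
  abel

/-- The remainder estimate with an arbitrarily small constant. -/
theorem exists_ball (hf : HasLipFDerivAt f f' u) {η : ℝ} (hη : 0 < η) :
    ∃ r > 0, ∀ v w, ‖v - u‖ < r → ‖w - u‖ < r → ‖f v - f w - f' (v - w)‖ ≤ η * ‖v - w‖ := by
  have h := hf.hasStrictFDerivAt.isLittleO.bound hη
  rw [nhds_prod_eq] at h
  obtain ⟨r, hr, hb⟩ := (Metric.nhds_basis_ball.prod_self.eventually_iff).1 h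
  refine ⟨r, hr, fun v w hv hw => ?_⟩
  exact hb (x := (v, w)) ⟨by simpa [dist_eq_norm] using hv, by simpa [dist_eq_norm] using hw⟩

/-- The quadratic remainder estimate. -/
theorem exists_quadratic (hf : HasLipFDerivAt f f' u) :
    ∃ C > 0, ∃ r > 0, ∀ x, ‖x‖ < r → ‖f (u + x) - f u - f' x‖ ≤ C * ‖x‖ ^ 2 := by
  obtain ⟨C, hC, h⟩ := hf.exists_pos
  have h1 : Tendsto (fun x : E => (u + x, u)) (𝓝 0) (𝓝 (u, u)) := by
    have : Continuous fun x : E => (u + x, u) := by fun_prop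
    simpa using this.tendsto 0
  obtain ⟨r, hr, hb⟩ := Metric.eventually_nhds_iff_ball.1 (h1.eventually h.bound)
  refine ⟨C, hC, r, hr, fun x hx => ?_⟩
  simpa [← sq] using hb x (by simpa using hx)

end HasLipFDerivAt

end LipschitzDerivative

/-! ### Spectrum of operators symmetric with respect to a bilinear form -/

section SymmetricForms

variable {X : Type*} [NormedAddCommGroup X] [NormedSpace ℝ X]

/-- The Cauchy–Schwarz inequality for a nonnegative symmetric form. -/
theorem ContinuousLinearMap.apply_sq_le_of_symm (b : X →L[ℝ] StrongDual ℝ X)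
    (hs : ∀ x y, b x y = b y x) (h0 : ∀ x, 0 ≤ b x x) (x y : X) :
    b x y ^ 2 ≤ b x x * b y y := by
  have h := LinearMap.BilinForm.apply_sq_le_of_symm
    (LinearMap.mk₂ ℝ (fun x y => b x y) (by simp) (by simp) (by simp) (by simp))
    (by simpa using h0) ⟨by simpa using hs⟩ x y
  simpa using h

theorem ContinuousLinearMap.apply_apply_le_sq (b : X →L[ℝ] StrongDual ℝ X) (x : X) :
    b x x ≤ ‖b‖ * ‖x‖ ^ 2 := by
  have := (le_abs_self _).trans (b.le_opNorm₂ x x)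
  linarith [sq ‖x‖, mul_assoc ‖b‖ ‖x‖ ‖x‖]

/-- A closed subspace that is proper is annihilated by a nonzero functional. -/
theorem Submodule.exists_dual_of_isClosed_of_notMem (R : Submodule ℝ X)
    (hR : IsClosed (R : Set X)) {z : X} (hz : z ∉ R) :
    ∃ f : StrongDual ℝ X, (∀ x ∈ R, f x = 0) ∧ f z ≠ 0 := by
  obtain ⟨f, c, h1, h2⟩ := geometric_hahn_banach_point_closed (E := X) R.convex hR hz
  have hc : c < 0 := by simpa using h2 0 R.zero_mem
  have h0 : ∀ x ∈ R, f x = 0 := by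
    intro x hx
    by_contra hne
    have h := h2 ((c / f x) • x) (R.smul_mem _ hx)
    rw [map_smul, smul_eq_mul, div_mul_cancel₀ _ hne] at h
    exact lt_irrefl _ h
  exact ⟨f, h0, (h1.trans hc).ne⟩

theorem exists_bound_of_notMem_spectrum {T : X →L[ℝ] X} {lam : ℝ} (h : lam ∉ spectrum ℝ T) :
    ∃ c > 0, ∀ x, c * ‖x‖ ≤ ‖T x - lam • x‖ := by
  rw [spectrum.notMem_iff] at h
  obtain ⟨S, hS⟩ := h.exists_left_inv
  refine ⟨(‖S‖ + 1)⁻¹, by positivity, fun x => ?_⟩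
  have h1 : S (lam • x - T x) = x := by
    have := congrArg (fun L : X →L[ℝ] X => L x) hS
    simpa [Algebra.algebraMap_eq_smul_one] using this
  have h2 : ‖x‖ ≤ (‖S‖ + 1) * ‖T x - lam • x‖ := by
    calc ‖x‖ = ‖S (lam • x - T x)‖ := by rw [h1]
      _ ≤ ‖S‖ * ‖lam • x - T x‖ := S.le_opNorm _
      _ ≤ (‖S‖ + 1) * ‖T x - lam • x‖ := by rw [norm_sub_rev]; gcongr; simp
  rw [inv_mul_le_iff₀ (by positivity)]
  exact h2

/-- Points of the spectrum of an operator that is symmetric with respect to a form which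
represents all functionals are approximate eigenvalues. -/
theorem exists_approx_eigenvector [CompleteSpace X] (b : X →L[ℝ] StrongDual ℝ X)
    (hsurj : Function.Surjective b) (hpos : ∀ x, x ≠ 0 → 0 < b x x) {T : X →L[ℝ] X}
    (hT : ∀ x y, b (T x) y = b x (T y)) {lam : ℝ} (h : lam ∈ spectrum ℝ T) {η : ℝ}
    (hη : 0 < η) : ∃ x ≠ 0, ‖T x - lam • x‖ ≤ η * ‖x‖ := by
  by_contra! hcon
  refine spectrum.mem_iff.1 h ?_
  set N : X →L[ℝ] X := algebraMap ℝ (X →L[ℝ] X) lam - T with hN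
  have hNx : ∀ x, N x = lam • x - T x := fun x => by simp [hN, Algebra.algebraMap_eq_smul_one]
  have hbelow : ∀ x, η * ‖x‖ ≤ ‖N x‖ := by
    intro x
    rcases eq_or_ne x 0 with rfl | hx
    · simp
    · rw [hNx, norm_sub_rev]; exact (hcon x hx).le
  have hanti : AntilipschitzWith (Real.toNNReal η⁻¹) N := by
    refine AddMonoidHomClass.antilipschitz_of_bound N fun x => ?_
    rw [Real.coe_toNNReal _ (by positivity), ← div_eq_inv_mul, le_div_iff₀ hη, mul_comm]
    exact hbelow x
  rw [ContinuousLinearMap.isUnit_iff_bijective]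
  refine ⟨hanti.injective, fun z => ?_⟩
  have hclosed : IsClosed ((N : X →ₗ[ℝ] X).range : Set X) := by
    rw [LinearMap.coe_range]
    exact hanti.isClosed_range N.uniformContinuous
  -- `N` has closed range, so a point outside it is detected by a functional `b y` vanishing on the
  -- range. Symmetry then gives `b (N y) (N y) = 0`, hence `y = 0`.
  by_contra hz
  obtain ⟨f, hf, hfz⟩ := Submodule.exists_dual_of_isClosed_of_notMem _ hclosed
    (z := z) (by simpa using hz)
  obtain ⟨y, rfl⟩ := hsurj f
  have hsym : ∀ x, b (N y) x = b y (N x) := fun x => by simp [hNx, hT]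
  have hNy : N y = 0 := by
    by_contra hne
    have h1 := hpos _ hne
    rw [hsym] at h1
    exact h1.ne' (hf _ ⟨N y, rfl⟩)
  have : y = 0 := hanti.injective (by simpa using hNy)
  simp [this] at hfz

/-- The quadratic form of a symmetric operator is bounded below by the least point of the
spectrum. -/
theorem le_form_of_isLeast_spectrum (b : X →L[ℝ] StrongDual ℝ X)
    (hs : ∀ x y, b x y = b y x) {c : ℝ} (hc : 0 < c) (hco : ∀ x, c * ‖x‖ ^ 2 ≤ b x x)
    {T : X →L[ℝ] X} (hT : ∀ x y, b (T x) y = b x (T y)) {lam : ℝ}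
    (h : IsLeast (spectrum ℝ T) lam) (x : X) : lam * b x x ≤ b (T x) x := by
  rcases eq_or_ne x 0 with rfl | hx
  · simp
  have hpos : ∀ x, x ≠ 0 → 0 < b x x := fun x hx =>
    lt_of_lt_of_le (by have := norm_pos_iff.2 hx; positivity) (hco x)
  set A : Set ℝ := (fun x => b (T x) x / b x x) '' {0}ᶜ with hA
  have hbdd : BddBelow A := by
    refine ⟨-(‖b‖ * ‖T‖ / c), ?_⟩
    rintro _ ⟨y, hy, rfl⟩
    have hy' := hpos y hy
    dsimp only
    rw [le_div_iff₀ hy']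
    have h1 : |b (T y) y| ≤ ‖b‖ * ‖T‖ * ‖y‖ ^ 2 := by
      refine (b.le_opNorm₂ (T y) y).trans ?_
      calc ‖b‖ * ‖T y‖ * ‖y‖ ≤ ‖b‖ * (‖T‖ * ‖y‖) * ‖y‖ := by gcongr; exact T.le_opNorm y
        _ = _ := by ring
    have h2 : ‖b‖ * ‖T‖ * ‖y‖ ^ 2 ≤ ‖b‖ * ‖T‖ / c * b y y := by
      calc ‖b‖ * ‖T‖ * ‖y‖ ^ 2 = ‖b‖ * ‖T‖ / c * (c * ‖y‖ ^ 2) := by field_simp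
        _ ≤ _ := by gcongr; exact hco y
    linarith [neg_abs_le (b (T y) y)]
  have hne : A.Nonempty := ⟨_, x, hx, rfl⟩
  have hle : ∀ y, sInf A * b y y ≤ b (T y) y := by
    intro y
    rcases eq_or_ne y 0 with rfl | hy
    · simp
    rw [← le_div_iff₀ (hpos y hy)]
    exact csInf_le hbdd ⟨y, hy, rfl⟩
  -- The infimum `m` of the Rayleigh quotients is a spectral value. Otherwise `N = T - m` is bounded
  -- below, and Cauchy–Schwarz for the nonnegative form `b (N ·) ·`, applied to `y` and `N y`, makes
  -- that form coercive; the infimum would then exceed `m`.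
  have hmem : sInf A ∈ spectrum ℝ T := by
    by_contra hns
    obtain ⟨d, hd, hbd⟩ := exists_bound_of_notMem_spectrum hns
    set m := sInf A with hm
    set N : X →L[ℝ] X := T - m • ContinuousLinearMap.id ℝ X with hN
    have hNx : ∀ y, N y = T y - m • y := fun y => by simp [hN]
    have hNs : ∀ y z, (b ∘L N) y z = (b ∘L N) z y := fun y z => by
      simp [hNx, hT, hs y z, hs y (T z)]
    have hN0 : ∀ y, 0 ≤ (b ∘L N) y y := fun y => by
      have := hle y
      simp [hNx]; linarith
    set C := ‖b ∘L N‖ + 1 with hC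
    have hCpos : 0 < C := by positivity
    have hbound : ∀ y, c ^ 2 * d ^ 2 / C * ‖y‖ ^ 2 ≤ b (N y) y := by
      intro y
      rcases eq_or_ne (N y) 0 with h0 | h0
      · have h1 := hbd y
        rw [← hNx, h0, norm_zero] at h1
        have h2 : ‖y‖ ≤ 0 := by
          by_contra! h3
          have := mul_pos hd h3
          linarith
        have h3 : y = 0 := norm_le_zero_iff.1 h2
        simp [h3]
      have hn : 0 < ‖N y‖ := norm_pos_iff.2 h0
      have h1 := (b ∘L N).apply_sq_le_of_symm hNs hN0 y (N y)
      have h2 : (b ∘L N) (N y) (N y) ≤ C * ‖N y‖ ^ 2 :=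
        ((b ∘L N).apply_apply_le_sq _).trans (by gcongr; simp [hC])
      have h3 := hco (N y)
      have h4 : (c * ‖N y‖ ^ 2) ^ 2 ≤ (b ∘L N) y y * (C * ‖N y‖ ^ 2) := by
        refine le_trans ?_ (h1.trans (by gcongr; exact hN0 y))
        simp only [ContinuousLinearMap.comp_apply]
        gcongr
      have h5 : c ^ 2 * ‖N y‖ ^ 2 ≤ b (N y) y * C := by
        have hpos2 : 0 < ‖N y‖ ^ 2 := by positivity
        refine le_of_mul_le_mul_right ?_ hpos2
        calc _ = (c * ‖N y‖ ^ 2) ^ 2 := by ring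
          _ ≤ _ := h4
          _ = _ := by simp only [ContinuousLinearMap.comp_apply]; ring
      have h6 : (d * ‖y‖) ^ 2 ≤ ‖N y‖ ^ 2 := by
        rw [hNx]; gcongr; exact hbd y
      rw [div_mul_eq_mul_div, div_le_iff₀ hCpos]
      calc c ^ 2 * d ^ 2 * ‖y‖ ^ 2 = c ^ 2 * (d * ‖y‖) ^ 2 := by ring
        _ ≤ c ^ 2 * ‖N y‖ ^ 2 := by gcongr
        _ ≤ _ := h5
    set κ := c ^ 2 * d ^ 2 / C / (‖b‖ + 1) with hκ
    have hκpos : 0 < κ := by positivity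
    have : m + κ ≤ m := by
      conv_rhs => rw [hm]
      refine le_csInf hne ?_
      rintro _ ⟨y, hy, rfl⟩
      dsimp only
      rw [le_div_iff₀ (hpos y hy)]
      have h1 := hbound y
      rw [hNx] at h1
      simp only [map_sub, map_smul, _root_.sub_apply, _root_.smul_apply, smul_eq_mul] at h1
      have h2 : κ * b y y ≤ c ^ 2 * d ^ 2 / C * ‖y‖ ^ 2 := by
        calc κ * b y y ≤ κ * ((‖b‖ + 1) * ‖y‖ ^ 2) := by
              gcongr; exact (b.apply_apply_le_sq y).trans (by gcongr; simp)
          _ = _ := by rw [hκ]; field_simp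
      linarith
    linarith
  calc lam * b x x ≤ sInf A * b x x := by
        gcongr
        · exact (hpos x hx).le
        · exact h.2 hmem
    _ ≤ _ := hle x

end SymmetricForms

/-! ### Coercivity and the energy norm of `M` -/

namespace AccelerationOperator

variable {V : Type*} [NormedAddCommGroup V] [NormedSpace ℝ V] (M : AccelerationOperator V)

theorem nonneg (x : V) : 0 ≤ M.op x x := by
  rcases eq_or_ne x 0 with rfl | hx
  · simp
  · exact (M.posDef x hx).le

theorem op_sq_le (x y : V) : M.op x y ^ 2 ≤ M.op x x * M.op y y :=
  (M.op : V →L[ℝ] StrongDual ℝ V).apply_sq_le_of_symm M.hermitian M.nonneg x y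

/-- Cauchy–Schwarz bounds `‖M x‖ ^ 2` by a multiple of `(M x)(x)`, and boundedness of `M⁻¹` bounds
`‖x‖` by a multiple of `‖M x‖`. Thus positivity together with invertibility already gives
coercivity. -/
theorem exists_coercive : ∃ c > 0, ∀ x, c * ‖x‖ ^ 2 ≤ M.op x x := by
  set A := ‖(M.op : V →L[ℝ] StrongDual ℝ V)‖ + 1 with hA
  set B := ‖(M.op.symm : StrongDual ℝ V →L[ℝ] V)‖ + 1 with hB
  have hApos : 0 < A := by positivity
  have hBpos : 0 < B := by positivity
  refine ⟨(A * B ^ 2)⁻¹, by positivity, fun x => ?_⟩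
  have h1 : ‖M.op x‖ ≤ √(M.op x x * A) := by
    refine ContinuousLinearMap.opNorm_le_bound _ (by positivity) fun y => ?_
    have h2 : M.op y y ≤ A * ‖y‖ ^ 2 :=
      ((M.op : V →L[ℝ] StrongDual ℝ V).apply_apply_le_sq y).trans (by gcongr; simp [hA])
    have h3 : M.op x y ^ 2 ≤ M.op x x * A * ‖y‖ ^ 2 := by
      refine (M.op_sq_le x y).trans ?_
      rw [mul_assoc]
      exact mul_le_mul_of_nonneg_left h2 (M.nonneg x)
    rw [Real.norm_eq_abs, ← Real.sqrt_sq_eq_abs, ← Real.sqrt_sq (norm_nonneg y),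
      ← Real.sqrt_mul (mul_nonneg (M.nonneg x) hApos.le)]
    exact Real.sqrt_le_sqrt h3
  have h2 : ‖x‖ ≤ B * √(M.op x x * A) := by
    calc ‖x‖ = ‖M.op.symm (M.op x)‖ := by simp
      _ ≤ ‖(M.op.symm : StrongDual ℝ V →L[ℝ] V)‖ * ‖M.op x‖ :=
        (M.op.symm : StrongDual ℝ V →L[ℝ] V).le_opNorm _
      _ ≤ _ := by gcongr; simp [hB]
  rw [inv_mul_le_iff₀ (by positivity)]
  calc ‖x‖ ^ 2 ≤ (B * √(M.op x x * A)) ^ 2 := by gcongr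
    _ = A * B ^ 2 * M.op x x := by
      rw [mul_pow, Real.sq_sqrt (mul_nonneg (M.nonneg x) hApos.le)]; ring

/-- The energy norm `(Mx)(x)^(1/2)`. -/
def energyNorm : Seminorm ℝ V :=
  Seminorm.of (fun x => √(M.op x x))
    (fun x y => by
      refine Real.sqrt_le_iff.2 ⟨by positivity, ?_⟩
      rw [add_sq, Real.sq_sqrt (M.nonneg x), Real.sq_sqrt (M.nonneg y)]
      have h : M.op x y ≤ √(M.op x x) * √(M.op y y) := by
        rw [← Real.sqrt_mul (M.nonneg x)]
        exact Real.le_sqrt_of_sq_le (M.op_sq_le x y)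
      simp only [map_add, _root_.add_apply]
      linarith [M.hermitian x y])
    (fun a x => by
      simp only [map_smul, _root_.smul_apply, smul_eq_mul]
      rw [← mul_assoc, Real.sqrt_mul (mul_self_nonneg a), Real.sqrt_mul_self_eq_abs,
        Real.norm_eq_abs])

theorem energyNorm_sq (x : V) : M.energyNorm x ^ 2 = M.op x x :=
  Real.sq_sqrt (M.nonneg x)

theorem op_le_energyNorm_mul (x y : V) : |M.op x y| ≤ M.energyNorm x * M.energyNorm y := by
  refine abs_le_of_sq_le_sq ?_ (mul_nonneg (apply_nonneg _ _) (apply_nonneg _ _))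
  rw [mul_pow, energyNorm_sq, energyNorm_sq]
  exact M.op_sq_le x y

theorem exists_energyNorm_le : ∃ C > 0, ∀ x, M.energyNorm x ≤ C * ‖x‖ := by
  refine ⟨√(‖(M.op : V →L[ℝ] StrongDual ℝ V)‖ + 1), by positivity, fun x => ?_⟩
  refine le_of_sq_le_sq ?_ (by positivity)
  rw [energyNorm_sq, mul_pow, Real.sq_sqrt (by positivity)]
  exact ((M.op : V →L[ℝ] StrongDual ℝ V).apply_apply_le_sq x).trans (by gcongr; simp)

theorem exists_le_energyNorm : ∃ c > 0, ∀ x, c * ‖x‖ ≤ M.energyNorm x := by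
  obtain ⟨c, hc, h⟩ := M.exists_coercive
  refine ⟨√c, by positivity, fun x => ?_⟩
  refine le_of_sq_le_sq ?_ (apply_nonneg _ _)
  rw [energyNorm_sq, mul_pow, Real.sq_sqrt hc.le]
  exact h x

end AccelerationOperator

/-! ### Derivative of the step at the solitary wave -/

namespace PCSOM

section StepDerivative

variable {V H : Type*} [NormedAddCommGroup V] [NormedSpace ℝ V]
  [NormedAddCommGroup H] [InnerProductSpace ℝ H]
  (ι : V →L[ℝ] H) (M : AccelerationOperator V) (L00 : V → StrongDual ℝ V)

theorem ip_comm (v w : V) : ip ι v w = ip ι w v := real_inner_comm _ _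

theorem power_eq_norm_sq (v : V) : power ι v = ‖ι v‖ ^ 2 := real_inner_self_eq_norm_sq _

theorem power_nonneg (v : V) : 0 ≤ power ι v := by
  rw [power_eq_norm_sq]; positivity

theorem power_smul (a : ℝ) (v : V) : power ι (a • v) = a ^ 2 * power ι v := by
  rw [power_eq_norm_sq, power_eq_norm_sq, map_smul, norm_smul, mul_pow, Real.norm_eq_abs, sq_abs]

theorem embed_ne_zero_of_power {v : V} (h : power ι v ≠ 0) : embed ι v ≠ 0 := fun h0 =>
  h (by rw [power, ← embed_apply, h0]; rfl)

theorem op_Minv (f : StrongDual ℝ V) : M.op (Minv M f) = f := M.op.apply_symm_apply f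

/-- Scaling to the power `P`. -/
def normalize (P : ℝ) (v : V) : V := √(P / power ι v) • v

theorem step_eq (P Δt : ℝ) (v : V) :
    step ι M L00 P Δt v = normalize ι P (predictor ι M L00 Δt v) := rfl

theorem power_normalize {P : ℝ} (hP : 0 ≤ P) {v : V} (hv : power ι v ≠ 0) :
    power ι (normalize ι P v) = P := by
  rw [normalize, power_smul, Real.sq_sqrt (div_nonneg hP (power_nonneg ι v)),
    div_mul_cancel₀ _ hv]

theorem normalize_of_power_eq {P : ℝ} (hP : P ≠ 0) {v : V} (hv : power ι v = P) :
    normalize ι P v = v := by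
  rw [normalize, hv, div_self hP, Real.sqrt_one, one_smul]

/-- The projection onto `S` along `u`. -/
def radialProj (u : V) : V →L[ℝ] V :=
  ContinuousLinearMap.id ℝ V - (power ι u)⁻¹ • (embed ι u).smulRight u

theorem radialProj_apply (u x : V) :
    radialProj ι u x = x - ((power ι u)⁻¹ * ip ι u x) • u := by
  simp [radialProj, embed_apply, smul_smul]

theorem hasFDerivAt_power (u : V) : HasFDerivAt (power ι) ((2 : ℝ) • embed ι u) u := by
  have h : HasFDerivAt (fun v => embed ι v v)
      ((embed ι u).comp (ContinuousLinearMap.id ℝ V)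
        + (embed ι).flip u) u := by
    have := (embed ι).hasFDerivAt (x := u) |>.clm_apply (hasFDerivAt_id u)
    simpa [add_comm] using this
  refine h.congr_fderiv ?_
  ext x
  simp only [_root_.add_apply, ContinuousLinearMap.comp_apply,
    ContinuousLinearMap.id_apply, ContinuousLinearMap.flip_apply, embed_apply,
    _root_.smul_apply, smul_eq_mul]
  rw [ip_comm ι x u]; ring

theorem contDiff_power : ContDiff ℝ 2 (power ι) := by
  have : ContDiff ℝ 2 fun v => embed ι v v := by fun_prop
  exact this

theorem normalize_hasLipFDerivAt {u : V} (hu : power ι u ≠ 0) :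
    HasLipFDerivAt (normalize ι (power ι u)) (radialProj ι u) u := by
  have h1 : ContDiffAt ℝ 2 (normalize ι (power ι u)) u := by
    refine ContDiffAt.smul ?_ contDiffAt_id
    refine ContDiffAt.sqrt ?_ (by simp [hu])
    exact contDiffAt_const.div (contDiff_power ι).contDiffAt hu
  refine h1.hasLipFDerivAt.of_eq ?_
  have h2 : HasFDerivAt (fun v => power ι u / power ι v)
      (-(2 * (power ι u)⁻¹) • embed ι u) u := by
    have := (hasDerivAt_inv hu).const_mul (power ι u) |>.comp_hasFDerivAt u
      (hasFDerivAt_power ι u)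
    refine (this.congr_fderiv ?_)
    rw [smul_smul]
    congr 1
    field_simp
  have h3 := (h2.sqrt (by simp [hu])).smul (hasFDerivAt_id u)
  refine (HasFDerivAt.fderiv h3).trans ?_
  ext x
  simp [radialProj, hu, smul_smul]
  rw [sub_eq_add_neg, ← neg_smul]

/-- The residual `M⁻¹ L₀ v` with `μ` replaced by the Rayleigh quotient of `v`. -/
def residual (v : V) : V := Minv M (L0 ι L00 (rayleigh ι M L00 v) v)

/-- The linearization of the residual, `Ψ ↦ M⁻¹ (L₁ Ψ - β u)`. -/
def residualDeriv (μ : ℝ) (u : V) : V →L[ℝ] V :=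
  Minv M ∘L (L1 ι L00 μ u - (beta ι M L00 μ u).smulRight (embed ι u))

/-- This is the defining property of the Rayleigh quotient. Differentiated at `u`, it identifies the
derivative of that quotient with `beta`. -/
theorem ip_residual (v : V) : embed ι v (residual ι M L00 v) = 0 := by
  by_cases hv : embed ι v = 0
  · simp [hv]
  have hd := denom_ne_zero ι M v hv
  simp only [residual, L0, map_sub, map_smul, smul_eq_mul]
  change ip ι v (Minv M (L00 v)) - rayleigh ι M L00 v * denom ι M v = 0
  rw [rayleigh, div_mul_cancel₀ _ hd, sub_self]

theorem rayleigh_eq {μ : ℝ} {u : V} (hu : embed ι u ≠ 0) (h : L0 ι L00 μ u = 0) :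
    rayleigh ι M L00 u = μ := by
  have hd := denom_ne_zero ι M u hu
  rw [L0, sub_eq_zero] at h
  rw [rayleigh, h, map_smul, div_eq_iff hd]
  change embed ι u (μ • Minv M (embed ι u)) = _
  rw [map_smul]; rfl

theorem residual_eq_zero {μ : ℝ} {u : V} (hu : embed ι u ≠ 0) (h : L0 ι L00 μ u = 0) :
    residual ι M L00 u = 0 := by
  rw [residual, rayleigh_eq ι M L00 hu h, h, map_zero]

/-- The derivative `ρ` can remain unspecified, since at a solution it is recovered from
`ip_residual`. -/
theorem rayleigh_hasLipFDerivAt {u : V} (hu : embed ι u ≠ 0) {L' : V →L[ℝ] StrongDual ℝ V}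
    (hL : HasLipFDerivAt L00 L' u) :
    ∃ ρ : V →L[ℝ] ℝ, HasLipFDerivAt (rayleigh ι M L00) ρ u := by
  have h1 : ContDiffAt ℝ 2 (fun q : V × StrongDual ℝ V =>
      embed ι q.1 (Minv M q.2) / embed ι q.1 (Minv M (embed ι q.1))) (u, L00 u) := by
    refine ContDiffAt.div (by fun_prop) (by fun_prop) ?_
    exact denom_ne_zero ι M u hu
  exact ⟨_, h1.hasLipFDerivAt.comp (f := fun v => (v, L00 v)) (HasLipFDerivAt.id.prodMk hL)⟩

theorem residual_hasLipFDerivAt {μ : ℝ} {u : V} (hu : embed ι u ≠ 0)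
    (h : L0 ι L00 μ u = 0) (hL : HasLipFDerivAt L00 (fderiv ℝ L00 u) u) :
    HasLipFDerivAt (residual ι M L00) (residualDeriv ι M L00 μ u) u := by
  obtain ⟨ρ, hρ⟩ := rayleigh_hasLipFDerivAt ι M L00 hu hL
  have hd := denom_ne_zero ι M u hu
  have h1 : ContDiffAt ℝ 2 (fun q : ℝ × V => q.1 • embed ι q.2) (rayleigh ι M L00 u, u) := by
    fun_prop
  have h2 := (hL.sub (h1.hasLipFDerivAt.comp (f := fun v => (rayleigh ι M L00 v, v))
    (hρ.prodMk .id))).clm_comp (Minv M)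
  have h3 : HasFDerivAt (residual ι M L00)
      (Minv M ∘L (L1 ι L00 μ u - ρ.smulRight (embed ι u))) u := by
    have := (Minv M).hasFDerivAt.comp u
      (hL.hasFDerivAt.sub (hρ.hasFDerivAt.smul (embed ι).hasFDerivAt))
    refine this.congr_fderiv ?_
    ext x
    simp [L1, rayleigh_eq ι M L00 hu h, sub_sub]
  refine h2.of_eq (h2.hasFDerivAt.unique (h3.congr_fderiv ?_))
  -- Differentiate `⟨v, residual v⟩ = 0` at `u`; the term with the residual itself vanishes there.
  -- The remaining equation determines `ρ`.
  have h4 : ∀ x, embed ι u ((Minv M ∘L (L1 ι L00 μ u - ρ.smulRight (embed ι u))) x) = 0 := by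
    have h5 := (embed ι).hasFDerivAt (x := u) |>.clm_apply h3
    have h6 : (fun v => embed ι v (residual ι M L00 v)) = fun _ => 0 :=
      funext (ip_residual ι M L00)
    rw [h6] at h5
    have h7 := h5.unique (hasFDerivAt_const (0 : ℝ) u)
    intro x
    have := congrArg (fun f : V →L[ℝ] ℝ => f x) h7
    simpa [residual_eq_zero ι M L00 hu h] using this
  have h8 : ρ = beta ι M L00 μ u := by
    ext x
    have h9 := h4 x
    have hd' : embed ι u (Minv M (embed ι u)) = denom ι M u := rfl
    simp only [ContinuousLinearMap.comp_apply, _root_.sub_apply,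
      ContinuousLinearMap.smulRight_apply, map_sub, map_smul, smul_eq_mul, hd'] at h9
    simp only [beta, _root_.smul_apply, ContinuousLinearMap.comp_apply, smul_eq_mul]
    field_simp
    linarith
  rw [h8, residualDeriv]

/-- Taking adjoints, as a continuous linear map. -/
def flipCLM : (V →L[ℝ] V →L[ℝ] ℝ) →L[ℝ] (V →L[ℝ] V →L[ℝ] ℝ) :=
  (ContinuousLinearMap.flipₗᵢ ℝ V V ℝ).toContinuousLinearEquiv

/-- The operator that takes the residual to the increment of the predictor. -/
def correction (v : V) (σ : V →L[ℝ] V →L[ℝ] ℝ) : V →L[ℝ] V :=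
  Minv M ∘L (σ - ((denom ι M v)⁻¹ • (embed ι v ∘L Minv M ∘L σ)).smulRight (embed ι v))

theorem predictor_eq (Δt : ℝ) (v : V) : predictor ι M L00 Δt v =
    v - Δt • correction ι M v (L1adj ι L00 (rayleigh ι M L00 v) v) (residual ι M L00 v) := by
  simp only [predictor, correction, gam, squaredTerm, residual, ContinuousLinearMap.comp_apply,
    _root_.sub_apply, ContinuousLinearMap.smulRight_apply, _root_.smul_apply, smul_eq_mul]
  rw [div_eq_inv_mul]
  rfl

/-- The correction is a smooth function of `v`, the Rayleigh quotient and `DL₀₀(v)`. The last is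
only Lipschitz, so no derivative is claimed; none is needed for a factor multiplying the residual.
-/
theorem correction_lipschitzNear {u : V} (hu : embed ι u ≠ 0)
    (hL : HasLipFDerivAt L00 (fderiv ℝ L00 u) u) (hX : LipschitzNear (fderiv ℝ L00) u) :
    LipschitzNear (fun v => correction ι M v (L1adj ι L00 (rayleigh ι M L00 v) v)) u := by
  obtain ⟨ρ, hρ⟩ := rayleigh_hasLipFDerivAt ι M L00 hu hL
  have hd := denom_ne_zero ι M u hu
  have h1 : ContDiffAt ℝ 1 (fun q : V × ℝ × (V →L[ℝ] V →L[ℝ] ℝ) =>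
      correction ι M q.1 (flipCLM (q.2.2 - embed ι ∘L (q.2.1 • ContinuousLinearMap.id ℝ V))))
      (u, rayleigh ι M L00 u, fderiv ℝ L00 u) := by
    have hf : ContDiffAt ℝ 1 (fun q : V × ℝ × (V →L[ℝ] V →L[ℝ] ℝ) =>
        flipCLM (q.2.2 - embed ι ∘L (q.2.1 • ContinuousLinearMap.id ℝ V)))
        (u, rayleigh ι M L00 u, fderiv ℝ L00 u) := by
      refine ContDiff.contDiffAt ?_
      fun_prop
    have hden : ContDiffAt ℝ 1 (fun q : V × ℝ × (V →L[ℝ] V →L[ℝ] ℝ) =>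
        (embed ι q.1 (Minv M (embed ι q.1)))⁻¹)
        (u, rayleigh ι M L00 u, fderiv ℝ L00 u) := by
      refine ContDiffAt.inv (by fun_prop) hd
    have he : ContDiffAt ℝ 1 (fun q : V × ℝ × (V →L[ℝ] V →L[ℝ] ℝ) => embed ι q.1)
        (u, rayleigh ι M L00 u, fderiv ℝ L00 u) := by fun_prop
    have hM : ContDiffAt ℝ 1 (fun _ : V × ℝ × (V →L[ℝ] V →L[ℝ] ℝ) => Minv M)
        (u, rayleigh ι M L00 u, fderiv ℝ L00 u) := contDiffAt_const
    exact hM.clm_comp (hf.sub ((hden.smul (he.clm_comp (hM.clm_comp hf))).smulRight he))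
  have h2 : ∀ v, L1adj ι L00 (rayleigh ι M L00 v) v = flipCLM
      (fderiv ℝ L00 v - embed ι ∘L (rayleigh ι M L00 v • ContinuousLinearMap.id ℝ V)) := by
    intro v
    ext x y
    simp [flipCLM, L1adj, L1]
  simp only [h2]
  exact LipschitzNear.comp (g := fun q : V × ℝ × (V →L[ℝ] V →L[ℝ] ℝ) =>
      correction ι M q.1 (flipCLM (q.2.2 - embed ι ∘L (q.2.1 • ContinuousLinearMap.id ℝ V))))
    (f := fun v => (v, rayleigh ι M L00 v, fderiv ℝ L00 v)) h1.lipschitzNear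
    (HasLipFDerivAt.id.lipschitzNear.prodMk (hρ.lipschitzNear.prodMk hX))

/-- The residual vanishes at `u`, so the derivative of the product is the correction frozen at `u`
composed with the derivative of the residual. -/
theorem predictor_hasLipFDerivAt (Δt : ℝ) {μ : ℝ} {u : V} (hu : embed ι u ≠ 0)
    (h : L0 ι L00 μ u = 0) (hL : HasLipFDerivAt L00 (fderiv ℝ L00 u) u)
    (hX : LipschitzNear (fderiv ℝ L00) u) :
    HasLipFDerivAt (predictor ι M L00 Δt)
      (ContinuousLinearMap.id ℝ V + Δt • LPCfull ι M L00 μ u) u := by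
  have h1 := (residual_hasLipFDerivAt ι M L00 hu h hL).lipschitz_clm_apply
    (correction_lipschitzNear ι M L00 hu hL hX) (residual_eq_zero ι M L00 hu h)
  have h2 := HasLipFDerivAt.id.sub (h1.const_smul Δt)
  rw [funext (predictor_eq ι M L00 Δt)]
  refine h2.of_eq ?_
  rw [sub_eq_add_neg, ← smul_neg, rayleigh_eq ι M L00 hu h]
  congr 2
  ext x
  simp only [correction, residualDeriv, LPCfull, Lhat, gammaHat, ContinuousLinearMap.comp_apply,
    _root_.sub_apply, ContinuousLinearMap.smulRight_apply, _root_.smul_apply,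
    _root_.neg_apply, map_sub, map_neg, map_smul, smul_eq_mul]
  module

theorem predictor_eq_self (Δt : ℝ) {μ : ℝ} {u : V} (hu : embed ι u ≠ 0)
    (h : L0 ι L00 μ u = 0) : predictor ι M L00 Δt u = u := by
  rw [predictor_eq, residual_eq_zero ι M L00 hu h]
  simp

theorem step_eq_self (P Δt : ℝ) {μ : ℝ} {u : V} (hP : P ≠ 0) (hu : power ι u = P)
    (h : L0 ι L00 μ u = 0) : step ι M L00 P Δt u = u := by
  rw [step_eq, predictor_eq_self ι M L00 Δt (embed_ne_zero_of_power ι (hu ▸ hP)) h,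
    normalize_of_power_eq ι hP hu]

theorem step_hasLipFDerivAt (Δt : ℝ) {μ : ℝ} {u : V} (hu : power ι u ≠ 0)
    (h : L0 ι L00 μ u = 0) (hL : HasLipFDerivAt L00 (fderiv ℝ L00 u) u)
    (hX : LipschitzNear (fderiv ℝ L00) u) :
    HasLipFDerivAt (step ι M L00 (power ι u) Δt)
      (radialProj ι u ∘L (ContinuousLinearMap.id ℝ V + Δt • LPCfull ι M L00 μ u)) u := by
  have he := embed_ne_zero_of_power ι hu
  refine HasLipFDerivAt.comp (g := normalize ι (power ι u)) ?_
    (predictor_hasLipFDerivAt ι M L00 Δt he h hL hX)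
  rw [predictor_eq_self ι M L00 Δt he h]
  exact normalize_hasLipFDerivAt ι hu

end StepDerivative

end PCSOM

/-! ### The factorization of the linearized operator, and its spectral bounds -/

namespace PCSOM

section LinearizedOperator

variable {V H : Type*} [NormedAddCommGroup V] [NormedSpace ℝ V]
  [NormedAddCommGroup H] [InnerProductSpace ℝ H]
  (ι : V →L[ℝ] H) (M : AccelerationOperator V) (L00 : V → StrongDual ℝ V)

theorem embed_residualDeriv (μ : ℝ) {u : V} (hu : embed ι u ≠ 0) (x : V) :
    embed ι u (residualDeriv ι M L00 μ u x) = 0 := by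
  have hd := denom_ne_zero ι M u hu
  have hd' : embed ι u (Minv M (embed ι u)) = denom ι M u := rfl
  simp only [residualDeriv, beta, ContinuousLinearMap.comp_apply, _root_.sub_apply,
    ContinuousLinearMap.smulRight_apply, _root_.smul_apply, map_sub, map_smul, smul_eq_mul, hd']
  field_simp
  ring

theorem residualDeriv_eq_zero (μ : ℝ) (u : V) {x : V} (hx : L1 ι L00 μ u x = 0) :
    residualDeriv ι M L00 μ u x = 0 := by
  simp [residualDeriv, beta, hx]

theorem embed_LPCfull (μ : ℝ) (u x : V) : embed ι u (LPCfull ι M L00 μ u x) = 0 :=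
  LPCfull_mem ι M L00 μ u x

/-- `𝓛_PC = -B*B` with respect to the form of `M`, where `B` is the linearization of the
residual. -/
theorem op_LPCfull (μ : ℝ) {u : V} (hu : embed ι u ≠ 0) (x : V) {y : V}
    (hy : embed ι u y = 0) : M.op (LPCfull ι M L00 μ u x) y =
      -M.op (residualDeriv ι M L00 μ u x) (residualDeriv ι M L00 μ u y) := by
  have h1 := embed_residualDeriv ι M L00 μ hu x
  rw [M.hermitian (residualDeriv ι M L00 μ u x)]
  have h2 : M.op (residualDeriv ι M L00 μ u y) =
      L1 ι L00 μ u y - beta ι M L00 μ u y • embed ι u := by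
    simp [residualDeriv, op_Minv]
  have h3 : M.op (LPCfull ι M L00 μ u x) = Lhat ι M L00 μ u x
      - gammaHat ι M L00 μ u x • embed ι u := by
    simp [LPCfull, op_Minv]
  have h4 : Lhat ι M L00 μ u x = -(L1adj ι L00 μ u (residualDeriv ι M L00 μ u x)) := rfl
  rw [h2, h3, h4]
  -- The `gammaHat` term drops because `y` lies in `S`, and the `beta` term of `y` drops because the
  -- linearized residual of `x` lies in `S`.
  simp [h1, hy, L1adj]

/-- The projection onto `S` that is orthogonal with respect to the form of `M`. -/
def orthProj (u : V) : V →L[ℝ] V :=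
  ContinuousLinearMap.id ℝ V - (denom ι M u)⁻¹ • (embed ι u).smulRight (Minv M (embed ι u))

theorem orthProj_apply (u x : V) : orthProj ι M u x =
    x - ((denom ι M u)⁻¹ * embed ι u x) • Minv M (embed ι u) := by
  simp [orthProj, smul_smul]

theorem embed_orthProj {u : V} (hu : embed ι u ≠ 0) (x : V) :
    embed ι u (orthProj ι M u x) = 0 := by
  have hd := denom_ne_zero ι M u hu
  have hd' : embed ι u (Minv M (embed ι u)) = denom ι M u := rfl
  rw [orthProj_apply, map_sub, map_smul, hd', smul_eq_mul]
  field_simp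
  ring

theorem op_orthProj (u x : V) {y : V} (hy : embed ι u y = 0) :
    M.op (orthProj ι M u x) y = M.op x y := by
  rw [orthProj_apply, map_sub, map_smul, op_Minv]
  simp [hy]

/-- The form of `M` on `S`. -/
def orthForm (u : V) : orthSpace ι u →L[ℝ] StrongDual ℝ (orthSpace ι u) :=
  (M.op : V →L[ℝ] StrongDual ℝ V).bilinearComp (orthSpace ι u).subtypeL (orthSpace ι u).subtypeL

theorem orthForm_apply (u : V) (x y : orthSpace ι u) : orthForm ι M u x y = M.op x y := rfl

theorem embed_eq_zero_of_mem {u : V} (x : orthSpace ι u) : embed ι u x = 0 := x.2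

/-- Extend the functional to `V` by Hahn–Banach, represent it through `M⁻¹`, and project onto `S`
along `M⁻¹ u`, which is `M`-orthogonal to `S`. -/
theorem orthForm_surjective {u : V} (hu : embed ι u ≠ 0) :
    Function.Surjective (orthForm ι M u) := by
  intro f
  obtain ⟨g, hg, -⟩ := exists_extension_norm_eq (orthSpace ι u) f
  refine ⟨⟨orthProj ι M u (Minv M g), embed_orthProj ι M hu _⟩, ?_⟩
  ext x
  rw [orthForm_apply, op_orthProj ι M u _ (embed_eq_zero_of_mem ι x), op_Minv, hg]

theorem orthForm_LPC (μ : ℝ) {u : V} (hu : embed ι u ≠ 0) (x y : orthSpace ι u) :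
    orthForm ι M u (LPC ι M L00 μ u x) y = orthForm ι M u x (LPC ι M L00 μ u y) := by
  rw [orthForm_apply, orthForm_apply]
  change M.op (LPCfull ι M L00 μ u x) y = M.op x (LPCfull ι M L00 μ u y)
  rw [op_LPCfull ι M L00 μ hu _ (embed_eq_zero_of_mem ι y), M.hermitian (x : V),
    op_LPCfull ι M L00 μ hu _ (embed_eq_zero_of_mem ι x), M.hermitian]

theorem le_op_LPCfull (μ : ℝ) {u : V} (hu : embed ι u ≠ 0) {lam : ℝ}
    (h : IsLeast (spectrum ℝ (LPC ι M L00 μ u)) lam) {x : V} (hx : embed ι u x = 0) :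
    lam * M.op x x ≤ M.op (LPCfull ι M L00 μ u x) x := by
  obtain ⟨c, hc, hco⟩ := M.exists_coercive
  exact le_form_of_isLeast_spectrum (orthForm ι M u) (fun x y => M.hermitian x y) hc
    (fun x => hco x) (orthForm_LPC ι M L00 μ hu) h ⟨x, hx⟩

theorem isClosed_orthSpace (u : V) : IsClosed (orthSpace ι u : Set V) :=
  (embed ι u).isClosed_ker

theorem exists_approx_eigenvector_LPCfull [CompleteSpace V] (μ : ℝ) {u : V}
    (hu : embed ι u ≠ 0) {lam : ℝ} (h : lam ∈ spectrum ℝ (LPC ι M L00 μ u)) {η : ℝ}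
    (hη : 0 < η) : ∃ x, x ≠ 0 ∧ embed ι u x = 0 ∧
      ‖LPCfull ι M L00 μ u x - lam • x‖ ≤ η * ‖x‖ := by
  have : CompleteSpace (orthSpace ι u) := (isClosed_orthSpace ι u).completeSpace_coe
  obtain ⟨x, hx, hxe⟩ := exists_approx_eigenvector (orthForm ι M u) (orthForm_surjective ι M hu)
    (fun x hx => M.posDef x (by simpa using hx)) (orthForm_LPC ι M L00 μ hu) h hη
  exact ⟨x, by simpa using hx, x.2, hxe⟩

theorem exists_bound_LPCfull (μ : ℝ) (u : V) {lam : ℝ}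
    (h : lam ∉ spectrum ℝ (LPC ι M L00 μ u)) :
    ∃ c > 0, ∀ x, embed ι u x = 0 → c * ‖x‖ ≤ ‖LPCfull ι M L00 μ u x - lam • x‖ := by
  obtain ⟨c, hc, hb⟩ := exists_bound_of_notMem_spectrum h
  exact ⟨c, hc, fun x hx => hb ⟨x, hx⟩⟩

theorem op_LPCfull_self_nonpos (μ : ℝ) {u : V} (hu : embed ι u ≠ 0) {x : V}
    (hx : embed ι u x = 0) : M.op (LPCfull ι M L00 μ u x) x ≤ 0 := by
  rw [op_LPCfull ι M L00 μ hu x hx, neg_nonpos]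
  exact M.nonneg _

theorem isLeast_nonpos [CompleteSpace V] (μ : ℝ) {u : V} (hu : embed ι u ≠ 0) {lam : ℝ}
    (h : IsLeast (spectrum ℝ (LPC ι M L00 μ u)) lam) : lam ≤ 0 := by
  obtain ⟨x, hx, hxs, -⟩ := exists_approx_eigenvector_LPCfull ι M L00 μ hu h.1 one_pos
  have h1 := le_op_LPCfull ι M L00 μ hu h hxs
  have h2 := op_LPCfull_self_nonpos ι M L00 μ hu hxs
  have h3 := M.posDef x hx
  by_contra! h4
  have := mul_pos h4 h3
  linarith

/-- With `|Λ|` the bound of `𝓛_PC = -B*B`, one has `‖B* B x‖² ≤ |Λ| ‖B x‖²`. -/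
theorem op_LPCfull_LPCfull_le (μ : ℝ) {u : V} (hu : embed ι u ≠ 0) {lam : ℝ}
    (h : IsLeast (spectrum ℝ (LPC ι M L00 μ u)) lam) (x : V) :
    M.op (LPCfull ι M L00 μ u x) (LPCfull ι M L00 μ u x) ≤
      -lam * M.op (residualDeriv ι M L00 μ u x) (residualDeriv ι M L00 μ u x) := by
  set G := LPCfull ι M L00 μ u
  set B := residualDeriv ι M L00 μ u
  have hs := embed_LPCfull ι M L00 μ u x
  have h1 : M.op (G x) (G x) = -M.op (B x) (B (G x)) := op_LPCfull ι M L00 μ hu x hs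
  have h2 : M.op (B (G x)) (B (G x)) ≤ -lam * M.op (G x) (G x) := by
    have e1 := le_op_LPCfull ι M L00 μ hu h hs
    have e2 := op_LPCfull ι M L00 μ hu (G x) hs
    change M.op (G (G x)) (G x) = -M.op (B (G x)) (B (G x)) at e2
    change lam * M.op (G x) (G x) ≤ M.op (G (G x)) (G x) at e1
    linarith
  have h3 := M.op_sq_le (B x) (B (G x))
  have h4 : M.op (G x) (G x) ^ 2 ≤ M.op (B x) (B x) * (-lam * M.op (G x) (G x)) := by
    rw [h1, neg_sq]
    exact h3.trans (mul_le_mul_of_nonneg_left (h1 ▸ h2) (M.nonneg _))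
  rcases (M.nonneg (G x)).eq_or_lt with h0 | h0
  · rw [← h0]
    have e1 : 0 ≤ M.op (B x) (B x) := M.nonneg _
    by_cases hl : lam ≤ 0
    · exact mul_nonneg (neg_nonneg.2 hl) e1
    -- A positive `lam` is impossible: as `𝓛_PC` is nonpositive, `S` would be trivial and the
    -- spectrum empty.
    · exfalso
      push Not at hl
      have : Nontrivial (orthSpace ι u) := by
        by_contra hn
        rw [not_nontrivial_iff_subsingleton] at hn
        have := h.1
        rw [spectrum.of_subsingleton] at this
        exact this
      obtain ⟨y, hy⟩ := exists_ne (0 : orthSpace ι u)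
      have e2 := le_op_LPCfull ι M L00 μ hu h y.2
      have e3 := op_LPCfull_self_nonpos ι M L00 μ hu y.2
      have e4 := mul_pos hl (M.posDef y (by simpa using hy))
      linarith
  · refine le_of_mul_le_mul_right ?_ h0
    calc _ = M.op (G x) (G x) ^ 2 := by ring
      _ ≤ _ := h4
      _ = _ := by ring

/-- Expand the square with `G = 𝓛_PC` and `B` the linearized residual: the cross term is `-2t ‖Bx‖²`
and the last is at most `-t² lam ‖Bx‖²` in the energy norm. The sign of `2 + t * lam` separates the
stable regime from the unstable one. -/
theorem op_one_add_LPCfull_le (μ : ℝ) {u : V} (hu : embed ι u ≠ 0) {lam : ℝ}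
    (h : IsLeast (spectrum ℝ (LPC ι M L00 μ u)) lam) {x : V} (hx : embed ι u x = 0) (t : ℝ) :
    M.op (x + t • LPCfull ι M L00 μ u x) (x + t • LPCfull ι M L00 μ u x) ≤
      M.op x x - t * (2 + t * lam) *
        M.op (residualDeriv ι M L00 μ u x) (residualDeriv ι M L00 μ u x) := by
  have h1 := op_LPCfull ι M L00 μ hu x hx
  have h2 := mul_le_mul_of_nonneg_left (op_LPCfull_LPCfull_le ι M L00 μ hu h x) (sq_nonneg t)
  have h3 := M.hermitian x (LPCfull ι M L00 μ u x)
  simp only [map_add, map_smul, _root_.add_apply, _root_.smul_apply, smul_eq_mul]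
  rw [h3, h1]
  linarith

end LinearizedOperator

/-! ### The solution family as a chart of the neutral directions -/

section Family

variable {V H : Type*} [NormedAddCommGroup V] [NormedSpace ℝ V]
  [NormedAddCommGroup H] [InnerProductSpace ℝ H]
  (ι : V →L[ℝ] H) (L00 : V → StrongDual ℝ V)
  {s : ℕ} {U : ℝ → (Fin s → ℝ) → V} {μ : ℝ} {c₀ : Fin s → ℝ}

/-- The derivative of the family with respect to the propagation constant. -/
theorem IsSolutionFamily.exists_deriv (hU : IsSolutionFamily ι L00 U μ c₀)
    (hd : DifferentiableAt ℝ L00 (U μ c₀)) :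
    ∃ D : ℝ × (Fin s → ℝ) →L[ℝ] V,
      HasStrictFDerivAt (fun p : ℝ × (Fin s → ℝ) => U p.1 p.2) D (μ, c₀) ∧
      (∀ j, D (0, Pi.single j 1) = invarianceMode U μ c₀ j) ∧
      L1 ι L00 μ (U μ c₀) (D (1, 0)) = embed ι (U μ c₀) ∧
      deriv (fun m => power ι (U m c₀)) μ = 2 * embed ι (U μ c₀) (D (1, 0)) := by
  have hD := hU.1.hasStrictFDerivAt one_ne_zero
  set D := fderiv ℝ (fun p : ℝ × (Fin s → ℝ) => U p.1 p.2) (μ, c₀)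
  refine ⟨D, hD, fun j => ?_, ?_, ?_⟩
  · have h1 : HasFDerivAt (U μ) (D ∘L .inr ℝ ℝ (Fin s → ℝ)) c₀ :=
      HasFDerivAt.comp (g := fun p : ℝ × (Fin s → ℝ) => U p.1 p.2) (f := fun c => (μ, c)) c₀
        hD.hasFDerivAt (hasFDerivAt_prodMk_right μ c₀)
    rw [invarianceMode, h1.differentiableAt.lineDeriv_eq_fderiv, h1.fderiv]
    simp
  · have h1 : HasFDerivAt (fun p : ℝ × (Fin s → ℝ) => L00 (U p.1 p.2) - p.1 • embed ι (U p.1 p.2))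
        (fderiv ℝ L00 (U μ c₀) ∘L D - (μ • (embed ι ∘L D)
          + (ContinuousLinearMap.fst ℝ ℝ (Fin s → ℝ)).smulRight (embed ι (U μ c₀)))) (μ, c₀) := by
      have e1 := HasFDerivAt.comp (g := L00) (f := fun p : ℝ × (Fin s → ℝ) => U p.1 p.2) (μ, c₀)
        hd.hasFDerivAt hD.hasFDerivAt
      have e2 := ((embed ι).hasFDerivAt (x := U μ c₀)).comp
        (f := fun p : ℝ × (Fin s → ℝ) => U p.1 p.2) (μ, c₀) hD.hasFDerivAt
      exact e1.sub ((hasFDerivAt_fst (p := (μ, c₀))).smul e2)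
    have h2 : (fun p : ℝ × (Fin s → ℝ) => L00 (U p.1 p.2) - p.1 • embed ι (U p.1 p.2))
        =ᶠ[𝓝 (μ, c₀)] fun _ => 0 := hU.2
    have h3 := (h1.congr_of_eventuallyEq h2.symm).unique (hasFDerivAt_const 0 (μ, c₀))
    -- Differentiating the equation of the family along the propagation constant gives `L₁ ∂u/∂μ =
    -- u`.
    have h4 := congrArg (fun f : ℝ × (Fin s → ℝ) →L[ℝ] StrongDual ℝ V => f (1, 0)) h3
    simp only [_root_.sub_apply, _root_.add_apply, ContinuousLinearMap.comp_apply,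
      _root_.smul_apply, ContinuousLinearMap.smulRight_apply, ContinuousLinearMap.coe_fst',
      one_smul, _root_.zero_apply] at h4
    simp only [L1, _root_.sub_apply, _root_.smul_apply]
    rw [← sub_sub, sub_eq_zero] at h4
    exact h4
  · have h1 : HasDerivAt (fun m : ℝ => (m, c₀)) (1, 0) μ :=
      (hasDerivAt_id μ).prodMk (hasDerivAt_const μ c₀)
    have h2 := HasFDerivAt.comp_hasDerivAt (l := fun p : ℝ × (Fin s → ℝ) => U p.1 p.2)
      (f := fun m : ℝ => (m, c₀)) μ hD.hasFDerivAt h1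
    have h3 := HasFDerivAt.comp_hasDerivAt (l := power ι) μ
      (hasFDerivAt_power ι (U μ c₀)) h2
    exact h3.deriv.trans (by simp)

/-- Near the solitary wave, the solutions of the given power can be used to adjust the component
in the span of the invariance modes. -/
theorem IsSolutionFamily.exists_nearby [CompleteSpace V] (hU : IsSolutionFamily ι L00 U μ c₀)
    (hd : DifferentiableAt ℝ L00 (U μ c₀))
    (K : Submodule ℝ V) (hK : K = Submodule.span ℝ (Set.range (invarianceMode U μ c₀)))
    (horth : ∀ x ∈ K, embed ι (U μ c₀) x = 0)
    (hP' : deriv (fun m => power ι (U m c₀)) μ ≠ 0) (π : V →L[ℝ] K) (hπ : ∀ x : K, π x = x)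
    {ε : ℝ} (hε : 0 < ε) :
    ∀ᶠ v in 𝓝 (U μ c₀), ∃ (μ' : ℝ) (c' : Fin s → ℝ), |μ' - μ| < ε ∧ ‖c' - c₀‖ < ε ∧
      L0 ι L00 μ' (U μ' c') = 0 ∧ power ι (U μ' c') = power ι (U μ c₀) ∧
      ‖U μ' c' - U μ c₀‖ < ε ∧ π (v - U μ' c') = 0 := by
  have : FiniteDimensional ℝ K := by
    rw [hK]; exact FiniteDimensional.span_of_finite ℝ (Set.finite_range _)
  have : CompleteSpace K := FiniteDimensional.complete ℝ K
  obtain ⟨D, hD, hDc, -, hDP⟩ := hU.exists_deriv ι L00 hd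
  set u := U μ c₀ with hu
  set Φ : ℝ × (Fin s → ℝ) → ℝ × K := fun p => (power ι (U p.1 p.2), π (U p.1 p.2)) with hΦ
  have hpow : HasStrictFDerivAt (power ι) ((2 : ℝ) • embed ι u) u := by
    have := (contDiff_power ι).contDiffAt (x := u) |>.hasStrictFDerivAt two_ne_zero
    rwa [(hasFDerivAt_power ι u).fderiv] at this
  have hΦ' : HasStrictFDerivAt Φ ((((2 : ℝ) • embed ι u) ∘L D).prod (π ∘L D)) (μ, c₀) :=
    (HasStrictFDerivAt.comp (g := power ι) (μ, c₀) hpow hD).prodMk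
      (HasStrictFDerivAt.comp (g := π) (μ, c₀) π.hasStrictFDerivAt hD)
  rw [hDP] at hP'
  -- The parameters `c` fill `K` without changing the power to first order, because `K` is
  -- orthogonal to `u`; the propagation constant changes the power at the rate `P'(μ) ≠ 0`. Only
  -- surjectivity is used, so the invariance modes may be linearly dependent.
  have hsurj : ((((2 : ℝ) • embed ι u) ∘L D).prod (π ∘L D)).range = ⊤ := by
    rw [LinearMap.range_eq_top]
    rintro ⟨a, k⟩
    set m := a / (2 * embed ι u (D (1, 0))) with hm
    have hk : ∀ x ∈ K, ∃ c : Fin s → ℝ, D (0, c) = x := by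
      intro x hx
      rw [hK] at hx
      obtain ⟨c, hc⟩ := (Submodule.mem_span_range_iff_exists_fun ℝ).1 hx
      refine ⟨c, ?_⟩
      rw [← hc]
      have : D ∘ₗ LinearMap.inr ℝ ℝ (Fin s → ℝ) =
          Fintype.linearCombination ℝ (invarianceMode U μ c₀) := by
        refine LinearMap.pi_ext' fun j => ?_
        ext
        simp [hDc]
      simpa [Fintype.linearCombination_apply] using LinearMap.congr_fun this c
    obtain ⟨c, hc⟩ := hk (k - π (m • D (1, 0))) (Submodule.sub_mem _ k.2 (Subtype.mem _))
    have hmc : D (m, c) = m • D (1, 0) + D (0, c) := by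
      rw [← map_smul, ← map_add]; simp
    refine ⟨(m, c), ?_⟩
    have h1 : embed ι u (D (0, c)) = 0 := by
      rw [hc]; exact horth _ (Submodule.sub_mem _ k.2 (Subtype.mem _))
    have h2 : π (D (0, c)) = k - π (m • D (1, 0)) := by
      rw [hc, ← AddSubgroupClass.coe_sub]
      exact hπ _
    refine Prod.ext ?_ ?_
    · simp only [ContinuousLinearMap.coe_coe, ContinuousLinearMap.prod_apply,
        ContinuousLinearMap.comp_apply, _root_.smul_apply, smul_eq_mul, hmc, map_add, h1,
        map_smul]
      rw [mul_zero, add_zero, hm, div_mul_cancel₀ _ hP']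
    · simp only [ContinuousLinearMap.coe_coe, ContinuousLinearMap.prod_apply,
        ContinuousLinearMap.comp_apply, hmc, map_add, h2]
      abel
  have hmap := hΦ'.map_nhds_eq_of_surj hsurj
  have hcont : ContinuousAt (fun p : ℝ × (Fin s → ℝ) => U p.1 p.2) (μ, c₀) := hD.continuousAt
  have hgood : ∀ᶠ p : ℝ × (Fin s → ℝ) in 𝓝 (μ, c₀), |p.1 - μ| < ε ∧ ‖p.2 - c₀‖ < ε ∧
      L0 ι L00 p.1 (U p.1 p.2) = 0 ∧ ‖U p.1 p.2 - u‖ < ε := by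
    have h1 : ∀ᶠ p : ℝ × (Fin s → ℝ) in 𝓝 (μ, c₀), |p.1 - μ| < ε := by
      have : Continuous fun p : ℝ × (Fin s → ℝ) => |p.1 - μ| := by fun_prop
      exact (this.tendsto (μ, c₀)).eventually_lt_const (by simpa using hε)
    have h2 : ∀ᶠ p : ℝ × (Fin s → ℝ) in 𝓝 (μ, c₀), ‖p.2 - c₀‖ < ε := by
      have : Continuous fun p : ℝ × (Fin s → ℝ) => ‖p.2 - c₀‖ := by fun_prop
      exact (this.tendsto (μ, c₀)).eventually_lt_const (by simpa using hε)
    have h3 : ∀ᶠ p : ℝ × (Fin s → ℝ) in 𝓝 (μ, c₀), ‖U p.1 p.2 - u‖ < ε := by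
      have := hcont.eventually (Metric.ball_mem_nhds _ hε)
      simpa [dist_eq_norm] using this
    filter_upwards [h1, h2, h3, hU.2] with p a b c d
    exact ⟨a, b, d, c⟩
  have himg : Φ '' {p | |p.1 - μ| < ε ∧ ‖p.2 - c₀‖ < ε ∧
      L0 ι L00 p.1 (U p.1 p.2) = 0 ∧ ‖U p.1 p.2 - u‖ < ε} ∈ 𝓝 (power ι u, π u) := by
    have : Φ (μ, c₀) = (power ι u, π u) := rfl
    rw [← this, ← hmap]
    exact image_mem_map hgood
  -- The target prescribes the power of `u` and the `K`-component of `v`; for `v` near `u` it lies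
  -- in the image of `Φ`.
  have hpi : Tendsto (fun v : V => (power ι u, π v)) (𝓝 u) (𝓝 (power ι u, π u)) := by
    have : Continuous fun v : V => (power ι u, π v) := by fun_prop
    exact this.tendsto u
  filter_upwards [hpi himg] with v hv
  obtain ⟨⟨μ', c'⟩, ⟨h1, h2, h3, h4⟩, h5⟩ := hv
  have h6 := congrArg Prod.fst h5
  have h7 := congrArg Prod.snd h5
  refine ⟨μ', c', h1, h2, h3, h6, h4, ?_⟩
  rw [map_sub, sub_eq_zero]
  exact h7.symm

end Family

end PCSOM

/-! ### Contracting increments and operators with closed range -/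

section Contraction

variable {V : Type*} [NormedAddCommGroup V] [NormedSpace ℝ V]

/-- Iterates of a map that contracts its own increments converge to a fixed point. -/
theorem exists_tendsto_iterate_of_contracting_increments [CompleteSpace V] {p : Seminorm ℝ V}
    {c C : ℝ} (hc : 0 < c) (hlow : ∀ x, c * ‖x‖ ≤ p x) (hC : 0 < C) (hup : ∀ x, p x ≤ C * ‖x‖)
    {F : V → V} {u : V} (hFu : F u = u) {good : V → Prop} {r ρ K : ℝ} (hr : 0 < r) (hρ0 : 0 ≤ ρ)
    (hρ1 : ρ < 1) (hLip : ∀ v w, ‖v - u‖ < r → ‖w - u‖ < r → ‖F v - F w‖ ≤ K * ‖v - w‖)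
    (hgood : ∀ v, ‖v - u‖ < r → good (F v))
    (hcontr : ∀ v, ‖v - u‖ < r → ‖F v - u‖ < r → good v →
      p (F (F v) - F v) ≤ ρ * p (F v - v)) {ε : ℝ} (hε : 0 < ε) :
    ∃ δ > 0, ∀ v, ‖v - u‖ < δ → (∀ n, ‖F^[n] v - u‖ < ε) ∧
      ∃ q, Tendsto (fun n => F^[n] v) atTop (𝓝 q) ∧ ‖q - u‖ < ε ∧ F q = q := by
  set a := min ε r / 2 with ha
  have ha0 : 0 < a := by have := lt_min hε hr; positivity
  have haε : a < ε := by have := lt_min hε hr; have := min_le_left ε r; linarith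
  have har : a < r := by have := lt_min hε hr; have := min_le_right ε r; linarith
  have h1ρ : 0 < 1 - ρ := by linarith
  set K' := |K| + 1 with hK'
  have hK'1 : 1 ≤ K' := by have := abs_nonneg K; linarith
  have hF : ∀ v, ‖v - u‖ < r → ‖F v - u‖ ≤ K' * ‖v - u‖ := by
    intro v hv
    have h1 := hLip v u hv (by simpa using hr)
    rw [hFu] at h1
    refine h1.trans ?_
    gcongr
    have := le_abs_self K; linarith
  set δ := min (a / (2 * K')) (c * (1 - ρ) * a / (4 * C * K' * K')) with hδ
  have hδ0 : 0 < δ := by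
    have : 0 < K' := by linarith
    refine lt_min (by positivity) (by positivity)
  refine ⟨δ, hδ0, fun v hv => ?_⟩
  have hK'0 : 0 < K' := by linarith
  have hv1 : K' * ‖v - u‖ < a / 2 := by
    have := hv.trans_le (min_le_left _ _)
    rw [lt_div_iff₀ (by positivity)] at this
    linarith
  have hv2 : 4 * C * K' * K' * ‖v - u‖ < c * (1 - ρ) * a := by
    have := hv.trans_le (min_le_right _ _)
    rw [lt_div_iff₀ (by positivity)] at this
    linarith
  have hva : ‖v - u‖ < a := by
    have : 1 * ‖v - u‖ ≤ K' * ‖v - u‖ := by gcongr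
    linarith
  -- The sequence starts at `F v`, because `good` is only guaranteed for images under `F`.
  set x : ℕ → V := fun n => F^[n] (F v) with hx
  have hx0 : x 0 = F v := rfl
  have hxs : ∀ n, x (n + 1) = F (x n) := fun n => Function.iterate_succ_apply' F n (F v)
  set d := p (x 1 - x 0) with hd
  have hx0a : ‖x 0 - u‖ < a / 2 := (hF v (hva.trans har)).trans_lt hv1
  have hdle : d < c * (1 - ρ) * (a / 2) := by
    have h0 : ‖x 0 - u‖ ≤ K' * ‖v - u‖ := hF v (hva.trans har)
    have h1 : ‖x 1 - u‖ ≤ K' * ‖x 0 - u‖ := hF (x 0) (by linarith)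
    have h2 : ‖x 1 - x 0‖ ≤ 2 * K' * K' * ‖v - u‖ := by
      calc ‖x 1 - x 0‖ = ‖(x 1 - u) - (x 0 - u)‖ := by congr 1; abel
        _ ≤ ‖x 1 - u‖ + ‖x 0 - u‖ := norm_sub_le _ _
        _ ≤ K' * ‖x 0 - u‖ + K' * ‖x 0 - u‖ := by
          gcongr
          have : 1 * ‖x 0 - u‖ ≤ K' * ‖x 0 - u‖ := by gcongr
          linarith
        _ ≤ K' * (K' * ‖v - u‖) + K' * (K' * ‖v - u‖) := by gcongr
        _ = _ := by ring
    calc d ≤ C * ‖x 1 - x 0‖ := hup _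
      _ ≤ C * (2 * K' * K' * ‖v - u‖) := by gcongr
      _ < _ := by linarith
  have hd0 : 0 ≤ d := apply_nonneg _ _
  have hball : ∀ n, p (x n - x 0) * (1 - ρ) ≤ (1 - ρ ^ n) * d → ‖x n - u‖ < a := by
    intro n hn
    have h1 : c * ‖x n - x 0‖ * (1 - ρ) ≤ d := by
      calc c * ‖x n - x 0‖ * (1 - ρ) ≤ p (x n - x 0) * (1 - ρ) := by gcongr; exact hlow _
        _ ≤ (1 - ρ ^ n) * d := hn
        _ ≤ 1 * d := by gcongr; have := pow_nonneg hρ0 n; linarith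
        _ = d := one_mul d
    have h2 : ‖x n - x 0‖ < a / 2 := by
      have : (c * (1 - ρ)) * ‖x n - x 0‖ < (c * (1 - ρ)) * (a / 2) := by linarith
      exact lt_of_mul_lt_mul_left this (by positivity)
    calc ‖x n - u‖ = ‖(x n - x 0) + (x 0 - u)‖ := by congr 1; abel
      _ ≤ ‖x n - x 0‖ + ‖x 0 - u‖ := norm_add_le _ _
      _ < a := by linarith
  -- The partial geometric sum is carried along, so that the next iterate is known to be in the ball
  -- before the contraction is applied.
  have key : ∀ n, p (x n - x 0) * (1 - ρ) ≤ (1 - ρ ^ n) * d ∧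
      p (x (n + 1) - x n) ≤ ρ ^ n * d ∧ good (x n) := by
    intro n
    induction n with
    | zero => exact ⟨by simp, by simp [hd], hgood v (hva.trans har)⟩
    | succ n ih =>
      obtain ⟨i1, i2, i3⟩ := ih
      have j1 : p (x (n + 1) - x 0) * (1 - ρ) ≤ (1 - ρ ^ (n + 1)) * d := by
        have e1 : p (x (n + 1) - x 0) ≤ p (x (n + 1) - x n) + p (x n - x 0) := by
          have := map_add_le_add p (x (n + 1) - x n) (x n - x 0)
          rwa [sub_add_sub_cancel] at this
        calc p (x (n + 1) - x 0) * (1 - ρ)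
            ≤ (p (x (n + 1) - x n) + p (x n - x 0)) * (1 - ρ) := by gcongr
          _ = p (x (n + 1) - x n) * (1 - ρ) + p (x n - x 0) * (1 - ρ) := by ring
          _ ≤ ρ ^ n * d * (1 - ρ) + (1 - ρ ^ n) * d := by gcongr
          _ = _ := by ring
      have b1 := (hball n i1).trans har
      have b2 := (hball (n + 1) j1).trans har
      refine ⟨j1, ?_, ?_⟩
      · have := hcontr (x n) b1 (by rw [← hxs]; exact b2) i3
        rw [← hxs, ← hxs] at this
        calc _ ≤ ρ * p (x (n + 1) - x n) := this
          _ ≤ ρ * (ρ ^ n * d) := by gcongr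
          _ = _ := by ring
      · rw [hxs]; exact hgood _ b1
  have hxa : ∀ n, ‖x n - u‖ < a := fun n => hball n (key n).1
  have hcau : CauchySeq x := by
    refine cauchySeq_of_le_geometric ρ (d / c) hρ1 fun n => ?_
    rw [dist_eq_norm, norm_sub_rev, div_mul_eq_mul_div, le_div_iff₀ hc, mul_comm, mul_comm d]
    exact (hlow _).trans (key n).2.1
  obtain ⟨q, hq⟩ := cauchySeq_tendsto_of_complete hcau
  have hqa : ‖q - u‖ ≤ a := le_of_tendsto ((hq.sub_const u).norm) (.of_forall fun n => (hxa n).le)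
  have hFq : F q = q := by
    have h1 : Tendsto (fun n => F (x n)) atTop (𝓝 (F q)) := by
      rw [tendsto_iff_norm_sub_tendsto_zero]
      have h2 : Tendsto (fun n => K * ‖x n - q‖) atTop (𝓝 0) := by
        have := (tendsto_iff_norm_sub_tendsto_zero.1 hq).const_mul K
        simpa using this
      exact squeeze_zero (fun n => norm_nonneg _)
        (fun n => hLip _ _ ((hxa n).trans har) (hqa.trans_lt har)) h2
    have h3 : Tendsto (fun n => F (x n)) atTop (𝓝 q) := by
      simp_rw [← hxs]
      exact hq.comp (tendsto_add_atTop_nat 1)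
    exact tendsto_nhds_unique h1 h3
  refine ⟨fun n => ?_, q, ?_, hqa.trans_lt haε, hFq⟩
  · cases n with
    | zero => exact hva.trans haε
    | succ n =>
      rw [Function.iterate_succ_apply]
      exact (hxa n).trans haε
  · rw [← tendsto_add_atTop_iff_nat 1]
    simpa only [Function.iterate_succ_apply] using hq

/-- An operator with closed range is bounded below on a complement of its kernel. -/
theorem ContinuousLinearMap.exists_norm_sub_le_of_isClosed_range [CompleteSpace V] {W : Type*}
    [NormedAddCommGroup W] [NormedSpace ℝ W] [CompleteSpace W] (A : V →L[ℝ] W)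
    (hA : IsClosed (Set.range A)) (K : Submodule ℝ V)
    (hK : LinearMap.ker (A : V →ₗ[ℝ] W) = K) (π : V →L[ℝ] K) (hπ : ∀ x : K, π x = x) :
    ∃ C > 0, ∀ x, ‖x - π x‖ ≤ C * ‖A x‖ := by
  have : CompleteSpace (A : V →ₗ[ℝ] W).range := by
    have h : IsClosed ((A : V →ₗ[ℝ] W).range : Set W) := by
      rw [LinearMap.coe_range]
      exact hA
    exact h.completeSpace_coe
  obtain ⟨C, hC, h⟩ := (A.codRestrict (A : V →ₗ[ℝ] W).range
    (fun x => ⟨x, rfl⟩)).exists_preimage_norm_le (by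
      rintro ⟨_, x, rfl⟩
      exact ⟨x, rfl⟩)
  refine ⟨(1 + ‖π‖) * C, by positivity, fun x => ?_⟩
  obtain ⟨x', hx', hn⟩ := h ⟨A x, x, rfl⟩
  have hx'' : A x' = A x := congrArg Subtype.val hx'
  have hmem : x - x' ∈ K := by
    rw [← hK]
    simp [hx'']
  have h1 : π (x - x') = ⟨x - x', hmem⟩ := hπ ⟨x - x', hmem⟩
  have h2 : (π x : V) - π x' = x - x' := by
    have := congrArg Subtype.val h1
    simpa using this
  -- `1 - π` annihilates `K`, so it takes the same value on every preimage of `A x`, in particular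
  -- on the one of controlled norm.
  have h3 : x - π x = x' - π x' := by
    rw [sub_eq_sub_iff_add_eq_add] at h2 ⊢
    rw [add_comm x', h2, add_comm]
  calc ‖x - π x‖ = ‖x' - π x'‖ := by rw [h3]
    _ ≤ ‖x'‖ + ‖(π x' : V)‖ := norm_sub_le _ _
    _ ≤ ‖x'‖ + ‖π‖ * ‖x'‖ := by gcongr; exact π.le_opNorm x'
    _ = (1 + ‖π‖) * ‖x'‖ := by ring
    _ ≤ (1 + ‖π‖) * (C * ‖A x‖) := by gcongr; exact hn
    _ = _ := by ring

end Contraction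

/-! ### Comparison of elements of equal power -/

namespace PCSOM

variable {V H : Type*} [NormedAddCommGroup V] [NormedSpace ℝ V]
  [NormedAddCommGroup H] [InnerProductSpace ℝ H]
  (ι : V →L[ℝ] H) (M : AccelerationOperator V) (L00 : V → StrongDual ℝ V)

/-- Equal power means `⟨v + w, v - w⟩ = 0`. Replacing `v + w` by `2u` leaves a second-order error.
-/
theorem embed_sub_of_power_eq (u : V) {v w : V} (h : power ι v = power ι w) :
    2 * embed ι u (v - w) = -embed ι ((v - u) + (w - u)) (v - w) := by
  simp only [power, ← embed_apply] at h
  have h1 : embed ι v w = embed ι w v := ip_comm ι v w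
  simp only [map_sub, map_add, _root_.add_apply, _root_.sub_apply]
  linarith

/-- Differences of elements of equal power near `u` lie in `S` up to higher order. -/
theorem exists_norm_sub_orthProj_le (u : V) : ∃ C > 0, ∀ v w, power ι v = power ι w →
    ‖(v - w) - orthProj ι M u (v - w)‖ ≤ C * (‖v - u‖ + ‖w - u‖) * ‖v - w‖ := by
  refine ⟨|(denom ι M u)⁻¹| * ‖embed ι‖ * ‖Minv M (embed ι u)‖ + 1, by positivity,
    fun v w h => ?_⟩
  have h1 : |embed ι u (v - w)| ≤ ‖embed ι‖ * (‖v - u‖ + ‖w - u‖) * ‖v - w‖ := by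
    have e1 := embed_sub_of_power_eq ι u h
    have e2 : |embed ι ((v - u) + (w - u)) (v - w)| ≤
        ‖embed ι‖ * (‖v - u‖ + ‖w - u‖) * ‖v - w‖ := by
      refine ((embed ι).le_opNorm₂ _ _).trans ?_
      gcongr
      exact norm_add_le _ _
    have e3 : |2 * embed ι u (v - w)| = 2 * |embed ι u (v - w)| := by
      rw [abs_mul, abs_two]
    rw [e1, abs_neg] at e3
    have := abs_nonneg (embed ι u (v - w))
    linarith
  rw [orthProj_apply, sub_sub_cancel, norm_smul, Real.norm_eq_abs, abs_mul]
  calc |(denom ι M u)⁻¹| * |embed ι u (v - w)| * ‖Minv M (embed ι u)‖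
      ≤ |(denom ι M u)⁻¹| * (‖embed ι‖ * (‖v - u‖ + ‖w - u‖) * ‖v - w‖)
        * ‖Minv M (embed ι u)‖ := by gcongr
    _ = (|(denom ι M u)⁻¹| * ‖embed ι‖ * ‖Minv M (embed ι u)‖)
        * (‖v - u‖ + ‖w - u‖) * ‖v - w‖ := by ring
    _ ≤ _ := by gcongr; simp

theorem stepDeriv_apply (Δt μ : ℝ) {u x : V} (hx : embed ι u x = 0) :
    (radialProj ι u ∘L (ContinuousLinearMap.id ℝ V + Δt • LPCfull ι M L00 μ u)) x =
      x + Δt • LPCfull ι M L00 μ u x := by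
  have h : embed ι u (x + Δt • LPCfull ι M L00 μ u x) = 0 := by
    simp [hx, embed_LPCfull]
  simp only [ContinuousLinearMap.comp_apply, _root_.add_apply, ContinuousLinearMap.id_apply,
    _root_.smul_apply]
  rw [radialProj_apply, ← embed_apply, h]
  simp

/-- On elements of equal power near `u`, the step acts like `1 + Δt 𝓛_PC`. -/
theorem exists_step_sub_le {Δt μ : ℝ} {u : V} {F : V → V}
    (hF : HasLipFDerivAt F
      (radialProj ι u ∘L (ContinuousLinearMap.id ℝ V + Δt • LPCfull ι M L00 μ u)) u)
    (hu : embed ι u ≠ 0) {η : ℝ} (hη : 0 < η) :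
    ∃ r > 0, ∀ v w, ‖v - u‖ < r → ‖w - u‖ < r → power ι v = power ι w →
      ‖(v - w) - orthProj ι M u (v - w)‖ ≤ η * ‖orthProj ι M u (v - w)‖ ∧
      ‖F v - F w - (orthProj ι M u (v - w)
        + Δt • LPCfull ι M L00 μ u (orthProj ι M u (v - w)))‖ ≤
        η * ‖orthProj ι M u (v - w)‖ := by
  set T := radialProj ι u ∘L (ContinuousLinearMap.id ℝ V + Δt • LPCfull ι M L00 μ u) with hT
  set θ := min (1 / 2) (η / (2 * (1 + ‖T‖))) with hθ
  have hθ0 : 0 < θ := by positivity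
  have hθ1 : θ ≤ 1 / 2 := min_le_left _ _
  have hθ2 : 2 * (1 + ‖T‖) * θ ≤ η := by
    have := min_le_right (1 / 2) (η / (2 * (1 + ‖T‖)))
    rw [← hθ, le_div_iff₀ (by positivity)] at this
    linarith
  obtain ⟨r₁, hr₁, h₁⟩ := hF.exists_ball hθ0
  obtain ⟨C, hC, h₂⟩ := exists_norm_sub_orthProj_le ι M u
  refine ⟨min r₁ (θ / (2 * C)), by positivity, fun v w hv hw hp => ?_⟩
  have e1 := h₁ v w (hv.trans_le (min_le_left _ _)) (hw.trans_le (min_le_left _ _))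
  have e2 : ‖(v - w) - orthProj ι M u (v - w)‖ ≤ θ * ‖v - w‖ := by
    refine (h₂ v w hp).trans ?_
    gcongr
    have a1 := hv.trans_le (min_le_right _ _)
    have a2 := hw.trans_le (min_le_right _ _)
    rw [lt_div_iff₀ (by positivity)] at a1 a2
    linarith
  set n := v - w
  set y := orthProj ι M u n
  have e3 : ‖n‖ ≤ 2 * ‖y‖ := by
    have a1 : ‖n‖ ≤ ‖n - y‖ + ‖y‖ := by
      have := norm_add_le (n - y) y
      rwa [sub_add_cancel] at this
    have a2 : θ * ‖n‖ ≤ 1 / 2 * ‖n‖ := by gcongr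
    linarith
  have e4 : 2 * θ ≤ η := by
    have : 0 ≤ 2 * ‖T‖ * θ := by positivity
    linarith
  refine ⟨?_, ?_⟩
  · calc ‖n - y‖ ≤ θ * ‖n‖ := e2
      _ ≤ θ * (2 * ‖y‖) := by gcongr
      _ = 2 * θ * ‖y‖ := by ring
      _ ≤ η * ‖y‖ := by gcongr
  · rw [← stepDeriv_apply ι M L00 Δt μ (embed_orthProj ι M hu n)]
    calc ‖F v - F w - T y‖ = ‖(F v - F w - T n) + T (n - y)‖ := by
          rw [map_sub T n y]; congr 1; abel
      _ ≤ ‖F v - F w - T n‖ + ‖T (n - y)‖ := norm_add_le _ _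
      _ ≤ θ * ‖n‖ + ‖T‖ * (θ * ‖n‖) := by
          gcongr
          exact (T.le_opNorm _).trans (by gcongr)
      _ = (1 + ‖T‖) * θ * ‖n‖ := by ring
      _ ≤ (1 + ‖T‖) * θ * (2 * ‖y‖) := by gcongr
      _ = 2 * (1 + ‖T‖) * θ * ‖y‖ := by ring
      _ ≤ η * ‖y‖ := by gcongr

theorem eventually_power_step {Δt μ : ℝ} {u : V} (hu : power ι u ≠ 0)
    (h : L0 ι L00 μ u = 0) (hL : HasLipFDerivAt L00 (fderiv ℝ L00 u) u)
    (hX : LipschitzNear (fderiv ℝ L00) u) :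
    ∀ᶠ v in 𝓝 u, power ι (step ι M L00 (power ι u) Δt v) = power ι u := by
  have he := embed_ne_zero_of_power ι hu
  have h1 := (predictor_hasLipFDerivAt ι M L00 Δt he h hL hX).continuousAt
  have h2 : ContinuousAt (fun v => power ι (predictor ι M L00 Δt v)) u :=
    ContinuousAt.comp (g := power ι) (contDiff_power ι).continuous.continuousAt h1
  have h3 : power ι (predictor ι M L00 Δt u) ≠ 0 := by
    rwa [predictor_eq_self ι M L00 Δt he h]
  filter_upwards [h2.eventually_ne h3] with v hv
  exact power_normalize ι (power_nonneg ι u) hv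

end PCSOM

/-! ### Convergence below the threshold -/

namespace PCSOM

variable {V H : Type*} [NormedAddCommGroup V] [NormedSpace ℝ V]
  [NormedAddCommGroup H] [InnerProductSpace ℝ H]
  (ι : V →L[ℝ] H) (M : AccelerationOperator V) (L00 : V → StrongDual ℝ V)

/-- When `L₁` has closed range and the power depends on the propagation constant, the linearized
residual is bounded below on `S` modulo the kernel of `L₁`. -/
theorem exists_norm_le_residualDeriv [CompleteSpace V] {μ : ℝ} {u w : V}
    (hw : L1 ι L00 μ u w = embed ι u) (huw : embed ι u w ≠ 0)
    (hcl : IsClosed (Set.range (L1 ι L00 μ u))) (K : Submodule ℝ V)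
    (hK : LinearMap.ker (L1 ι L00 μ u : V →ₗ[ℝ] StrongDual ℝ V) = K)
    (horth : ∀ x ∈ K, embed ι u x = 0) (π : V →L[ℝ] K) (hπ : ∀ x : K, π x = x) :
    ∃ C > 0, ∀ y, embed ι u y = 0 →
      ‖y‖ ≤ C * (‖residualDeriv ι M L00 μ u y‖ + ‖π y‖) := by
  obtain ⟨C, hC, h⟩ := (L1 ι L00 μ u).exists_norm_sub_le_of_isClosed_range hcl K hK π hπ
  set B := residualDeriv ι M L00 μ u
  set m := ‖(M.op : V →L[ℝ] StrongDual ℝ V)‖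
  set a := ‖embed ι u‖ * (C * m) / |embed ι u w| with ha
  have hew : 0 < |embed ι u w| := abs_pos.2 huw
  refine ⟨C * m + a * (‖π‖ * ‖w‖ + ‖w‖) + 1, by positivity, fun y hy => ?_⟩
  set β := beta ι M L00 μ u y
  -- Since `L₁ w = u`, subtracting `β • w` turns `L₁ y - β u` into `L₁ x`. Closed range controls `x`
  -- modulo `K`, and pairing with `u`, which is orthogonal to `y` and to `K`, then controls `β`.
  set x := y - β • w with hx
  have hLx : L1 ι L00 μ u x = M.op (B y) := by
    simp only [B, residualDeriv, ContinuousLinearMap.comp_apply, op_Minv, _root_.sub_apply,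
      ContinuousLinearMap.smulRight_apply, hx, map_sub, map_smul, hw]
    rfl
  have h1 : ‖x - π x‖ ≤ C * m * ‖B y‖ := by
    refine (h x).trans ?_
    rw [hLx, mul_assoc]
    gcongr
    exact (M.op : V →L[ℝ] StrongDual ℝ V).le_opNorm _
  have h2 : embed ι u (x - π x) = -(β * embed ι u w) := by
    rw [map_sub, horth _ (π x).2, hx, map_sub, hy, map_smul]
    simp
  have h3 : |β| ≤ a * ‖B y‖ := by
    have e1 : |β| * |embed ι u w| ≤ ‖embed ι u‖ * (C * m * ‖B y‖) := by
      rw [← abs_mul, ← abs_neg, ← h2]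
      refine ((embed ι u).le_opNorm _).trans ?_
      gcongr
    rw [ha, div_mul_eq_mul_div, le_div_iff₀ hew]
    linarith
  have h4 : (π x : V) = π y - β • (π w : V) := by
    rw [hx, map_sub, map_smul]; rfl
  have h5 : ‖(π w : V)‖ ≤ ‖π‖ * ‖w‖ := π.le_opNorm w
  have hB := norm_nonneg (B y)
  have hπy := norm_nonneg (π y)
  calc ‖y‖ = ‖(x - π x) + π y + (β • w - β • (π w : V))‖ := by
        rw [h4, hx]; congr 1; abel
    _ ≤ ‖x - π x‖ + ‖(π y : V)‖ + (‖β • w‖ + ‖β • (π w : V)‖) :=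
      (norm_add_le _ _).trans (add_le_add (norm_add_le _ _) (norm_sub_le _ _))
    _ ≤ C * m * ‖B y‖ + ‖π y‖ + (a * ‖B y‖ * ‖w‖ + a * ‖B y‖ * (‖π‖ * ‖w‖)) := by
      rw [norm_smul, norm_smul, Real.norm_eq_abs]
      gcongr
      exact le_rfl
    _ ≤ _ := by
      have e1 : 0 ≤ (C * m + a * (‖π‖ * ‖w‖ + ‖w‖)) * ‖π y‖ := by positivity
      linarith

section Contracting

variable {μ Δt lam : ℝ} {u : V} {K : Submodule ℝ V} {π : V →L[ℝ] K}

/-- For `z` in `S` and `M`-orthogonal to `K`, the linearized residual dominates `z`, so the decrease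
in `op_one_add_LPCfull_le` is a fixed fraction of the energy. -/
theorem exists_energyNorm_step_le (hu : embed ι u ≠ 0)
    (hlam : IsLeast (spectrum ℝ (LPC ι M L00 μ u)) lam) (hΔ0 : 0 < Δt) (hΔ : 0 < 2 + Δt * lam)
    (hK : LinearMap.ker (L1 ι L00 μ u : V →ₗ[ℝ] StrongDual ℝ V) = K)
    (horth : ∀ x ∈ K, embed ι u x = 0) (hπ : ∀ x : K, π x = x)
    {C : ℝ} (hC : 0 < C) (hbelow : ∀ y, embed ι u y = 0 →
      ‖y‖ ≤ C * (‖residualDeriv ι M L00 μ u y‖ + ‖π y‖)) :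
    ∃ κ, 0 ≤ κ ∧ κ < 1 ∧ ∀ z, embed ι u z = 0 → (∀ k ∈ K, M.op z k = 0) →
      M.energyNorm (z + Δt • LPCfull ι M L00 μ u z) ≤ κ * M.energyNorm z := by
  obtain ⟨c₁, hc₁, hlow⟩ := M.exists_le_energyNorm
  obtain ⟨c₂, hc₂, hup⟩ := M.exists_energyNorm_le
  set B := residualDeriv ι M L00 μ u
  set D := c₂ * C / c₁ with hD
  have hD0 : 0 < D := by positivity
  set s := Δt * (2 + Δt * lam) with hs
  have hs0 : 0 < s := by positivity
  refine ⟨√(max (1 - s / D ^ 2) 0), by positivity, ?_, fun z hz hzK => ?_⟩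
  · rw [Real.sqrt_lt' one_pos, one_pow, max_lt_iff]
    refine ⟨?_, one_pos⟩
    have : 0 < s / D ^ 2 := by positivity
    linarith
  have hBk : ∀ k ∈ K, B k = 0 := fun k hk =>
    residualDeriv_eq_zero ι M L00 μ u (by rw [← hK] at hk; exact hk)
  -- Being `M`-orthogonal to `K`, `z` has the least energy norm in its class modulo `K`; `π` itself
  -- need not be `M`-orthogonal.
  have hz0 : M.energyNorm z ≤ M.energyNorm (z - π z) := by
    have e1 : M.op z z = M.op z (z - π z) := by
      rw [map_sub, hzK _ (π z).2, sub_zero]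
    have e2 := (le_abs_self _).trans (M.op_le_energyNorm_mul z (z - π z))
    rw [← e1, ← M.energyNorm_sq, sq] at e2
    rcases (apply_nonneg M.energyNorm z).eq_or_lt with h | h
    · rw [← h]; exact apply_nonneg _ _
    · exact le_of_mul_le_mul_left e2 h
  have hz1 : M.energyNorm z ≤ D * M.energyNorm (B z) := by
    have e1 := hbelow (z - π z) (by rw [map_sub, hz, horth _ (π z).2, sub_zero])
    have e2 : π (z - π z) = 0 := by rw [map_sub, hπ, sub_self]
    have e3 : B (z - π z) = B z := by rw [map_sub, hBk _ (π z).2, sub_zero]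
    rw [e2, norm_zero, add_zero] at e1
    change ‖z - π z‖ ≤ C * ‖B (z - π z)‖ at e1
    rw [e3] at e1
    calc M.energyNorm z ≤ c₂ * ‖z - π z‖ := hz0.trans (hup _)
      _ ≤ c₂ * (C * ‖B z‖) := by gcongr
      _ = D * (c₁ * ‖B z‖) := by rw [hD]; field_simp
      _ ≤ _ := by gcongr; exact hlow _
  have hz2 : M.op z z / D ^ 2 ≤ M.op (B z) (B z) := by
    rw [div_le_iff₀ (by positivity), ← M.energyNorm_sq, ← M.energyNorm_sq, mul_comm, ← mul_pow]
    exact pow_le_pow_left₀ (apply_nonneg _ _) hz1 2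
  have h1 := op_one_add_LPCfull_le ι M L00 μ hu hlam hz Δt
  refine le_of_sq_le_sq ?_ (mul_nonneg (Real.sqrt_nonneg _) (apply_nonneg _ _))
  rw [mul_pow, Real.sq_sqrt (le_max_right _ _), M.energyNorm_sq, M.energyNorm_sq]
  calc _ ≤ M.op z z - s * M.op (B z) (B z) := h1
    _ ≤ M.op z z - s * (M.op z z / D ^ 2) := by gcongr
    _ = (1 - s / D ^ 2) * M.op z z := by ring
    _ ≤ _ := by
      gcongr
      · exact M.nonneg z
      · exact le_max_left _ _

/-- When the `K`-component of `y` is relatively small, the linearized residual dominates `y`, and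
Cauchy–Schwarz in `⟨𝓛_PC y, y⟩ = -‖By‖²` passes the bound to `𝓛_PC y`. Thus the increment of a step
controls the distance to the reference solution. -/
theorem exists_le_energyNorm_LPCfull (hu : embed ι u ≠ 0)
    {C : ℝ} (hC : 0 < C) (hbelow : ∀ y, embed ι u y = 0 →
      ‖y‖ ≤ C * (‖residualDeriv ι M L00 μ u y‖ + ‖π y‖)) :
    ∃ c > 0, ∀ y, embed ι u y = 0 → 2 * C * ‖π y‖ ≤ ‖y‖ →
      c * ‖y‖ ≤ M.energyNorm (LPCfull ι M L00 μ u y) := by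
  obtain ⟨c₁, hc₁, hlow⟩ := M.exists_le_energyNorm
  obtain ⟨c₂, hc₂, hup⟩ := M.exists_energyNorm_le
  set B := residualDeriv ι M L00 μ u
  refine ⟨c₁ ^ 2 / (4 * C ^ 2) / c₂, by positivity, fun y hy hπy => ?_⟩
  rcases eq_or_ne y 0 with rfl | hy0
  · simp
  have hny : 0 < ‖y‖ := norm_pos_iff.2 hy0
  have h1 : ‖y‖ ≤ 2 * C * ‖B y‖ := by
    have := hbelow y hy
    change ‖y‖ ≤ C * (‖B y‖ + ‖π y‖) at this
    linarith
  have h2 := op_LPCfull ι M L00 μ hu y hy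
  change M.op (LPCfull ι M L00 μ u y) y = -M.op (B y) (B y) at h2
  have h3 := M.op_le_energyNorm_mul (LPCfull ι M L00 μ u y) y
  rw [h2, abs_neg, abs_of_nonneg (M.nonneg _), ← M.energyNorm_sq] at h3
  have h4 : (c₁ * ‖B y‖) ^ 2 ≤ M.energyNorm (LPCfull ι M L00 μ u y) * (c₂ * ‖y‖) :=
    (pow_le_pow_left₀ (by positivity) (hlow _) 2).trans (h3.trans (by
      gcongr
      exact hup y))
  have h5 : ‖y‖ ^ 2 ≤ (2 * C * ‖B y‖) ^ 2 := by gcongr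
  rw [div_mul_eq_mul_div, div_le_iff₀ hc₂]
  refine le_of_mul_le_mul_right ?_ hny
  calc c₁ ^ 2 / (4 * C ^ 2) * ‖y‖ * ‖y‖ = c₁ ^ 2 / (4 * C ^ 2) * ‖y‖ ^ 2 := by ring
    _ ≤ c₁ ^ 2 / (4 * C ^ 2) * (2 * C * ‖B y‖) ^ 2 := by gcongr
    _ = (c₁ * ‖B y‖) ^ 2 := by field_simp; ring
    _ ≤ _ := by linarith

/-- Near `u`, the step contracts its increments, and a fixed point is determined by its component
in the kernel of `L₁`. -/
theorem exists_contracting_increments {F : V → V}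
    (hF : HasLipFDerivAt F
      (radialProj ι u ∘L (ContinuousLinearMap.id ℝ V + Δt • LPCfull ι M L00 μ u)) u)
    (hu : embed ι u ≠ 0) (hlam : IsLeast (spectrum ℝ (LPC ι M L00 μ u)) lam)
    (hΔ0 : 0 < Δt) (hΔ : 0 < 2 + Δt * lam)
    (hK : LinearMap.ker (L1 ι L00 μ u : V →ₗ[ℝ] StrongDual ℝ V) = K)
    (horth : ∀ x ∈ K, embed ι u x = 0) (hπ : ∀ x : K, π x = x)
    {C : ℝ} (hC : 0 < C) (hbelow : ∀ y, embed ι u y = 0 →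
      ‖y‖ ≤ C * (‖residualDeriv ι M L00 μ u y‖ + ‖π y‖)) :
    ∃ ρ, 0 ≤ ρ ∧ ρ < 1 ∧ ∃ r > 0, ∀ v q, ‖v - u‖ < r → ‖q - u‖ < r →
      power ι v = power ι q → F q = q → π (v - q) = 0 →
      (‖F v - u‖ < r → M.energyNorm (F (F v) - F v) ≤ ρ * M.energyNorm (F v - v)) ∧
      (F v = v → v = q) := by
  obtain ⟨κ, hκ0, hκ1, hκ⟩ :=
    exists_energyNorm_step_le ι M L00 hu hlam hΔ0 hΔ hK horth hπ hC hbelow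
  obtain ⟨c, hc, hcG⟩ := exists_le_energyNorm_LPCfull ι M L00 hu hC hbelow
  obtain ⟨c₂, hc₂, hup⟩ := M.exists_energyNorm_le
  set G := LPCfull ι M L00 μ u
  set T := radialProj ι u ∘L (ContinuousLinearMap.id ℝ V + Δt • G) with hT
  set A := c₂ / (c * Δt) with hA
  have hA0 : 0 < A := by positivity
  set A' := A * (2 * ‖T‖ + 2 + Δt * ‖G‖) with hA'
  have hA'0 : 0 < A' := by positivity
  set η := min (min 1 (1 / (2 * C * (‖π‖ + 1)))) ((1 - κ) / (4 * (A' + 2 * A))) with hη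
  have h1κ : 0 < 1 - κ := by linarith
  have hη0 : 0 < η := by positivity
  have hη1 : η ≤ 1 := (min_le_left _ _).trans (min_le_left _ _)
  have hη2 : 2 * C * (‖π‖ * η) ≤ 1 := by
    have : η ≤ 1 / (2 * C * (‖π‖ + 1)) := (min_le_left _ _).trans (min_le_right _ _)
    rw [le_div_iff₀ (by positivity)] at this
    have e : 0 ≤ η * (2 * C) := by positivity
    linarith
  have hη3 : η * (4 * (A' + 2 * A)) ≤ 1 - κ := by
    have : η ≤ (1 - κ) / (4 * (A' + 2 * A)) := min_le_right _ _
    rwa [le_div_iff₀ (by positivity)] at this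
  obtain ⟨r₁, hr₁, h₁⟩ := exists_step_sub_le ι M L00 hF hu hη0
  obtain ⟨r₂, hr₂, h₂⟩ := hF.exists_ball hη0
  refine ⟨(1 + κ) / 2, by linarith, by linarith, min r₁ r₂, by positivity,
    fun v q hv hq hp hFq hvq => ?_⟩
  obtain ⟨d1, d2⟩ := h₁ v q (hv.trans_le (min_le_left _ _)) (hq.trans_le (min_le_left _ _)) hp
  set n := v - q with hn
  set y := orthProj ι M u n with hy
  have hyS : embed ι u y = 0 := embed_orthProj ι M hu n
  change ‖F v - F q - (y + Δt • G y)‖ ≤ η * ‖y‖ at d2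
  rw [hFq] at d2
  have hπy : 2 * C * ‖π y‖ ≤ ‖y‖ := by
    have e1 : ‖π y‖ ≤ ‖π‖ * (η * ‖y‖) := by
      have : π y = -π (n - y) := by rw [map_sub, hvq, zero_sub, neg_neg]
      rw [this, norm_neg]
      exact (π.le_opNorm _).trans (by gcongr)
    calc 2 * C * ‖π y‖ ≤ 2 * C * (‖π‖ * (η * ‖y‖)) := by gcongr
      _ = 2 * C * (‖π‖ * η) * ‖y‖ := by ring
      _ ≤ 1 * ‖y‖ := by gcongr
      _ = _ := one_mul _
  set z := Δt • G y with hz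
  have hpz : M.energyNorm z = Δt * M.energyNorm (G y) := by
    rw [hz, map_smul_eq_mul, Real.norm_of_nonneg hΔ0.le]
  have hyz : c₂ * ‖y‖ ≤ A * M.energyNorm z := by
    rw [hpz]
    calc c₂ * ‖y‖ = A * (Δt * (c * ‖y‖)) := by rw [hA]; field_simp
      _ ≤ _ := by gcongr; exact hcG y hyS hπy
  -- Since `q` is a fixed point, the increment `F v - v` equals `z` up to an error small relative to
  -- `y`, hence relative to `z` itself.
  set e := F v - v - z with he
  have hen : ‖e‖ ≤ 2 * η * ‖y‖ := by
    calc ‖e‖ = ‖(F v - q - (y + z)) - (n - y)‖ := by rw [he, hn]; congr 1; abel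
      _ ≤ ‖F v - q - (y + z)‖ + ‖n - y‖ := norm_sub_le _ _
      _ ≤ η * ‖y‖ + η * ‖y‖ := add_le_add d2 d1
      _ = _ := by ring
  have hpe : M.energyNorm e ≤ 2 * A * η * M.energyNorm z := by
    calc M.energyNorm e ≤ c₂ * (2 * η * ‖y‖) := (hup e).trans (by gcongr)
      _ = 2 * η * (c₂ * ‖y‖) := by ring
      _ ≤ 2 * η * (A * M.energyNorm z) := by gcongr
      _ = _ := by ring
  have hpz0 : 0 ≤ M.energyNorm z := apply_nonneg _ _
  have hAη : 2 * A * η ≤ 1 / 2 := by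
    have : 0 ≤ η * A' := by positivity
    linarith
  refine ⟨fun hFv => ?_, fun hfix => ?_⟩
  · have hzS : embed ι u z = 0 := by
      rw [hz, map_smul, embed_LPCfull, smul_zero]
    -- `z` is in the range of `𝓛_PC = -B*B`, and `B` annihilates `K`.
    have hzK : ∀ k ∈ K, M.op z k = 0 := by
      intro k hk
      have hk' : residualDeriv ι M L00 μ u k = 0 :=
        residualDeriv_eq_zero ι M L00 μ u (by rw [← hK] at hk; exact hk)
      rw [hz, map_smul, _root_.smul_apply, op_LPCfull ι M L00 μ hu y (horth k hk), hk']
      simp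
    have hTz : T z = z + Δt • G z := stepDeriv_apply ι M L00 Δt μ hzS
    have hincr : ‖F v - v‖ ≤ (2 + Δt * ‖G‖) * ‖y‖ := by
      calc ‖F v - v‖ = ‖e + z‖ := by rw [he, sub_add_cancel]
        _ ≤ ‖e‖ + ‖z‖ := norm_add_le _ _
        _ ≤ 2 * η * ‖y‖ + Δt * (‖G‖ * ‖y‖) := by
          gcongr
          rw [hz, norm_smul, Real.norm_of_nonneg hΔ0.le]
          gcongr
          exact G.le_opNorm y
        _ ≤ 2 * 1 * ‖y‖ + Δt * (‖G‖ * ‖y‖) := by gcongr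
        _ = _ := by ring
    have hmain : ‖F (F v) - F v - (z + Δt • G z)‖ ≤ (2 * ‖T‖ + 2 + Δt * ‖G‖) * η * ‖y‖ := by
      have e1 := h₂ (F v) v (hFv.trans_le (min_le_right _ _)) (hv.trans_le (min_le_right _ _))
      calc ‖F (F v) - F v - (z + Δt • G z)‖
          = ‖(F (F v) - F v - T (F v - v)) + T e‖ := by
            rw [← hTz, he, map_sub T (F v - v) z]; congr 1; abel
        _ ≤ ‖F (F v) - F v - T (F v - v)‖ + ‖T e‖ := norm_add_le _ _
        _ ≤ η * ((2 + Δt * ‖G‖) * ‖y‖) + ‖T‖ * (2 * η * ‖y‖) := by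
          gcongr
          · exact e1.trans (by gcongr)
          · exact (T.le_opNorm _).trans (by gcongr)
        _ = _ := by ring
    have hleft : M.energyNorm (F (F v) - F v) ≤ (κ + A' * η) * M.energyNorm z := by
      calc M.energyNorm (F (F v) - F v)
          = M.energyNorm ((F (F v) - F v - (z + Δt • G z)) + (z + Δt • G z)) := by
            rw [sub_add_cancel]
        _ ≤ M.energyNorm (F (F v) - F v - (z + Δt • G z)) + M.energyNorm (z + Δt • G z) :=
            map_add_le_add _ _ _
        _ ≤ c₂ * ((2 * ‖T‖ + 2 + Δt * ‖G‖) * η * ‖y‖) + κ * M.energyNorm z := by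
            gcongr
            · exact (hup _).trans (by gcongr)
            · exact hκ z hzS hzK
        _ = (2 * ‖T‖ + 2 + Δt * ‖G‖) * η * (c₂ * ‖y‖) + κ * M.energyNorm z := by ring
        _ ≤ (2 * ‖T‖ + 2 + Δt * ‖G‖) * η * (A * M.energyNorm z) + κ * M.energyNorm z := by
            gcongr
        _ = _ := by rw [hA']; ring
    have hright : (1 - 2 * A * η) * M.energyNorm z ≤ M.energyNorm (F v - v) := by
      have e1 : M.energyNorm z ≤ M.energyNorm (F v - v) + M.energyNorm e := by
        have := map_sub_le_add M.energyNorm (F v - v) e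
        rwa [he, sub_sub_cancel] at this
      linarith
    calc M.energyNorm (F (F v) - F v) ≤ (κ + A' * η) * M.energyNorm z := hleft
      _ ≤ ((1 + κ) / 2 * (1 - 2 * A * η)) * M.energyNorm z := by
        gcongr
        have e1 : (1 + κ) / 2 * (2 * A * η) ≤ 1 * (2 * A * η) := by
          gcongr
          linarith
        have e2 : 0 ≤ A' * η := by positivity
        have e3 : 0 ≤ A * η := by positivity
        linarith
      _ = (1 + κ) / 2 * ((1 - 2 * A * η) * M.energyNorm z) := by ring
      _ ≤ _ := by gcongr
  · have h0 : e = -z := by rw [he, hfix, sub_self, zero_sub]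
    -- At a fixed point the increment is zero, so `z` would be cancelled by an error of at most half
    -- its size.
    have h1 : M.energyNorm z ≤ 1 / 2 * M.energyNorm z := by
      calc M.energyNorm z = M.energyNorm e := by rw [h0, map_neg_eq_map]
        _ ≤ 2 * A * η * M.energyNorm z := hpe
        _ ≤ _ := by gcongr
    have h2 : M.energyNorm z = 0 := by linarith
    have h3 : ‖y‖ = 0 := by
      rw [h2, mul_zero] at hyz
      have : 0 ≤ ‖y‖ := norm_nonneg y
      by_contra hne
      have := mul_pos hc₂ (lt_of_le_of_ne this (Ne.symm hne))
      linarith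
    rw [h3, mul_zero] at d1
    have h4 : n - y = 0 := norm_le_zero_iff.1 d1
    rw [norm_eq_zero.1 h3, sub_zero] at h4
    exact sub_eq_zero.1 h4

end Contracting

theorem convergesNear [CompleteSpace V] {s : ℕ} {U : ℝ → (Fin s → ℝ) → V} {μ : ℝ} {c₀ : Fin s → ℝ}
    (hU : IsSolutionFamily ι L00 U μ c₀)
    (hdiff : ∀ᶠ v in 𝓝 (U μ c₀), DifferentiableAt ℝ L00 v)
    (hL : HasLipFDerivAt L00 (fderiv ℝ L00 (U μ c₀)) (U μ c₀))
    (hX : LipschitzNear (fderiv ℝ L00) (U μ c₀))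
    (hker : LinearMap.ker (L1 ι L00 μ (U μ c₀) : V →ₗ[ℝ] StrongDual ℝ V) =
      Submodule.span ℝ (Set.range (invarianceMode U μ c₀)))
    (horth : ∀ Ψ : V, L1 ι L00 μ (U μ c₀) Ψ = 0 → embed ι (U μ c₀) Ψ = 0)
    (hP : power ι (U μ c₀) ≠ 0)
    (hP' : deriv (fun m => power ι (U m c₀)) μ ≠ 0)
    {lam : ℝ} (hlam : IsLeast (spectrum ℝ (LPC ι M L00 μ (U μ c₀))) lam)
    (hcl : IsClosed (Set.range (L1 ι L00 μ (U μ c₀)))) {Δt : ℝ} (hΔ0 : 0 < Δt)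
    (hΔ : 0 < 2 + Δt * lam) :
    ConvergesNear ι M L00 U μ c₀ (power ι (U μ c₀)) Δt := by
  set u := U μ c₀ with hu_def
  have hu := embed_ne_zero_of_power ι hP
  have h0 : L0 ι L00 μ u = 0 := hU.2.self_of_nhds
  have hdu : DifferentiableAt ℝ L00 u := hdiff.self_of_nhds
  set F := step ι M L00 (power ι u) Δt with hF_def
  have hF : HasLipFDerivAt F
      (radialProj ι u ∘L (ContinuousLinearMap.id ℝ V + Δt • LPCfull ι M L00 μ u)) u :=
    step_hasLipFDerivAt ι M L00 Δt hP h0 hL hX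
  set K := Submodule.span ℝ (Set.range (invarianceMode U μ c₀)) with hK
  have : FiniteDimensional ℝ K := FiniteDimensional.span_of_finite ℝ (Set.finite_range _)
  have horthK : ∀ x ∈ K, embed ι u x = 0 := fun x hx => horth x (by rw [← hker] at hx; exact hx)
  obtain ⟨π, hπ⟩ := Submodule.ClosedComplemented.of_finiteDimensional (𝕜 := ℝ) K
  obtain ⟨D, -, -, hDw, hDP⟩ := hU.exists_deriv ι L00 hdu
  have huw : embed ι u (D (1, 0)) ≠ 0 := by
    intro h
    rw [hDP, h, mul_zero] at hP'
    exact hP' rfl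
  obtain ⟨C, hC, hbelow⟩ := exists_norm_le_residualDeriv ι M L00 hDw huw hcl K hker horthK π hπ
  obtain ⟨ρ, hρ0, hρ1, r, hr, hcontr⟩ := exists_contracting_increments ι M L00 hF hu hlam hΔ0 hΔ
    hker horthK hπ hC hbelow
  obtain ⟨c₁, hc₁, hlow⟩ := M.exists_le_energyNorm
  obtain ⟨c₂, hc₂, hup⟩ := M.exists_energyNorm_le
  obtain ⟨k, W, hW, hLip⟩ := hF.hasStrictFDerivAt.exists_lipschitzOnWith
  intro ε hε
  have hfam := hU.exists_nearby ι L00 hdu K hK horthK hP' π hπ (lt_min hε hr)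
  have hpow := eventually_power_step ι M L00 (Δt := Δt) hP h0 hL hX
  obtain ⟨r', hr', hball⟩ := Metric.eventually_nhds_iff_ball.1
    (((hfam.and hpow).and hdiff).and (hW : ∀ᶠ v in 𝓝 u, v ∈ W))
  have hball' : ∀ v, ‖v - u‖ < min r r' → _ := fun v hv => hball v
    (by simpa [dist_eq_norm] using hv.trans_le (min_le_right _ _))
  have hfix : ∀ q μ', power ι q = power ι u → L0 ι L00 μ' q = 0 → F q = q := fun q μ' h1 h2 =>
    step_eq_self ι M L00 (power ι u) Δt hP h1 h2
  have hFu : F u = u := hfix u μ rfl h0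
  obtain ⟨δ, hδ, hconv⟩ := exists_tendsto_iterate_of_contracting_increments (p := M.energyNorm)
    (F := F) (u := u) (good := fun v => power ι v = power ι u) (r := min r r') (ρ := ρ) (K := k)
    (ε := min ε (min r r')) hc₁ hlow hc₂ hup hFu (lt_min hr hr') hρ0 hρ1
    (fun v w hv hw => hLip.norm_sub_le (hball' v hv).2 (hball' w hw).2)
    (fun v hv => (hball' v hv).1.1.2)
    (fun v hv hFv hg => by
      -- The reference solution depends on `v` and may change at every step; the contraction
      -- estimate for increments does not mention it.
      obtain ⟨μ', c', -, -, h3, h4, h5, h6⟩ := (hball' v hv).1.1.1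
      exact (hcontr v (U μ' c') (hv.trans_le (min_le_left _ _)) (h5.trans_le (min_le_right _ _))
        (hg.trans h4.symm) (hfix _ μ' h4 h3) h6).1 (hFv.trans_le (min_le_left _ _)))
    (lt_min hε (lt_min hr hr'))
  refine ⟨δ, hδ, fun v hv => ?_⟩
  obtain ⟨hn, q, hq, hqu, hFq⟩ := hconv v hv
  have hqr := hqu.trans_le (min_le_right _ _)
  obtain ⟨⟨⟨⟨μ', c', h1, h2, h3, h4, h5, h6⟩, h7⟩, h8⟩, -⟩ := hball' q hqr
  -- The limit is its own image under the step, so it has the prescribed power and can be compared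
  -- with its reference solution.
  have hqP : power ι q = power ι u := by
    change power ι (F q) = power ι u at h7
    rwa [hFq] at h7
  have hqU : q = U μ' c' := (hcontr q (U μ' c') (hqr.trans_le (min_le_left _ _))
    (h5.trans_le (min_le_right _ _)) (hqP.trans h4.symm) (hfix _ μ' h4 h3) h6).2 hFq
  refine ⟨fun n => (hn n).trans_le (min_le_left _ _), μ', c', h1.trans_le (min_le_left _ _),
    h2.trans_le (min_le_left _ _), h3, h4, hqU ▸ hq, ?_⟩
  have hqe : embed ι q ≠ 0 := embed_ne_zero_of_power ι (by rwa [hqP])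
  have hray : rayleigh ι M L00 q = μ' := rayleigh_eq ι M L00 hqe (by rw [hqU]; exact h3)
  have hcont : ContinuousAt (rayleigh ι M L00) q := by
    have e1 : ContinuousAt L00 q := h8.continuousAt
    have e2 : ContinuousAt (fun v => embed ι v (Minv M (L00 v))) q :=
      (embed ι).continuous.continuousAt.clm_apply ((Minv M).continuous.continuousAt.comp e1)
    have e3 : Continuous fun v => embed ι v (Minv M (embed ι v)) := by fun_prop
    exact e2.div e3.continuousAt (denom_ne_zero ι M q hqe)
  rw [← hray]
  exact hcont.tendsto.comp hq

end PCSOM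

/-! ### Growth along an approximate eigenvector -/

section Escape

variable {V : Type*} [NormedAddCommGroup V] [NormedSpace ℝ V]

/-- A sequence that follows an operator of norm `r > 1` up to quadratic errors, and starts at an
approximate eigenvector for `-r`, grows like `r ^ n` up to a fixed size. -/
theorem Seminorm.half_mul_pow_le_of_quadratic_recursion {p : Seminorm ℝ V} {T : V →L[ℝ] V}
    {S : Submodule ℝ V} {r C : ℝ} (hr : 1 < r) (hC : 0 < C) (hT : ∀ x ∈ S, p (T x) ≤ r * p x)
    {δ : ℝ} (hδ : 0 < δ) {N : ℕ} (hN : (C + 4 * C / (r - 1)) * δ * r ^ N ≤ 1 / 4)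
    {x : V} (hxS : x ∈ S) (hx : p x = 1) (hxT : p (T x + r • x) ≤ 1 / (4 * (N + 1)))
    {z : ℕ → V} (hzS : ∀ k, z k ∈ S) (hz0 : p (z 0 - δ • x) ≤ C * δ ^ 2)
    (hz : ∀ k, p (z (k + 1) - T (z k)) ≤ C * p (z k) ^ 2) :
    δ * r ^ N / 2 ≤ p (z N) := by
  -- `C ≤ C₁` covers the initial error, and `4 * C ≤ C₁ * (r - 1)` absorbs the new quadratic error
  -- of each step.
  set C₁ := C + 4 * C / (r - 1) with hC₁
  have hr1 : 0 < r - 1 := by linarith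
  have hr0 : 0 < r := by linarith
  have hC₁0 : 0 < C₁ := by positivity
  have hCC₁ : C ≤ C₁ := by
    have : 0 ≤ 4 * C / (r - 1) := by positivity
    linarith
  have hC₁r : 4 * C ≤ C₁ * (r - 1) := by
    have : 4 * C / (r - 1) * (r - 1) = 4 * C := div_mul_cancel₀ _ hr1.ne'
    have h2 : 0 ≤ C * (r - 1) := by positivity
    rw [hC₁, add_mul]; linarith
  set η : ℝ := 1 / (4 * (N + 1)) with hη
  have hη0 : 0 < η := by positivity
  set y : ℕ → V := fun k => ((-r) ^ k * δ) • x with hy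
  have hpy : ∀ k, p (y k) = δ * r ^ k := by
    intro k
    rw [hy]
    simp only [map_smul_eq_mul, hx, norm_mul, norm_pow, norm_neg, Real.norm_of_nonneg hr0.le,
      Real.norm_of_nonneg hδ.le]
    ring
  have hsize : ∀ k ≤ N, C₁ * δ * r ^ k + k * η ≤ 1 / 2 := by
    intro k hk
    have h1 : C₁ * δ * r ^ k ≤ C₁ * δ * r ^ N := by gcongr; exact hr.le
    have h2 : k * η ≤ 1 / 4 := by
      have : (k : ℝ) ≤ N + 1 := by
        have : (k : ℝ) ≤ N := by exact_mod_cast hk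
        linarith
      calc k * η ≤ (N + 1) * η := by gcongr
        _ = 1 / 4 := by rw [hη]; field_simp
    linarith
  -- Relative to the size `δ * r ^ k` of the ideal orbit `y`, the nonlinear error is proportional to
  -- that size, and the eigenvector defect adds at most `η` per step.
  have key : ∀ k ≤ N, p (z k - y k) ≤ (C₁ * δ * r ^ k + k * η) * (δ * r ^ k) := by
    intro k
    induction k with
    | zero =>
      intro _
      simp only [hy, pow_zero, one_mul, Nat.cast_zero, zero_mul, add_zero, mul_one]
      refine hz0.trans ?_
      rw [sq, ← mul_assoc]
      gcongr
    | succ k ih =>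
      intro hk
      have hk' : k ≤ N := by omega
      have ih := ih hk'
      have hb := hsize k hk'
      have hpos : 0 < δ * r ^ k := by positivity
      have hzk : p (z k) ≤ 2 * (δ * r ^ k) := by
        have e1 : p (z k) ≤ p (z k - y k) + p (y k) := by
          have := map_add_le_add p (z k - y k) (y k)
          rwa [sub_add_cancel] at this
        have e2 : (C₁ * δ * r ^ k + k * η) * (δ * r ^ k) ≤ 1 / 2 * (δ * r ^ k) := by gcongr
        rw [hpy] at e1
        linarith
      have hdec : z (k + 1) - y (k + 1) = (z (k + 1) - T (z k)) + T (z k - y k)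
          + ((-r) ^ k * δ) • (T x + r • x) := by
        simp only [hy, map_sub, map_smul, pow_succ]
        module
      have hSk : z k - y k ∈ S := S.sub_mem (hzS k) (S.smul_mem _ hxS)
      have e3 : p (((-r) ^ k * δ) • (T x + r • x)) ≤ δ * r ^ k * η := by
        rw [map_smul_eq_mul, norm_mul, norm_pow, norm_neg, Real.norm_of_nonneg hr0.le,
          Real.norm_of_nonneg hδ.le, mul_comm (r ^ k)]
        gcongr
      calc p (z (k + 1) - y (k + 1))
          ≤ p (z (k + 1) - T (z k)) + p (T (z k - y k)) + p (((-r) ^ k * δ) • (T x + r • x)) := by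
            rw [hdec]
            exact (map_add_le_add p _ _).trans (add_le_add_left (map_add_le_add p _ _) _)
        _ ≤ C * (2 * (δ * r ^ k)) ^ 2 + r * ((C₁ * δ * r ^ k + k * η) * (δ * r ^ k))
            + δ * r ^ k * η := by
            gcongr
            · exact (hz k).trans (by gcongr)
            · exact (hT _ hSk).trans (by gcongr)
        _ = (4 * C * (δ * r ^ k) + r * (C₁ * δ * r ^ k + k * η) + η) * (δ * r ^ k) := by ring
        _ ≤ ((C₁ * δ * r ^ (k + 1) + (k + 1 : ℕ) * η) * r) * (δ * r ^ k) := by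
            gcongr
            have e4 : 4 * C * (δ * r ^ k) ≤ C₁ * (r - 1) * r * (δ * r ^ k) :=
              mul_le_mul_of_nonneg_right (hC₁r.trans
                (le_mul_of_one_le_right (by positivity) hr.le)) hpos.le
            have e5 : η ≤ η * r := le_mul_of_one_le_right hη0.le hr.le
            push_cast
            rw [pow_succ]
            linarith
        _ = _ := by rw [pow_succ]; ring
  have h1 := key N le_rfl
  have h2 := hsize N le_rfl
  have h3 : (C₁ * δ * r ^ N + N * η) * (δ * r ^ N) ≤ 1 / 2 * (δ * r ^ N) := by gcongr
  have h4 : p (y N) ≤ p (z N) + p (z N - y N) := by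
    have := map_sub_le_add p (z N) (z N - y N)
    rwa [sub_sub_cancel] at this
  rw [hpy] at h4
  linarith

theorem ContinuousLinearMap.abs_apply_self_sub_le (b : V →L[ℝ] StrongDual ℝ V) (x y : V) :
    |b x x - b y y| ≤ ‖b‖ * ‖x - y‖ * (‖x‖ + ‖y‖) := by
  have h : b x x - b y y = b (x - y) x + b y (x - y) := by
    simp only [map_sub, _root_.sub_apply]; ring
  calc |b x x - b y y| ≤ |b (x - y) x| + |b y (x - y)| := by rw [h]; exact abs_add_le _ _
    _ ≤ ‖b‖ * ‖x - y‖ * ‖x‖ + ‖b‖ * ‖y‖ * ‖x - y‖ :=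
      add_le_add (b.le_opNorm₂ _ _) (b.le_opNorm₂ _ _)
    _ = _ := by ring

end Escape

/-! ### Divergence above the threshold -/

namespace PCSOM

variable {V H : Type*} [NormedAddCommGroup V] [NormedSpace ℝ V]
  [NormedAddCommGroup H] [InnerProductSpace ℝ H]
  (ι : V →L[ℝ] H) (M : AccelerationOperator V) (L00 : V → StrongDual ℝ V)

theorem power_add_smul {u x : V} (hx : embed ι u x = 0) (t : ℝ) :
    power ι (u + t • x) = power ι u + t ^ 2 * power ι x := by
  have h1 : embed ι x u = 0 := (ip_comm ι x u).trans hx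
  simp only [power, ← embed_apply]
  simp [hx, h1]
  ring

theorem radialProj_of_embed_eq_zero {u x : V} (hx : embed ι u x = 0) :
    radialProj ι u x = x := by
  rw [radialProj_apply, ← embed_apply, hx]; simp

theorem orthProj_of_embed_eq_zero {u x : V} (hx : embed ι u x = 0) :
    orthProj ι M u x = x := by
  rw [orthProj_apply, hx]; simp

variable {μ Δt lam : ℝ} {u : V}

/-- Here the coefficient in `op_one_add_LPCfull_le` has the opposite sign, so `‖Bx‖²` is replaced by
its upper bound `-lam ‖x‖²`; the result is the square `(1 + Δt * lam) ^ 2`. -/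
theorem energyNorm_step_le_of_neg (hu : embed ι u ≠ 0)
    (hlam : IsLeast (spectrum ℝ (LPC ι M L00 μ u)) lam) (hΔ0 : 0 < Δt) (hΔ : 2 + Δt * lam < 0)
    {x : V} (hx : embed ι u x = 0) :
    M.energyNorm (x + Δt • LPCfull ι M L00 μ u x) ≤ -(1 + Δt * lam) * M.energyNorm x := by
  have h1 := op_one_add_LPCfull_le ι M L00 μ hu hlam hx Δt
  have h2 := op_LPCfull ι M L00 μ hu x hx
  have h3 := le_op_LPCfull ι M L00 μ hu hlam hx
  set b := M.op (residualDeriv ι M L00 μ u x) (residualDeriv ι M L00 μ u x)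
  have h4 : -Δt * (2 + Δt * lam) * b ≤ -Δt * (2 + Δt * lam) * (-lam * M.op x x) := by
    have : 0 ≤ -Δt * (2 + Δt * lam) := by
      rw [neg_mul, ← mul_neg]; exact mul_nonneg hΔ0.le (by linarith)
    gcongr
    linarith
  refine le_of_sq_le_sq ?_ (mul_nonneg (by linarith) (apply_nonneg _ _))
  rw [mul_pow, M.energyNorm_sq, M.energyNorm_sq]
  linarith

/-- The component in `S` of the deviation from `u` follows `1 + Δt 𝓛_PC` up to a quadratic
error. -/
theorem exists_orthProj_step_sub_le {F : V → V} (hFu : F u = u)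
    (hF : HasLipFDerivAt F
      (radialProj ι u ∘L (ContinuousLinearMap.id ℝ V + Δt • LPCfull ι M L00 μ u)) u)
    (hu : embed ι u ≠ 0) :
    ∃ C > 0, ∃ r > 0, ∀ v, ‖v - u‖ < r → power ι v = power ι u →
      ‖orthProj ι M u (F v - u) - (orthProj ι M u (v - u)
        + Δt • LPCfull ι M L00 μ u (orthProj ι M u (v - u)))‖ ≤
      C * ‖orthProj ι M u (v - u)‖ ^ 2 := by
  set T := radialProj ι u ∘L (ContinuousLinearMap.id ℝ V + Δt • LPCfull ι M L00 μ u) with hT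
  set Q := orthProj ι M u
  obtain ⟨CF, hCF, rF, hrF, hquadF⟩ := hF.exists_quadratic
  obtain ⟨CQ, hCQ, hQ⟩ := exists_norm_sub_orthProj_le ι M u
  refine ⟨(‖Q‖ + 1) * (‖T‖ * CQ + CF) * 4, by positivity, min rF (1 / (2 * CQ)),
    by positivity, fun v hv hvP => ?_⟩
  have hvQ : ‖(v - u) - Q (v - u)‖ ≤ CQ * ‖v - u‖ ^ 2 := by
    have := hQ v u hvP
    rwa [sub_self, norm_zero, add_zero, mul_assoc, ← sq] at this
  have hv2 : ‖v - u‖ ≤ 2 * ‖Q (v - u)‖ := by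
    have e1 : CQ * ‖v - u‖ ^ 2 ≤ 1 / 2 * ‖v - u‖ := by
      rw [sq, ← mul_assoc]
      gcongr
      have := hv.trans_le (min_le_right _ _)
      rw [lt_div_iff₀ (by positivity)] at this
      linarith
    have e2 : ‖v - u‖ ≤ ‖(v - u) - Q (v - u)‖ + ‖Q (v - u)‖ := by
      have := norm_add_le ((v - u) - Q (v - u)) (Q (v - u))
      rwa [sub_add_cancel] at this
    linarith
  have hQS : embed ι u (Q (v - u)) = 0 := embed_orthProj ι M hu _
  rw [← stepDeriv_apply ι M L00 Δt μ hQS, ← hT]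
  have e1 : ‖F v - u - T (v - u)‖ ≤ CF * ‖v - u‖ ^ 2 := by
    have := hquadF (v - u) (hv.trans_le (min_le_left _ _))
    rwa [add_sub_cancel, hFu] at this
  -- The linear part preserves `S`, where `Q` is the identity; thus only quadratic terms remain.
  have e2 : Q (T (Q (v - u))) = T (Q (v - u)) := by
    refine orthProj_of_embed_eq_zero ι M ?_
    rw [hT, stepDeriv_apply ι M L00 Δt μ hQS, map_add, hQS, map_smul, embed_LPCfull]
    simp
  have e3 : Q (F v - u) - T (Q (v - u)) =
      Q ((F v - u - T (v - u)) + T ((v - u) - Q (v - u))) := by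
    rw [← e2, ← map_sub Q, map_sub T (v - u) (Q (v - u)), sub_add_sub_cancel]
  rw [e3]
  calc _ ≤ ‖Q‖ * ‖(F v - u - T (v - u)) + T ((v - u) - Q (v - u))‖ := Q.le_opNorm _
    _ ≤ (‖Q‖ + 1) * (CF * ‖v - u‖ ^ 2 + ‖T‖ * (CQ * ‖v - u‖ ^ 2)) := by
      gcongr
      · linarith
      · refine (norm_add_le _ _).trans (add_le_add e1 ((T.le_opNorm _).trans ?_))
        gcongr
    _ = (‖Q‖ + 1) * (‖T‖ * CQ + CF) * ‖v - u‖ ^ 2 := by ring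
    _ ≤ (‖Q‖ + 1) * (‖T‖ * CQ + CF) * (2 * ‖Q (v - u)‖) ^ 2 := by gcongr
    _ = _ := by ring

/-- There are approximate eigenvectors of `1 + Δt 𝓛_PC` for its least spectral value. -/
theorem exists_energyNorm_eq_one [CompleteSpace V] (hu : embed ι u ≠ 0)
    (hlam : lam ∈ spectrum ℝ (LPC ι M L00 μ u)) (hΔ0 : 0 < Δt) {η : ℝ} (hη : 0 < η) :
    ∃ x, embed ι u x = 0 ∧ M.energyNorm x = 1 ∧
      M.energyNorm (x + Δt • LPCfull ι M L00 μ u x + (-(1 + Δt * lam)) • x) ≤ η := by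
  obtain ⟨c₁, hc₁, hlow⟩ := M.exists_le_energyNorm
  obtain ⟨c₂, hc₂, hup⟩ := M.exists_energyNorm_le
  obtain ⟨x, hx0, hxS, hx⟩ := exists_approx_eigenvector_LPCfull ι M L00 μ hu hlam
    (η := c₁ / (c₂ * Δt) * η) (by positivity)
  set G := LPCfull ι M L00 μ u
  have hpx : 0 < M.energyNorm x := (mul_pos hc₁ (norm_pos_iff.2 hx0)).trans_le (hlow x)
  have hTx : x + Δt • G x + (-(1 + Δt * lam)) • x = Δt • (G x - lam • x) := by module
  have h1 : M.energyNorm (x + Δt • G x + (-(1 + Δt * lam)) • x) ≤ η * M.energyNorm x := by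
    rw [hTx, map_smul_eq_mul, Real.norm_of_nonneg hΔ0.le]
    calc Δt * M.energyNorm (G x - lam • x) ≤ Δt * (c₂ * ‖G x - lam • x‖) := by
          gcongr; exact hup _
      _ ≤ Δt * (c₂ * (c₁ / (c₂ * Δt) * η * ‖x‖)) := by gcongr
      _ = η * (c₁ * ‖x‖) := by field_simp
      _ ≤ _ := by gcongr; exact hlow x
  refine ⟨(M.energyNorm x)⁻¹ • x, by rw [map_smul, hxS, smul_zero], ?_, ?_⟩
  · rw [map_smul_eq_mul, norm_inv, Real.norm_of_nonneg hpx.le, inv_mul_cancel₀ hpx.ne']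
  · have h2 : (M.energyNorm x)⁻¹ • x + Δt • G ((M.energyNorm x)⁻¹ • x)
        + (-(1 + Δt * lam)) • (M.energyNorm x)⁻¹ • x =
        (M.energyNorm x)⁻¹ • (x + Δt • G x + (-(1 + Δt * lam)) • x) := by
      rw [map_smul]; module
    rw [h2, map_smul_eq_mul, norm_inv, Real.norm_of_nonneg hpx.le, inv_mul_le_iff₀ hpx, mul_comm (M.energyNorm x)]
    exact h1

/-- Elements of the power of `u` that deviate from `u` in a direction of `S`. -/
theorem exists_normalize_quadratic (hP : power ι u ≠ 0) :
    ∃ C > 0, ∃ r > 0, ∀ x, embed ι u x = 0 → ‖x‖ < r →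
      power ι (normalize ι (power ι u) (u + x)) = power ι u ∧
      ‖normalize ι (power ι u) (u + x) - u - x‖ ≤ C * ‖x‖ ^ 2 := by
  obtain ⟨C, hC, r, hr, hquad⟩ := (normalize_hasLipFDerivAt ι hP).exists_quadratic
  refine ⟨C, hC, r, hr, fun x hxS hx => ⟨?_, ?_⟩⟩
  · refine power_normalize ι (power_nonneg ι u) ?_
    have h1 := power_add_smul ι hxS 1
    rw [one_smul, one_pow, one_mul] at h1
    have h2 := power_nonneg ι x
    have h3 := lt_of_le_of_ne (power_nonneg ι u) (Ne.symm hP)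
    rw [h1]
    linarith
  · have h1 := hquad x hx
    rwa [normalize_of_power_eq ι hP rfl, radialProj_of_embed_eq_zero ι hxS] at h1

/-- `lam` need not be an eigenvalue. The size `δ` fixes the number `N` of steps, and only then is an
approximate eigenvector chosen, accurate enough for those `N` steps. -/
theorem divergesFrom [CompleteSpace V] (hP : power ι u ≠ 0) (h0 : L0 ι L00 μ u = 0)
    (hL : HasLipFDerivAt L00 (fderiv ℝ L00 u) u) (hX : LipschitzNear (fderiv ℝ L00) u)
    (hlam : IsLeast (spectrum ℝ (LPC ι M L00 μ u)) lam) (hΔ0 : 0 < Δt)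
    (hΔ : 2 + Δt * lam < 0) : DivergesFrom ι M L00 u (power ι u) Δt := by
  have hu := embed_ne_zero_of_power ι hP
  obtain ⟨c₁, hc₁, hlow⟩ := M.exists_le_energyNorm
  obtain ⟨c₂, hc₂, hup⟩ := M.exists_energyNorm_le
  set F := step ι M L00 (power ι u) Δt with hF_def
  have hFu : F u = u := step_eq_self ι M L00 (power ι u) Δt hP rfl h0
  set Q := orthProj ι M u
  obtain ⟨CT, hCT, rF, hrF, hrec⟩ := exists_orthProj_step_sub_le ι M L00 hFu
    (step_hasLipFDerivAt ι M L00 Δt hP h0 hL hX) hu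
  obtain ⟨CN, hCN, rN, hrN, hquadN⟩ := exists_normalize_quadratic ι hP
  obtain ⟨rP, hrP, hpowb⟩ := Metric.eventually_nhds_iff_ball.1
    (eventually_power_step ι M L00 (Δt := Δt) hP h0 hL hX)
  set G := LPCfull ι M L00 μ u
  set r := -(1 + Δt * lam) with hr
  have hr1 : 1 < r := by linarith
  have hr0 : 0 < r := by linarith
  have hr2 : 0 < r - 1 := by linarith
  set C := c₂ * CT / c₁ ^ 2 + c₂ * ((‖Q‖ + 1) * CN) / c₁ ^ 2 with hC
  have hC0 : 0 < C := by positivity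
  set C₁ := C + 4 * C / (r - 1) with hC₁
  have hC₁0 : 0 < C₁ := by positivity
  -- By the maximality of `N` below, `δ * r ^ N / 2` exceeds `1 / (8 * C₁ * r)`; the factor `c₂ *
  -- (‖Q‖ + 1)` converts this energy norm of the `S`-component to the norm of the deviation.
  set ε := min (min rF rP) (1 / (8 * C₁ * r * (c₂ * (‖Q‖ + 1)))) with hε
  have hε0 : 0 < ε := by positivity
  refine ⟨ε, hε0, fun δ' hδ' => ?_⟩
  set δ := min (min 1 (1 / (4 * C₁))) (min (c₁ * rN / 2)
    (δ' / (2 * (1 / c₁ + CN / c₁ ^ 2)))) with hδ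
  have hδ0 : 0 < δ := by positivity
  have hδ1 : δ ≤ 1 := (min_le_left _ _).trans (min_le_left _ _)
  have hδC : 1 ≤ 1 / (4 * C₁ * δ) := by
    have : δ ≤ 1 / (4 * C₁) := (min_le_left _ _).trans (min_le_right _ _)
    rw [le_div_iff₀ (by positivity)] at this ⊢
    linarith
  have hδN : δ / c₁ < rN := by
    have : δ ≤ c₁ * rN / 2 := (min_le_right _ _).trans (min_le_left _ _)
    rw [div_lt_iff₀ hc₁]
    have : 0 < c₁ * rN := by positivity
    linarith
  have hδδ : δ * (1 / c₁ + CN / c₁ ^ 2) < δ' := by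
    have : δ ≤ δ' / (2 * (1 / c₁ + CN / c₁ ^ 2)) := (min_le_right _ _).trans (min_le_right _ _)
    rw [le_div_iff₀ (by positivity)] at this
    linarith
  obtain ⟨N, hN1, hN2⟩ := exists_nat_pow_near hδC hr1
  rw [le_div_iff₀ (by positivity)] at hN1
  rw [div_lt_iff₀ (by positivity)] at hN2
  clear_value δ
  obtain ⟨x, hxS, hx1, hxT⟩ := exists_energyNorm_eq_one ι M L00 hu hlam.1 hΔ0
    (η := 1 / (4 * (N + 1))) (by positivity)
  have hxn : ‖x‖ ≤ 1 / c₁ := by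
    rw [le_div_iff₀ hc₁, mul_comm, ← hx1]; exact hlow x
  have hδx : ‖δ • x‖ ≤ δ / c₁ := by
    rw [norm_smul, Real.norm_of_nonneg hδ0.le, div_eq_mul_one_div]
    gcongr
  obtain ⟨hv₀P, hv₀n⟩ := hquadN (δ • x) (by rw [map_smul, hxS, smul_zero]) (hδx.trans_lt hδN)
  set v₀ := normalize ι (power ι u) (u + δ • x)
  replace hv₀n : ‖v₀ - u - δ • x‖ ≤ CN * (δ / c₁) ^ 2 := hv₀n.trans (by gcongr)
  have hv₀u : ‖v₀ - u‖ < δ' := by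
    calc ‖v₀ - u‖ = ‖(v₀ - u - δ • x) + δ • x‖ := by rw [sub_add_cancel]
      _ ≤ CN * (δ / c₁) ^ 2 + δ / c₁ := (norm_add_le _ _).trans (add_le_add hv₀n hδx)
      _ = δ * (δ * (CN / c₁ ^ 2)) + δ * (1 / c₁) := by ring
      _ ≤ δ * (1 * (CN / c₁ ^ 2)) + δ * (1 / c₁) := by gcongr
      _ = δ * (1 / c₁ + CN / c₁ ^ 2) := by ring
      _ < δ' := hδδ
  refine ⟨v₀, hv₀u, hv₀P, ?_⟩
  clear_value v₀
  by_contra! hstay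
  set v : ℕ → V := fun n => iterates ι M L00 (power ι u) Δt v₀ n with hv
  have hv0 : v 0 = v₀ := rfl
  have hvs : ∀ n, v (n + 1) = F (v n) := fun n => Function.iterate_succ_apply' _ n v₀
  have hvε : ∀ n, ‖v n - u‖ < ε := hstay
  have hvP : ∀ n, power ι (v n) = power ι u := by
    intro n
    cases n with
    | zero => exact hv₀P
    | succ n =>
      rw [hvs]
      refine hpowb (v n) ?_
      rw [mem_ball_iff_norm]
      exact (hvε n).trans_le ((min_le_left _ _).trans (min_le_right _ _))
  clear_value v
  have hQn : ∀ y, ‖Q y‖ ≤ (‖Q‖ + 1) * ‖y‖ := fun y => (Q.le_opNorm y).trans (by gcongr; linarith)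
  have hstart : M.energyNorm (Q (v 0 - u) - δ • x) ≤ C * δ ^ 2 := by
    have e1 : Q (v 0 - u) - δ • x = Q (v₀ - u - δ • x) := by
      rw [map_sub Q (v₀ - u), map_smul, orthProj_of_embed_eq_zero ι M hxS, hv0]
    rw [e1]
    calc _ ≤ c₂ * ‖Q (v₀ - u - δ • x)‖ := hup _
      _ ≤ c₂ * ((‖Q‖ + 1) * (CN * (δ / c₁) ^ 2)) := by
        gcongr
        exact (hQn _).trans (by gcongr)
      _ = c₂ * ((‖Q‖ + 1) * CN) / c₁ ^ 2 * δ ^ 2 := by ring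
      _ ≤ C * δ ^ 2 := by
        gcongr
        rw [hC]
        have : 0 ≤ c₂ * CT / c₁ ^ 2 := by positivity
        linarith
  have hnext : ∀ n, M.energyNorm (Q (v (n + 1) - u) -
      (ContinuousLinearMap.id ℝ V + Δt • G) (Q (v n - u))) ≤
        C * M.energyNorm (Q (v n - u)) ^ 2 := by
    intro n
    rw [hvs]
    have e1 := hrec (v n) ((hvε n).trans_le ((min_le_left _ _).trans (min_le_left _ _))) (hvP n)
    calc _ ≤ c₂ * ‖Q (F (v n) - u) - (Q (v n - u) + Δt • G (Q (v n - u)))‖ := hup _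
      _ ≤ c₂ * (CT * ‖Q (v n - u)‖ ^ 2) := by gcongr
      _ = c₂ * CT / c₁ ^ 2 * (c₁ * ‖Q (v n - u)‖) ^ 2 := by field_simp
      _ ≤ C * M.energyNorm (Q (v n - u)) ^ 2 := by
        gcongr
        · rw [hC]
          have : 0 ≤ c₂ * ((‖Q‖ + 1) * CN) / c₁ ^ 2 := by positivity
          linarith
        · exact hlow _
  have hgrow := Seminorm.half_mul_pow_le_of_quadratic_recursion (p := M.energyNorm)
    (T := ContinuousLinearMap.id ℝ V + Δt • G)
    (S := orthSpace ι u) (N := N) (x := x) (δ := δ) hr1 hC0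
    (fun y hy => energyNorm_step_le_of_neg ι M L00 hu hlam hΔ0 hΔ hy)
    hδ0 (by linarith) hxS hx1 hxT
    (z := fun n => Q (v n - u)) (fun n => embed_orthProj ι M hu _) hstart hnext
  have h1 : M.energyNorm (Q (v N - u)) * (8 * C₁ * r) < 1 := by
    have e1 := (hvε N).trans_le (min_le_right _ _)
    rw [lt_div_iff₀ (by positivity)] at e1
    calc M.energyNorm (Q (v N - u)) * (8 * C₁ * r)
        ≤ c₂ * ((‖Q‖ + 1) * ‖v N - u‖) * (8 * C₁ * r) := by
          gcongr
          refine (hup _).trans ?_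
          gcongr
          exact hQn _
      _ = ‖v N - u‖ * (8 * C₁ * r * (c₂ * (‖Q‖ + 1))) := by ring
      _ < 1 := e1
  have h2 : δ * r ^ N / 2 * (8 * C₁ * r) ≤ M.energyNorm (Q (v N - u)) * (8 * C₁ * r) := by
    gcongr
  have h3 : δ * r ^ N / 2 * (8 * C₁ * r) = r ^ (N + 1) * (4 * C₁ * δ) := by ring
  linarith

/-! ### Generic divergence -/

/-- The form `⟨(ν - 𝓛_PC) x, y⟩` with respect to `M`. -/
def gapForm (μ : ℝ) (u : V) (ν : ℝ) : V →L[ℝ] StrongDual ℝ V :=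
  (M.op : V →L[ℝ] StrongDual ℝ V) ∘L (ν • ContinuousLinearMap.id ℝ V - LPCfull ι M L00 μ u)

theorem gapForm_apply (ν : ℝ) (x y : V) : gapForm ι M L00 μ u ν x y =
    ν * M.op x y - M.op (LPCfull ι M L00 μ u x) y := by
  simp [gapForm]

/-- At a spectral value `λ ≤ 0` this is `((1 + Δt λ)² - (1 + Δt ν)²)(ν - λ) = -Δt (ν - λ)² (2 + Δt ν
+ Δt λ)`, which is at least `-Δt (2 + Δt ν)(ν - λ)²`. The gap at `ν` makes the surplus uniform; the
proof is the same identity with `g = (𝓛_PC - ν) x`. -/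
theorem gapForm_step_ge (hu : embed ι u ≠ 0) (hΔ0 : 0 < Δt) {ν c : ℝ} (hc : 0 < c)
    (hco : ∀ x, c * ‖x‖ ^ 2 ≤ M.op x x) {d : ℝ} (hd : 0 < d)
    (hgap : ∀ x, embed ι u x = 0 → d * ‖x‖ ≤ ‖LPCfull ι M L00 μ u x - ν • x‖)
    (hν : 2 + Δt * ν < 0) {x : V} (hx : embed ι u x = 0) :
    (1 + Δt * ν) ^ 2 * gapForm ι M L00 μ u ν x x
        + Δt * (-(2 + Δt * ν)) * (c * d ^ 2) * ‖x‖ ^ 2 ≤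
      gapForm ι M L00 μ u ν (x + Δt • LPCfull ι M L00 μ u x)
        (x + Δt • LPCfull ι M L00 μ u x) := by
  set G := LPCfull ι M L00 μ u with hG
  have hGS : ∀ y, embed ι u (G y) = 0 := embed_LPCfull ι M L00 μ u
  have hsym : ∀ y z, embed ι u y = 0 → embed ι u z = 0 → M.op (G y) z = M.op y (G z) := by
    intro y z hy hz
    rw [M.hermitian y, hG, op_LPCfull ι M L00 μ hu y hz, op_LPCfull ι M L00 μ hu z hy,
      M.hermitian]
  set g := G x - ν • x with hg
  have hgS : embed ι u g = 0 := by rw [hg, map_sub, hGS, map_smul, hx]; simp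
  have h1 : c * d ^ 2 * ‖x‖ ^ 2 ≤ M.op g g := by
    calc c * d ^ 2 * ‖x‖ ^ 2 = c * (d * ‖x‖) ^ 2 := by ring
      _ ≤ c * ‖g‖ ^ 2 := by gcongr; exact hgap x hx
      _ ≤ _ := hco g
  have h2 : M.op (G g) g ≤ 0 := op_LPCfull_self_nonpos ι M L00 μ hu hgS
  have hGx : G x = g + ν • x := by rw [hg]; abel
  have h3 : M.op (G g) x = M.op g g + ν * M.op g x := by
    rw [hsym g x hgS hx, hGx]; simp
  have h4 : x + Δt • G x = (1 + Δt * ν) • x + Δt • g := by rw [hGx]; module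
  have h5 : M.op x g = M.op g x := M.hermitian _ _
  have h6 : gapForm ι M L00 μ u ν x x = -M.op g x := by
    rw [gapForm_apply, ← hG, hGx]; simp
  have h7 : gapForm ι M L00 μ u ν (x + Δt • G x) (x + Δt • G x) =
      (1 + Δt * ν) ^ 2 * -M.op g x - (2 * Δt * (1 + Δt * ν) - Δt ^ 2 * ν) * M.op g g
        - Δt ^ 2 * M.op (G g) g := by
    rw [h4, gapForm_apply, ← hG]
    simp only [map_add, map_smul, _root_.add_apply, _root_.smul_apply, smul_eq_mul, hGx, h3, h5]
    ring
  rw [h7, h6]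
  have h8 : Δt * (-(2 + Δt * ν)) * (c * d ^ 2 * ‖x‖ ^ 2) ≤
      Δt * (-(2 + Δt * ν)) * M.op g g := by
    have : 0 ≤ Δt * (-(2 + Δt * ν)) := mul_nonneg hΔ0.le (by linarith)
    gcongr
  have h9 : Δt ^ 2 * M.op (G g) g ≤ 0 := mul_nonpos_of_nonneg_of_nonpos (sq_nonneg _) h2
  linarith

/-- Near `u`, the step expands the differences of elements of equal power with respect to the
indefinite form `⟨(ν - 𝓛_PC) x, x⟩`, for `ν` outside the spectrum. -/
theorem exists_gapForm_expanding {F : V → V}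
    (hF : HasLipFDerivAt F
      (radialProj ι u ∘L (ContinuousLinearMap.id ℝ V + Δt • LPCfull ι M L00 μ u)) u)
    (hu : embed ι u ≠ 0) (hΔ0 : 0 < Δt) {ν : ℝ}
    (hν : ν ∉ spectrum ℝ (LPC ι M L00 μ u)) (hν2 : 2 + Δt * ν < 0) :
    ∃ r > 0, ∀ v w, ‖v - u‖ < r → ‖w - u‖ < r → power ι v = power ι w →
      (1 + Δt * ν) ^ 2 * gapForm ι M L00 μ u ν (v - w) (v - w) ≤
        gapForm ι M L00 μ u ν (F v - F w) (F v - F w) := by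
  obtain ⟨c, hc, hco⟩ := M.exists_coercive
  obtain ⟨d, hd, hgap⟩ := exists_bound_LPCfull ι M L00 μ u hν
  set b := gapForm ι M L00 μ u ν
  set G := LPCfull ι M L00 μ u
  set κ := Δt * (-(2 + Δt * ν)) * (c * d ^ 2) with hκ
  have hκ0 : 0 < κ := by
    have : 0 < -(2 + Δt * ν) := by linarith
    positivity
  set A := ‖b‖ * (2 * (1 + Δt * ‖G‖) + 1) + (1 + Δt * ν) ^ 2 * (‖b‖ * 3) with hA
  have hA0 : 0 ≤ A := by positivity
  -- The nonlinear errors in both forms total at most `η * A * ‖y‖ ^ 2`, which the surplus `κ * ‖y‖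
  -- ^ 2` of the linear step absorbs.
  set η := min 1 (κ / (A + 1)) with hη
  have hη0 : 0 < η := by positivity
  have hη1 : η ≤ 1 := min_le_left _ _
  have hηA : η * A ≤ κ := by
    have : η ≤ κ / (A + 1) := min_le_right _ _
    rw [le_div_iff₀ (by positivity)] at this
    linarith
  obtain ⟨r, hr, h⟩ := exists_step_sub_le ι M L00 hF hu hη0
  refine ⟨r, hr, fun v w hv hw hp => ?_⟩
  obtain ⟨d1, d2⟩ := h v w hv hw hp
  set n := v - w
  set y := orthProj ι M u n
  have hyS : embed ι u y = 0 := embed_orthProj ι M hu n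
  change ‖F v - F w - (y + Δt • G y)‖ ≤ η * ‖y‖ at d2
  set Ty := y + Δt • G y with hTy
  have hTyn : ‖Ty‖ ≤ (1 + Δt * ‖G‖) * ‖y‖ := by
    calc ‖Ty‖ ≤ ‖y‖ + Δt * (‖G‖ * ‖y‖) := by
          refine (norm_add_le _ _).trans ?_
          rw [norm_smul, Real.norm_of_nonneg hΔ0.le]
          gcongr
          exact G.le_opNorm y
      _ = _ := by ring
  have hη1y : η * ‖y‖ ≤ 1 * ‖y‖ := by gcongr
  have e1 : |b (F v - F w) (F v - F w) - b Ty Ty| ≤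
      ‖b‖ * (2 * (1 + Δt * ‖G‖) + 1) * η * ‖y‖ ^ 2 := by
    refine (b.abs_apply_self_sub_le _ _).trans ?_
    have : ‖F v - F w‖ ≤ ‖F v - F w - Ty‖ + ‖Ty‖ := by
      have := norm_add_le (F v - F w - Ty) Ty
      rwa [sub_add_cancel] at this
    calc _ ≤ ‖b‖ * (η * ‖y‖) * ((2 * (1 + Δt * ‖G‖) + 1) * ‖y‖) := by
          gcongr
          linarith
      _ = _ := by ring
  have e2 : |b n n - b y y| ≤ ‖b‖ * 3 * η * ‖y‖ ^ 2 := by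
    refine (b.abs_apply_self_sub_le _ _).trans ?_
    have : ‖n‖ ≤ ‖n - y‖ + ‖y‖ := by
      have := norm_add_le (n - y) y
      rwa [sub_add_cancel] at this
    calc _ ≤ ‖b‖ * (η * ‖y‖) * (3 * ‖y‖) := by
          gcongr
          linarith
      _ = _ := by ring
  have e3 : (1 + Δt * ν) ^ 2 * b y y + κ * ‖y‖ ^ 2 ≤ b Ty Ty :=
    gapForm_step_ge ι M L00 hu hΔ0 hc hco hd hgap hν2 hyS
  have e4 : η * A * ‖y‖ ^ 2 ≤ κ * ‖y‖ ^ 2 := by gcongr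
  have e5 : (1 + Δt * ν) ^ 2 * b n n ≤
      (1 + Δt * ν) ^ 2 * (b y y + ‖b‖ * 3 * η * ‖y‖ ^ 2) := by
    gcongr
    linarith [(abs_le.1 e2).2]
  have e6 := (abs_le.1 e1).1
  have e7 : η * A * ‖y‖ ^ 2 = ‖b‖ * (2 * (1 + Δt * ‖G‖) + 1) * η * ‖y‖ ^ 2
      + (1 + Δt * ν) ^ 2 * (‖b‖ * 3 * η * ‖y‖ ^ 2) := by rw [hA]; ring
  linarith

theorem exists_gapForm_pos [CompleteSpace V] (hu : embed ι u ≠ 0)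
    (hlam : lam ∈ spectrum ℝ (LPC ι M L00 μ u)) {ν : ℝ} (hν : lam < ν) :
    ∃ x, embed ι u x = 0 ∧ 0 < gapForm ι M L00 μ u ν x x := by
  obtain ⟨c, hc, hco⟩ := M.exists_coercive
  set m := ‖(M.op : V →L[ℝ] StrongDual ℝ V)‖
  have hνl : 0 < ν - lam := by linarith
  obtain ⟨x, hx0, hxS, hx⟩ := exists_approx_eigenvector_LPCfull ι M L00 μ hu hlam
    (η := c * (ν - lam) / (2 * (m + 1))) (by positivity)
  refine ⟨x, hxS, ?_⟩
  have hm : 0 < m + 1 := by positivity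
  have hnx : 0 < ‖x‖ := norm_pos_iff.2 hx0
  set e := LPCfull ι M L00 μ u x - lam • x with he
  have h1 : |M.op e x| ≤ c * (ν - lam) / 2 * ‖x‖ ^ 2 := by
    calc |M.op e x| ≤ m * ‖e‖ * ‖x‖ := (M.op : V →L[ℝ] StrongDual ℝ V).le_opNorm₂ e x
      _ ≤ (m + 1) * (c * (ν - lam) / (2 * (m + 1)) * ‖x‖) * ‖x‖ := by
        gcongr
        linarith
      _ = _ := by field_simp
  have h2 : gapForm ι M L00 μ u ν x x = (ν - lam) * M.op x x - M.op e x := by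
    rw [gapForm_apply, he]
    simp only [map_sub, map_smul, _root_.sub_apply, _root_.smul_apply, smul_eq_mul]
    ring
  have h3 : (ν - lam) * (c * ‖x‖ ^ 2) ≤ (ν - lam) * M.op x x := by
    gcongr; exact hco x
  have h4 : 0 < (ν - lam) * (c * ‖x‖ ^ 2) := by positivity
  rw [h2]
  linarith [le_abs_self (M.op e x)]

/-- Every element of the given power near `u` can be perturbed, within that power, in a
direction on which a given form is positive. -/
theorem exists_perturbation_pos (hP : power ι u ≠ 0) (b : V →L[ℝ] StrongDual ℝ V) {x : V}
    (hx : embed ι u x = 0) (hb : 0 < b x x) :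
    ∃ r > 0, ∀ v, ‖v - u‖ < r → power ι v = power ι u → ∀ δ > 0, ∃ w, ‖w - v‖ < δ ∧
      power ι w = power ι u ∧ 0 < b (w - v) (w - v) := by
  have hx0 : x ≠ 0 := by rintro rfl; simp at hb
  have hnx : 0 < ‖x‖ := norm_pos_iff.2 hx0
  -- With this `η`, rescaling to the given power changes the form by at most three quarters of its
  -- value at `t • x`.
  set η := min 1 (b x x / (4 * (‖b‖ + 1) * ‖x‖ ^ 2)) with hη
  have hη0 : 0 < η := by positivity
  have hη1 : η ≤ 1 := min_le_left _ _
  have hηb : η * (4 * (‖b‖ + 1) * ‖x‖ ^ 2) ≤ b x x := by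
    have : η ≤ b x x / (4 * (‖b‖ + 1) * ‖x‖ ^ 2) := min_le_right _ _
    rwa [le_div_iff₀ (by positivity)] at this
  obtain ⟨r₁, hr₁, h₁⟩ := (normalize_hasLipFDerivAt ι hP).exists_ball hη0
  obtain ⟨r₂, hr₂, h₂⟩ := Metric.eventually_nhds_iff_ball.1
    ((contDiff_power ι).continuous.continuousAt.eventually_ne hP)
  set r := min r₁ r₂ / 2 with hr
  have hr0 : 0 < r := by positivity
  refine ⟨r, hr0, fun v hv hvP δ hδ => ?_⟩
  set t := min r (δ / 3) / ‖x‖ with ht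
  have ht0 : 0 < t := by positivity
  have htx : t * ‖x‖ = min r (δ / 3) := div_mul_cancel₀ _ hnx.ne'
  have htr : t * ‖x‖ ≤ r := htx ▸ min_le_left _ _
  have htδ : t * ‖x‖ ≤ δ / 3 := htx ▸ min_le_right _ _
  have hntx : ‖t • x‖ = t * ‖x‖ := by rw [norm_smul, Real.norm_of_nonneg ht0.le]
  have hvt : ‖v + t • x - u‖ < min r₁ r₂ := by
    calc ‖v + t • x - u‖ = ‖(v - u) + t • x‖ := by congr 1; abel
      _ ≤ ‖v - u‖ + ‖t • x‖ := norm_add_le _ _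
      _ < r + r := by rw [hntx]; linarith
      _ = _ := by rw [hr]; ring
  have hvr : ‖v - u‖ < r₁ := hv.trans_le (by
    have : min r₁ r₂ ≤ r₁ := min_le_left _ _
    have : 0 < min r₁ r₂ := lt_min hr₁ hr₂
    linarith)
  set w := normalize ι (power ι u) (v + t • x) with hw
  have hwP : power ι w = power ι u := power_normalize ι (power_nonneg ι u)
    (h₂ _ (by rw [mem_ball_iff_norm]; exact hvt.trans_le (min_le_right _ _)))
  have he : ‖(w - v) - t • x‖ ≤ η * (t * ‖x‖) := by
    have := h₁ (v + t • x) v (hvt.trans_le (min_le_left _ _)) hvr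
    rwa [normalize_of_power_eq ι hP hvP, add_sub_cancel_left,
      radialProj_of_embed_eq_zero ι (by rw [map_smul, hx, smul_zero]), hntx] at this
  have hηt : η * (t * ‖x‖) ≤ 1 * (t * ‖x‖) := by gcongr
  have hwv : ‖w - v‖ ≤ 2 * (t * ‖x‖) := by
    have := norm_add_le ((w - v) - t • x) (t • x)
    rw [sub_add_cancel, hntx] at this
    linarith
  refine ⟨w, by linarith, hwP, ?_⟩
  have h3 := b.abs_apply_self_sub_le (w - v) (t • x)
  have h4 : ‖b‖ * ‖w - v - t • x‖ * (‖w - v‖ + ‖t • x‖) ≤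
      (‖b‖ + 1) * (η * (t * ‖x‖)) * (2 * (t * ‖x‖) + t * ‖x‖) := by
    rw [hntx]
    gcongr
    linarith
  have h5 : (‖b‖ + 1) * (η * (t * ‖x‖)) * (2 * (t * ‖x‖) + t * ‖x‖) =
      t ^ 2 * (3 / 4 * (η * (4 * (‖b‖ + 1) * ‖x‖ ^ 2))) := by ring
  have h6 : t ^ 2 * (3 / 4 * (η * (4 * (‖b‖ + 1) * ‖x‖ ^ 2))) ≤ t ^ 2 * (3 / 4 * b x x) := by
    gcongr
  have h7 : b (t • x) (t • x) = t ^ 2 * b x x := by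
    simp only [map_smul, _root_.smul_apply, smul_eq_mul]; ring
  have h8 : 0 < t ^ 2 * b x x := by positivity
  have h9 := (abs_le.1 h3).1
  rw [h7] at h9
  linarith

/-- If the orbit of `v` stays near `u`, a nearby `w` with `b (w - v) (w - v) > 0` must escape: while
both orbits stay, the form of their difference grows geometrically, yet it is bounded. -/
theorem divergesGenerically [CompleteSpace V] (hP : power ι u ≠ 0) (h0 : L0 ι L00 μ u = 0)
    (hL : HasLipFDerivAt L00 (fderiv ℝ L00 u) u) (hX : LipschitzNear (fderiv ℝ L00) u)
    (hlam : lam ∈ spectrum ℝ (LPC ι M L00 μ u)) (hΔ0 : 0 < Δt) {ν : ℝ}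
    (hν : ν ∉ spectrum ℝ (LPC ι M L00 μ u)) (hν1 : lam < ν) (hν2 : 2 + Δt * ν < 0) :
    DivergesGenerically ι M L00 u (power ι u) Δt := by
  have hu := embed_ne_zero_of_power ι hP
  set F := step ι M L00 (power ι u) Δt with hF_def
  have hF := step_hasLipFDerivAt ι M L00 Δt hP h0 hL hX
  set b := gapForm ι M L00 μ u ν with hb
  obtain ⟨x, hxS, hx⟩ := exists_gapForm_pos ι M L00 hu hlam hν1
  obtain ⟨r₁, hr₁, hexp⟩ := exists_gapForm_expanding ι M L00 hF hu hΔ0 hν hν2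
  obtain ⟨r₂, hr₂, hpert⟩ := exists_perturbation_pos ι hP b hxS hx
  obtain ⟨r₃, hr₃, hpow⟩ := Metric.eventually_nhds_iff_ball.1
    (eventually_power_step ι M L00 (Δt := Δt) hP h0 hL hX)
  set ε := min r₁ (min r₂ r₃) with hε
  have hε0 : 0 < ε := by positivity
  refine ⟨ε, hε0, fun v hv hvP δ hδ => ?_⟩
  by_cases hesc : ∃ n, ε ≤ ‖iterates ι M L00 (power ι u) Δt v n - u‖
  · exact ⟨v, by simpa using hδ, hvP, hesc⟩
  obtain ⟨w, hwv, hwP, hq⟩ := hpert v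
    (hv.trans_le ((min_le_right _ _).trans (min_le_left _ _))) hvP δ hδ
  refine ⟨w, hwv, hwP, ?_⟩
  push Not at hesc
  by_contra! hstay
  have hiter : ∀ a, power ι a = power ι u →
      (∀ n, ‖iterates ι M L00 (power ι u) Δt a n - u‖ < ε) →
      ∀ n, power ι (iterates ι M L00 (power ι u) Δt a n) = power ι u := by
    intro a ha hn n
    cases n with
    | zero => exact ha
    | succ n =>
      rw [iterates, Function.iterate_succ_apply']
      refine hpow _ ?_
      rw [mem_ball_iff_norm]
      exact (hn n).trans_le ((min_le_right _ _).trans (min_le_right _ _))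
  set x : ℕ → V := fun n => iterates ι M L00 (power ι u) Δt w n with hx_def
  set y : ℕ → V := fun n => iterates ι M L00 (power ι u) Δt v n with hy_def
  have hxs : ∀ n, x (n + 1) = F (x n) := fun n => Function.iterate_succ_apply' _ n w
  have hys : ∀ n, y (n + 1) = F (y n) := fun n => Function.iterate_succ_apply' _ n v
  have hgrow : ∀ n, ((1 + Δt * ν) ^ 2) ^ n * b (w - v) (w - v) ≤ b (x n - y n) (x n - y n) := by
    intro n
    induction n with
    | zero => rw [pow_zero, one_mul]; exact le_rfl
    | succ n ih =>
      rw [hxs, hys, pow_succ', mul_assoc]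
      refine le_trans (by gcongr) (hexp (x n) (y n) ((hstay n).trans_le (min_le_left _ _))
        ((hesc n).trans_le (min_le_left _ _)) ?_)
      rw [hiter w hwP hstay, hiter v hvP hesc]
  have hbd : ∀ n, b (x n - y n) (x n - y n) ≤ ‖b‖ * (2 * ε) ^ 2 := by
    intro n
    refine (b.apply_apply_le_sq _).trans ?_
    gcongr
    calc ‖x n - y n‖ = ‖(x n - u) - (y n - u)‖ := by congr 1; abel
      _ ≤ ‖x n - u‖ + ‖y n - u‖ := norm_sub_le _ _
      _ ≤ 2 * ε := by linarith [hstay n, hesc n]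
  have hτ : 1 < (1 + Δt * ν) ^ 2 := by
    rw [one_lt_sq_iff_one_lt_abs, lt_abs]
    right; linarith
  obtain ⟨n, hn⟩ := pow_unbounded_of_one_lt (‖b‖ * (2 * ε) ^ 2 / b (w - v) (w - v)) hτ
  rw [div_lt_iff₀ hq] at hn
  linarith [hgrow n, hbd n]

end PCSOM

end

/-! ### Closedness of the spectrum, and the final assembly -/

theorem ContinuousLinearMap.isClosed_spectrum {X : Type*} [NormedAddCommGroup X] [NormedSpace ℝ X]
    [CompleteSpace X] (T : X →L[ℝ] X) : IsClosed (spectrum ℝ T) :=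
  spectrum.isClosed T

theorem PCSOM.isClosed_spectrum_LPC {V H : Type*} [NormedAddCommGroup V] [NormedSpace ℝ V]
    [CompleteSpace V] [NormedAddCommGroup H] [InnerProductSpace ℝ H] (ι : V →L[ℝ] H)
    (M : AccelerationOperator V) (L00 : V → StrongDual ℝ V) (μ : ℝ) (u : V) :
    IsClosed (spectrum ℝ (PCSOM.LPC ι M L00 μ u)) := by
  have : CompleteSpace (PCSOM.orthSpace ι u) :=
    (PCSOM.isClosed_orthSpace ι u).completeSpace_coe
  exact ContinuousLinearMap.isClosed_spectrum _

theorem theorem3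
    {V H : Type*} [NormedAddCommGroup V] [NormedSpace ℝ V] [CompleteSpace V]
    [NormedAddCommGroup H] [InnerProductSpace ℝ H]
    -- the inclusion of the energy space `V` of `M` in `H`
    (ι : V →L[ℝ] H) (hι : Function.Injective ι)
    (M : AccelerationOperator V) (L00 : V → StrongDual ℝ V)
    -- the solitary wave `u = u(x; μ, c₀)` and the family of solutions it belongs to
    {s : ℕ} (U : ℝ → (Fin s → ℝ) → V) (μ : ℝ) (c₀ : Fin s → ℝ)
    (u : V) (hu : u = U μ c₀) (hU : PCSOM.IsSolutionFamily ι L00 U μ c₀)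
    -- near `u` the operator `L₀₀` has a Lipschitz continuous derivative
    (hdiff : ∀ᶠ v in 𝓝 u, DifferentiableAt ℝ L00 v)
    (hLip : ∃ K, ∃ W ∈ 𝓝 u, LipschitzOnWith K (fderiv ℝ L00) W)
    -- the kernel of `L₁` consists of the invariance modes only
    (hker : LinearMap.ker (PCSOM.L1 ι L00 μ u : V →ₗ[ℝ] StrongDual ℝ V) =
      Submodule.span ℝ (Set.range (PCSOM.invarianceMode U μ c₀)))
    -- `u` is orthogonal to the kernel of `L₁`
    (horth : ∀ Ψ : V, PCSOM.L1 ι L00 μ u Ψ = 0 → PCSOM.ip ι u Ψ = 0)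
    -- `P` is the power of `u`, and `P'(μ) ≠ 0`
    (P : ℝ) (hP : P = PCSOM.power ι u)
    (hP' : deriv (fun m => PCSOM.power ι (U m c₀)) μ ≠ 0)
    -- `Λmin` is the minimum of the spectrum of `𝓛_PC` on `S`
    (Λmin : ℝ) (hΛ : IsLeast (spectrum ℝ (PCSOM.LPC ι M L00 μ u)) Λmin) (hΛ0 : Λmin ≠ 0) :
    -- convergence, zero not being in the continuous spectrum of `L₁`
    (IsClosed (Set.range (PCSOM.L1 ι L00 μ u)) →
      ∀ Δt : ℝ, 0 < Δt → Δt < -2 / Λmin → PCSOM.ConvergesNear ι M L00 U μ c₀ P Δt) ∧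
    -- divergence, for generic initial conditions unless the spectrum is continuous
    -- all the way from `Λmin` to `-2 / Δt`
    (∀ Δt : ℝ, -2 / Λmin < Δt → PCSOM.DivergesFrom ι M L00 u P Δt ∧
      (¬ Set.Icc Λmin (-2 / Δt) ⊆ spectrum ℝ (PCSOM.LPC ι M L00 μ u) →
        PCSOM.DivergesGenerically ι M L00 u P Δt)) := by
  have hX : LipschitzNear (fderiv ℝ L00) u := by
    obtain ⟨k, W, hW, h⟩ := hLip
    exact .of_lipschitzOnWith hW h
  have hL : HasLipFDerivAt L00 (fderiv ℝ L00 u) u := .of_lipschitzNear_fderiv hdiff hX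
  subst hu
  set u := U μ c₀
  have h0 : PCSOM.L0 ι L00 μ u = 0 := hU.2.self_of_nhds
  -- Zero power would give `P'(μ) = 2⟨u, ∂u/∂μ⟩ = 0`.
  have hPu : PCSOM.power ι u ≠ 0 := by
    intro h
    obtain ⟨D, -, -, -, hDP⟩ := hU.exists_deriv ι L00 hdiff.self_of_nhds
    refine hP' ?_
    have h1 : ι u = 0 := by
      rw [PCSOM.power_eq_norm_sq] at h
      exact norm_eq_zero.1 (by simpa using h)
    rw [hDP, PCSOM.embed_apply, PCSOM.ip, h1, inner_zero_left, mul_zero]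
  have hu := PCSOM.embed_ne_zero_of_power ι hPu
  have hΛneg : Λmin < 0 :=
    lt_of_le_of_ne (PCSOM.isLeast_nonpos ι M L00 μ hu hΛ) hΛ0
  subst hP
  refine ⟨fun hcl Δt hΔ0 hΔ => ?_, fun Δt hΔ => ?_⟩
  · refine PCSOM.convergesNear ι M L00 hU hdiff hL hX hker horth hPu hP' hΛ hcl hΔ0 ?_
    rw [lt_div_iff_of_neg hΛneg] at hΔ
    linarith
  · have hΔ0 : 0 < Δt := (div_pos_of_neg_of_neg (by norm_num) hΛneg).trans hΔ
    rw [div_lt_iff_of_neg hΛneg] at hΔ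
    refine ⟨PCSOM.divergesFrom ι M L00 hPu h0 hL hX hΛ hΔ0 (by linarith), fun hgap => ?_⟩
    obtain ⟨ν₁, ⟨hν1, hν2⟩, hν⟩ := Set.not_subset.1 hgap
    have hne : Λmin ≠ ν₁ := fun h => hν (h ▸ hΛ.1)
    have hopen := (PCSOM.isClosed_spectrum_LPC ι M L00 μ u).isOpen_compl
    -- The missing point may be the endpoint `-2 / Δt`, where nothing expands strictly. As the
    -- spectrum is closed, it can be moved slightly to the left.
    have hIoo : ∀ᶠ ν in 𝓝[<] ν₁, ν ∈ Set.Ioo Λmin ν₁ :=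
      Ioo_mem_nhdsLT (lt_of_le_of_ne hν1 hne)
    obtain ⟨ν, hνmem, hνs⟩ := (hIoo.and
      (mem_nhdsWithin_of_mem_nhds (hopen.mem_nhds hν))).exists
    refine PCSOM.divergesGenerically ι M L00 hPu h0 hL hX hΛ.1 hΔ0 hνs hνmem.1 ?_
    have h1 : ν < -2 / Δt := hνmem.2.trans_le hν2
    rw [lt_div_iff₀ hΔ0] at h1
    linarith
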